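/- Let $f(x)=\int_0^x\cos\left(\frac{\pi}{2}t^2\right)dt$ be the Fresnel cosine and let $R$ be the series reversion of its Taylor series at $0$, i.e. the unique formal power series without constant term such that $f(R(x))=x$. Then $R$ contains only powers $x^{4k+1}$ and $$R(x)=x+\tfrac{\pi^2}{40}x^5+\tfrac{49\pi^4}{17280}x^9+\tfrac{4019\pi^6}{8985600}x^{13}+\tfrac{42037157\pi^8}{513257472000}x^{17}+\tfrac{21129194183\pi^{10}}{1293408829440000}x^{21}+\cdots.$$ Let $g$ be the sum of the sign-alternated series, in which the coefficient of $x^{4k+1}$ is multiplied by $(-1)^k$; its radius of convergence $\rho$ is positive. **Algorithm.** Write a series as $x+\sum_{m\ge1}a_mx^{m\tau+1}$ with $a_1<0$; for $f$ and $g$ we have $\tau=4$. Let $(-t)_k=(-t)(-t-1)\cdots(-t-k+1)$, and for a tuple $v=(v_1,\dots,v_k)$ let $$S_{k,m,s}(v)=\sum\binom{m-s}{n_1,\dots,n_k}v_1^{n_1}\cdots v_k^{n_k},$$ summed over integers $n_i\ge0$ with $\sum_i i\,n_i=m$ and $\sum_i n_i=m-s$. Put $\lambda=-1/(\tau a_1)$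 and $$b_j=\lambda^{j+1}\sum_{s=0}^{j}\tfrac{(-\tau)_{j+1-s}}{(j+1-s)!}S_{7,j+1,s}(a_1,\dots,a_7)\quad(1\le j\le 6),$$ $$a_{0,j}=\sum_{s=0}^{j-1}\tfrac{(-1)^{j-1-s}}{j-s}S_{7,j,s}(1,b_1,\dots,b_6)\quad(1\le j\le 6),$$ $$a_{i,j}=\sum_{s=0}^{j-i-1}\tfrac{(-i)_{j-i-s}}{(j-i-s)!}S_{7,j-i,s}(1,b_1,\dots,b_6)\quad(1\le i<j\le 6),$$ $$c_0=-b_1,\qquad c_i=\tfrac1i\Big(b_{i+1}+\sum_{h=0}^{i-1}a_{h,i+1}c_h\Big)\quad(1\le i\le5).$$ Put $T_1=X$, $T_2=b_1X-c_1$ and, for $2\le m\le5$, $$T_{m+1}=b_1\sum_{s=0}^{m-1}\tfrac{(-1)^{m-1-s}}{m-s}S_{m,m,s}(T_1,\dots,T_m)-c_m-\sum_{p=1}^{m-1}c_p\sum_{q=1}^{m-p}\tfrac{(-p)_q}{q!}S_{m,m-p,m-p-q}(T_1,\dots,T_m).$$ With $\widetilde T_m(X)=T_m(-\tau X)$, put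 $P_0=1$, $P_1=X$ and, for $2\le m\le6$, $$P_m=\sum_{s=0}^{m-1}\tfrac{(-1/\tau)_{m-s}}{(m-s)!}S_{6,m,s}(\widetilde T_1,\dots,\widetilde T_6).$$ **Parameters of $g$.** For $g$ one has $\lambda=10/\pi^2$ and - $(b_j)_{j=1}^6=\left(-\frac{55}{108},\frac{80}{117},-\frac{1613305}{1388016},\frac{343709}{154791},-\frac{181191932495}{39810678336},\frac{7036909925}{719512794}\right)$; - $(a_{0,j})_{j=1}^6=\left(1,-\frac{109}{108},\frac{2143}{1404},-\frac{98701909}{36088416},\frac{3497783}{649740},-\frac{65830792020265}{5852169715392}\right)$; - $(c_i)_{i=1}^5=\left(\frac{25745}{151632},-\frac{250903475}{3897548928},\frac{124092693449}{3379862723328},-\frac{2012588028078415}{91012943413776384},\frac{168154016370424766095}{15749152767150106816512}\right)$; - $T_2=-\frac{55}{108}X-\frac{25745}{151632}$, $\ T_3=\frac{55}{216}X^2+\frac{1205}{2808}X+\frac{587905525}{3897548928}$, $\ T_4=-\frac{55}{324}X^3-\frac{169465}{303264}X^2-\frac{1013788675}{1948774464}X-\frac{16359252550091}{114915332593152}$;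 - $P_2=\frac52X^2-\frac{55}{108}X+\frac{25745}{606528}$, $\ P_3=\frac{15}2X^3-\frac{385}{108}X^2+\frac{389005}{606528}X-\frac{587905525}{15590195712}$, $\ P_4=\frac{195}8X^4-\frac{12485}{648}X^3+\frac{62045}{10368}X^2-\frac{12734847275}{15590195712}X+\frac{73718758987739}{1838645321490432}$. **Expansion for $g$.** Let $\kappa=\sqrt{5/8}/\pi$. For every $0<x_0<\rho$ the sequence $x_n=g(x_{n-1})$ is positive and strictly decreasing, and there is a constant $C=C(x_0)$ such that, as $n\to\infty$, $$x_n=\Big(\frac{\lambda}{n}\Big)^{1/4}\Big\{1+\sum_{m=1}^4P_m\Big(-\tfrac14\left[b_1\ln n+C\right]\Big)\frac1{n^m}\Big\}+o(n^{-17/4})\qquad\text{(A)}$$ and, with the same $C$, $$\frac{x_n}{\sqrt\kappa}=\sum_{m=0}^{4}\sum_{j=0}^{m}K_{m,j}(C)\frac{\ln(n)^j}{n^{m+1/4}}+o(n^{-17/4}),$$ where - $K_{0,0}=2$; - $K_{1,1}=\frac{55}{216}$, $\ K_{1,0}=-\frac C2$; - $K_{2,2}=\frac{15125}{186624}$, $\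 K_{2,1}=-\left(\frac{275}{864}C+\frac{3025}{23328}\right)$, $\ K_{2,0}=\frac5{16}C^2+\frac{55}{216}C+\frac{25745}{303264}$; - $K_{3,3}=\frac{831875}{26873856}$, $\ K_{3,2}=-\left(\frac{15125}{82944}C+\frac{1164625}{10077696}\right)$, $\ K_{3,1}=\frac{275}{768}C^2+\frac{21175}{46656}C+\frac{21395275}{131010048}$, $\ K_{3,0}=-\left(\frac{15}{64}C^3+\frac{385}{864}C^2+\frac{389005}{1213056}C+\frac{587905525}{7795097856}\right)$; - $K_{4,4}=\frac{594790625}{46438023168}$, $\ K_{4,3}=-\left(\frac{10814375}{107495424}C+\frac{2077191875}{26121388032}\right)$, $\ K_{4,2}=\frac{196625}{663552}C^2+\frac{37767125}{80621568}C+\frac{187686125}{967458816}$, $\ K_{4,1}=-\left(\frac{3575}{9216}C^3+\frac{686675}{746496}C^2+\frac{3412475}{4478976}C+\frac{700416600125}{3367482273792}\right)$, $\ K_{4,0}=\frac{195}{1024}C^4+\frac{12485}{20736}C^3+\frac{62045}{82944}C^2+\frac{12734847275}{31180391424}C+\frac{73718758987739}{919322660745216}$. **Kindredness with $f$.** For every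 $x_0>0$ the sequence $x_n=f(x_{n-1})$ is positive and strictly decreasing, and there is a constant $C=C(x_0)$ such that formula (A) holds with the parameters $\lambda,b_1,P_m$ of $f$ and $-C$ in place of $C$ (formula (B)), and $$\frac{x_n}{\sqrt\kappa}=\sum_{m=0}^{4}\sum_{j=0}^{m}(-1)^mK_{m,j}(C)\frac{\ln(n)^j}{n^{m+1/4}}+o(n^{-17/4}).$$ Thus corresponding coefficients of the two expansions agree up to sign. Likewise $\lambda^f=\lambda^g$, $b_1^f=-b_1^g$, $c_i^g=(-1)^{i+1}c_i^f$ for $1\le i\le5$, $T_m^g(X)=(-1)^mT_m^f(-X)$ for $1\le m\le4$, and $P_m^g(X)=(-1)^mP_m^f(-X)$ for $0\le m\le4$. -/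

import Mathlib

open Finset Filter Asymptotics
open scoped ENNReal Polynomial

namespace Kindred

noncomputable section

/-! ### The Fresnel cosine, its reversion, and the function `g` -/

/-- The Fresnel cosine `f(x) = ∫₀ˣ cos(π t² / 2) dt`. -/
def fresnelC (x : ℝ) : ℝ := ∫ t in (0 : ℝ)..x, Real.cos (Real.pi / 2 * t ^ 2)

/-- The Taylor series of `f` at the origin, as a formal power series. -/
def taylorSeries (f : ℝ → ℝ) : PowerSeries ℝ :=
  PowerSeries.mk fun n => iteratedDeriv n f 0 / (n.factorial : ℝ)

/-- `G` is a series reversion of `F`: it has no constant term and `F(G(x)) = x`. -/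
def IsReversion (F G : PowerSeries ℝ) : Prop :=
  PowerSeries.constantCoeff G = 0 ∧ PowerSeries.subst G F = PowerSeries.X

/-- The series reversion of `F` (meaningful when it exists uniquely, which the theorem asserts
for the series at hand). -/
def reversion (F : PowerSeries ℝ) : PowerSeries ℝ := Classical.epsilon (IsReversion F)

/-- Sign alternation with gap `τ`: `∑ r_k x^(kτ+1)` becomes `∑ (-1)^k r_k x^(kτ+1)`. -/
def alternate (τ : ℕ) (G : PowerSeries ℝ) : PowerSeries ℝ :=
  PowerSeries.mk fun n => (-1 : ℝ) ^ (n / τ) * PowerSeries.coeff n G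

/-- The radius of convergence of a power series. -/
def radius (A : PowerSeries ℝ) : ℝ≥0∞ :=
  (FormalMultilinearSeries.ofScalars ℝ (fun n => PowerSeries.coeff n A)).radius

/-- The sum of a power series (used inside its disc of convergence). -/
def seriesSum (A : PowerSeries ℝ) (x : ℝ) : ℝ := ∑' n : ℕ, PowerSeries.coeff n A * x ^ n

/-- The Taylor series of the Fresnel cosine. -/
def fSeries : PowerSeries ℝ := taylorSeries fresnelC

/-- The sign-alternated series reversion of the Fresnel cosine. -/
def gSeries : PowerSeries ℝ := alternate 4 (reversion fSeries)

/-- The function `g`, the sum of `gSeries`. -/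
def g (x : ℝ) : ℝ := seriesSum gSeries x

/-- The coefficients `a_m` of a series `x + ∑_{m ≥ 1} a_m x^(mτ+1)`. -/
def gapCoeff (τ : ℕ) (A : PowerSeries ℝ) (m : ℕ) : ℝ := PowerSeries.coeff (m * τ + 1) A

/-! ### The algorithm producing the polynomials `P_m` from `τ` and the coefficients `a_m` -/

/-- `t (t - 1) ⋯ (t - k + 1)`; the symbol `(-t)_k` is `fall (-t) k`. -/
def fall (t : ℝ) (k : ℕ) : ℝ := ∏ i ∈ range k, (t - i)

/-- `∑_{(k,m,s)} (m-s choose n₁, …, n_k) v₁^n₁ ⋯ v_k^n_k`, the sum being over all natural numbers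
`n₁, …, n_k` with `n₁ + 2 n₂ + ⋯ + k n_k = m` and `n₁ + ⋯ + n_k = m - s` (here `s ≤ m`, and
`v i` stands for `v_{i+1}`). -/
def partSum {R : Type*} [CommRing R] (k m s : ℕ) (v : Fin k → R) : R :=
  ∑ n ∈ ((univ : Finset (Fin k)).piAntidiag (m - s)).filter
      (fun n => ∑ i : Fin k, ((i : ℕ) + 1) * n i = m),
    (Nat.multinomial univ n : R) * ∏ i : Fin k, v i ^ n i

/-- `λ = -1 / (τ a₁)`. -/
def lam (τ : ℕ) (a : ℕ → ℝ) : ℝ := -1 / (τ * a 1)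

/-- The numbers `b_j`, `1 ≤ j ≤ 6`. -/
def b (τ : ℕ) (a : ℕ → ℝ) (j : ℕ) : ℝ :=
  lam τ a ^ (j + 1) * ∑ s ∈ range (j + 1),
    fall (-(τ : ℝ)) (j + 1 - s) / ((j + 1 - s).factorial : ℝ) *
      partSum 7 (j + 1) s (fun i => a ((i : ℕ) + 1))

/-- The tuple `(1, b₁, …, b₆)`. -/
def oneB (τ : ℕ) (a : ℕ → ℝ) (i : Fin 7) : ℝ := if (i : ℕ) = 0 then 1 else b τ a i

/-- The numbers `a_{i,j}`, `0 ≤ i < j ≤ 6`. -/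
def aa (τ : ℕ) (a : ℕ → ℝ) (i j : ℕ) : ℝ :=
  if i = 0 then
    ∑ s ∈ range j, (-1 : ℝ) ^ (j - 1 - s) / ((j - s : ℕ) : ℝ) * partSum 7 j s (oneB τ a)
  else
    ∑ s ∈ range (j - i), fall (-(i : ℝ)) (j - i - s) / ((j - i - s).factorial : ℝ) *
      partSum 7 (j - i) s (oneB τ a)

/-- The numbers `c_i`, `0 ≤ i ≤ 5`. -/
def c (τ : ℕ) (a : ℕ → ℝ) : ℕ → ℝ
  | 0 => -b τ a 1
  | i + 1 => 1 / ((i : ℝ) + 1) *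
      (b τ a (i + 2) + ∑ h : Fin (i + 1), aa τ a h (i + 2) * c τ a h)
termination_by i => i
decreasing_by exact h.2

/-- The polynomials `T_m`, `1 ≤ m ≤ 6` (`T 0` is not used). The last clause is the recursion
for `T_{m'+1}` with `m' = m + 1`; for `m' = 1` it is `b₁ X - c₁`. -/
def T (τ : ℕ) (a : ℕ → ℝ) : ℕ → ℝ[X]
  | 0 => 0
  | 1 => Polynomial.X
  | m + 2 =>
      Polynomial.C (b τ a 1) * ∑ s ∈ range (m + 1),
          Polynomial.C ((-1 : ℝ) ^ (m - s) / ((m + 1 - s : ℕ) : ℝ)) *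
            partSum (m + 1) (m + 1) s (fun i : Fin (m + 1) => T τ a ((i : ℕ) + 1))
        - Polynomial.C (c τ a (m + 1))
        - ∑ p ∈ Icc 1 m, Polynomial.C (c τ a p) * ∑ q ∈ Icc 1 (m + 1 - p),
            Polynomial.C (fall (-(p : ℝ)) q / (q.factorial : ℝ)) *
              partSum (m + 1) (m + 1 - p) (m + 1 - p - q)
                (fun i : Fin (m + 1) => T τ a ((i : ℕ) + 1))
termination_by m => m
decreasing_by all_goals (have := i.2; omega)

/-- The polynomials `P_m`, `0 ≤ m ≤ 6`; `T̃_m(X) = T_m(-τ X)`. -/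
def P (τ : ℕ) (a : ℕ → ℝ) : ℕ → ℝ[X]
  | 0 => 1
  | 1 => Polynomial.X
  | m + 2 => ∑ s ∈ range (m + 2),
      Polynomial.C (fall (-(1 / (τ : ℝ))) (m + 2 - s) / ((m + 2 - s).factorial : ℝ)) *
        partSum 6 (m + 2) s
          (fun i : Fin 6 => (T τ a ((i : ℕ) + 1)).comp (Polynomial.C (-(τ : ℝ)) * Polynomial.X))

/-- The right-hand side of formula (A), with the sum over `1 ≤ m ≤ N`:
`(λ/n)^(1/τ) (1 + ∑ P_m(-(1/τ)(b₁ ln n + C)) / n^m)`. Formula (B) is the same with `-C`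
in place of `C`. -/
def formulaA (τ : ℕ) (a : ℕ → ℝ) (N : ℕ) (C : ℝ) (n : ℕ) : ℝ :=
  (lam τ a / n) ^ (1 / (τ : ℝ)) *
    (1 + ∑ m ∈ Icc 1 N,
      (P τ a m).eval (-(1 / (τ : ℝ)) * (b τ a 1 * Real.log n + C)) / (n : ℝ) ^ m)

/-! ### The explicit expansions -/

/-- `κ = √(5/8) / π`. -/
def kappa : ℝ := √(5 / 8) / Real.pi

/-- For the iterates of `g`: the coefficient of `ln(n)^j / n^(m+1/4)`, depending on `C`. -/
def gTerm : ℕ → ℕ → ℝ → ℝ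
  | 0, 0, _ => 2
  | 1, 1, _ => 55 / 216
  | 1, 0, C => -(C / 2)
  | 2, 2, _ => 15125 / 186624
  | 2, 1, C => -(275 / 864 * C + 3025 / 23328)
  | 2, 0, C => 5 / 16 * C ^ 2 + 55 / 216 * C + 25745 / 303264
  | 3, 3, _ => 831875 / 26873856
  | 3, 2, C => -(15125 / 82944 * C + 1164625 / 10077696)
  | 3, 1, C => 275 / 768 * C ^ 2 + 21175 / 46656 * C + 21395275 / 131010048
  | 3, 0, C => -(15 / 64 * C ^ 3 + 385 / 864 * C ^ 2 + 389005 / 1213056 * C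
      + 587905525 / 7795097856)
  | 4, 4, _ => 594790625 / 46438023168
  | 4, 3, C => -(10814375 / 107495424 * C + 2077191875 / 26121388032)
  | 4, 2, C => 196625 / 663552 * C ^ 2 + 37767125 / 80621568 * C + 187686125 / 967458816
  | 4, 1, C => -(3575 / 9216 * C ^ 3 + 686675 / 746496 * C ^ 2 + 3412475 / 4478976 * C
      + 700416600125 / 3367482273792)
  | 4, 0, C => 195 / 1024 * C ^ 4 + 12485 / 20736 * C ^ 3 + 62045 / 82944 * C ^ 2
      + 12734847275 / 31180391424 * C + 73718758987739 / 919322660745216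
  | _, _, _ => 0

/-- For the iterates of the Fresnel cosine: the coefficient of `ln(n)^j / n^(m+1/4)`. -/
def fTerm : ℕ → ℕ → ℝ → ℝ
  | 0, 0, _ => 2
  | 1, 1, _ => -(55 / 216)
  | 1, 0, C => C / 2
  | 2, 2, _ => 15125 / 186624
  | 2, 1, C => -(275 / 864 * C + 3025 / 23328)
  | 2, 0, C => 5 / 16 * C ^ 2 + 55 / 216 * C + 25745 / 303264
  | 3, 3, _ => -(831875 / 26873856)
  | 3, 2, C => 15125 / 82944 * C + 1164625 / 10077696
  | 3, 1, C => -(275 / 768 * C ^ 2 + 21175 / 46656 * C + 21395275 / 131010048)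
  | 3, 0, C => 15 / 64 * C ^ 3 + 385 / 864 * C ^ 2 + 389005 / 1213056 * C
      + 587905525 / 7795097856
  | 4, 4, _ => 594790625 / 46438023168
  | 4, 3, C => -(10814375 / 107495424 * C + 2077191875 / 26121388032)
  | 4, 2, C => 196625 / 663552 * C ^ 2 + 37767125 / 80621568 * C + 187686125 / 967458816
  | 4, 1, C => -(3575 / 9216 * C ^ 3 + 686675 / 746496 * C ^ 2 + 3412475 / 4478976 * C
      + 700416600125 / 3367482273792)
  | 4, 0, C => 195 / 1024 * C ^ 4 + 12485 / 20736 * C ^ 3 + 62045 / 82944 * C ^ 2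
      + 12734847275 / 31180391424 * C + 73718758987739 / 919322660745216
  | _, _, _ => 0

/-- `∑_{m ≤ 4} ∑_{j ≤ m} K_{m,j}(C) ln(n)^j / n^(m+1/4)`. -/
def expansion (K : ℕ → ℕ → ℝ → ℝ) (C : ℝ) (n : ℕ) : ℝ :=
  ∑ m ∈ range 5, ∑ j ∈ range (m + 1), K m j C * Real.log n ^ j / (n : ℝ) ^ ((m : ℝ) + 1 / 4)

/-- `x_n ∼ E_n` to order `n^(-17/4)`: the remainder is `o(n^(-17/4))`. -/
def ExpandsAs (x E : ℕ → ℝ) : Prop :=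
  (fun n : ℕ => x n - E n) =o[atTop] fun n : ℕ => (n : ℝ) ^ (-(17 / 4) : ℝ)

end

end Kindred

/-! Let $F(x)=x+a_1x^5+a_2x^9+\cdots$ with $a_1<0$, let $x_{n+1}=F(x_n)\to0$ with $x_n>0$, and put
$y_n=\lambda/x_n^4$. The choice of $\lambda$ gives $y_{n+1}/y_n=1+1/y_n+b_1/y_n^2+\cdots$. The
numbers $c_i$ are such that the truncated Abel function $A(y)=y-b_1\ln y+\sum_{i\le3}c_iy^{-i}$
satisfies $A(y_{n+1})-A(y_n)=1+o(y_n^{-4})$ (`abelFn_diff`). A Cesàro argument gives $y_n\sim n$, so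
the errors are summable and $A(y_n)=n+C+o(n^{-3})$ (`exists_sub_isLittleO_of_diff`).

With $y_n=n(1+w_n)$ this becomes a fixed point equation $w=\frac{b_1\ln
n+C}{n}+\frac{b_1}{n}\ln(1+w)-\sum_i c_in^{-i-1}(1+w)^{-i}+o(n^{-4})$. Every occurrence of $w$ on
the right carries a factor $1/n$, so each substitution gains one order; the coefficients obtained
are $T_m(b_1\ln n+C)$ (`exists_hasExp_T`). Finally $x_n=(\lambda/n)^{1/4}(1+w_n)^{-1/4}$ produces
the $P_m$ (`exists_expandsAs_formulaA`). The bookkeeping is done by `HasExp`, a calculus of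
expansions in $\delta=1/n$ whose coefficients are polynomials in a slowly growing $X=b_1\ln n+C$;
the sums over partitions in the algorithm are coefficients of composed series (`compCoeff`).

It remains to see that both functions fit this scheme. Alternating the signs of a series in
$x^{4k+1}$ is conjugation by $x\mapsto\zeta x$ with $\zeta^4=-1$, hence commutes with reversion. So
$g$ is the local inverse of $h(x)=\int_0^x\cosh(\pi t^2/2)\,dt$ (`exists_localInverse_gSeries`), and
$h(g(x))=x$ on the whole disc of convergence by the identity theorem (`fresnelCosh_g`). As $h$ has
positive coefficients, $h(x)>x$ for $x>0$, whence $0<g(x)<x$. For the Fresnel cosine, $f(x)<x$ is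
clear and $f(x)>0$ follows from an integration by parts (`fresnelC_pos`).

The conjugation replaces $y$ by $-y$ and the reversion replaces a step $+1$ of the Abel function by
$-1$, so formally $A^g(y)=-A^f(-y)$ up to a constant; this explains the kindredness. The proof
verifies it on explicit values: rescaled by $10/\pi^2$, all coefficients become rational and every
parameter is computed exactly. -/

namespace Kindred

/-! ### Coefficients of powers and `partSum` -/

/-- `pw v d m` is the coefficient of `x^m` in `(∑_{i ≥ 1} v_i x^i)^d`. -/
def pw {R : Type*} [CommRing R] (v : ℕ → R) : ℕ → ℕ → R
  | 0, m => if m = 0 then 1 else 0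
  | d + 1, m => ∑ i ∈ range m, v (i + 1) * pw v d (m - (i + 1))

theorem pw_congr {R : Type*} [CommRing R] {v w : ℕ → R} (d : ℕ) :
    ∀ m, (∀ i, 1 ≤ i → i ≤ m → v i = w i) → pw v d m = pw w d m := by
  induction d with
  | zero => intro m _; rfl
  | succ d ih =>
    intro m h
    refine Finset.sum_congr rfl fun i hi => ?_
    have := Finset.mem_range.1 hi
    rw [h (i + 1) (by omega) (by omega), ih _ fun j h1 h2 => h j h1 (by omega)]

theorem coeff_pow_eq_pw {R : Type*} [CommRing R] (p : R[X]) (hp : p.coeff 0 = 0) (d : ℕ) :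
    ∀ m, (p ^ d).coeff m = pw p.coeff d m := by
  induction d with
  | zero => intro m; simp [pw, Polynomial.coeff_one]
  | succ d ih =>
    intro m
    rw [pow_succ', Polynomial.coeff_mul, Finset.Nat.sum_antidiagonal_eq_sum_range_succ_mk,
      Finset.sum_range_succ', hp, zero_mul, add_zero]
    exact Finset.sum_congr rfl fun i _ => by rw [ih]

theorem pw_eq_zero_of_lt {R : Type*} [CommRing R] (v : ℕ → R) (d : ℕ) :
    ∀ m, m < d → pw v d m = 0 := by
  induction d with
  | zero => intro m h; omega
  | succ d ih =>
    intro m h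
    refine Finset.sum_eq_zero fun i hi => ?_
    have := Finset.mem_range.1 hi
    rw [ih _ (by omega), mul_zero]

/-- Substituting $rx$ for $x$. It moves the powers of $\lambda$ in $b_j$ onto the coefficients
$a_i$. -/
theorem pw_smul {R : Type*} [CommRing R] (r : R) (v : ℕ → R) (d : ℕ) :
    ∀ m, pw (fun i => r ^ i * v i) d m = r ^ m * pw v d m := by
  induction d with
  | zero => intro m; rcases m with _ | m <;> simp [pw]
  | succ d ih =>
    intro m
    simp only [pw, Finset.mul_sum]
    refine Finset.sum_congr rfl fun i hi => ?_
    have := Finset.mem_range.1 hi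
    rw [ih, show r ^ m = r ^ (i + 1) * r ^ (m - (i + 1)) by rw [← pow_add]; congr 1; omega]
    ring

theorem map_pw {R S : Type*} [CommRing R] [CommRing S] (φ : R →+* S) (v : ℕ → R) (d : ℕ) :
    ∀ m, φ (pw v d m) = pw (fun i => φ (v i)) d m := by
  induction d with
  | zero => intro m; by_cases h : m = 0 <;> simp [pw, h]
  | succ d ih => intro m; simp [pw, ih]

/-- The multinomial theorem for the $(m-s)$-th power of $\sum_i v_ix^{i+1}$: the filter in `partSum`
selects the degree $m$. Entries of weight above $m$ cannot contribute, so only $m\le k$ is needed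
and the tuple lengths 6 and 7 in the algorithm do not matter. -/
theorem partSum_eq_pw {R : Type*} [CommRing R] {k m s : ℕ} {v : Fin k → R} {w : ℕ → R}
    (hk : m ≤ k) (h : ∀ i : Fin k, (i : ℕ) + 1 ≤ m → v i = w ((i : ℕ) + 1)) :
    partSum k m s v = pw w (m - s) m := by
  set p : R[X] := ∑ i : Fin k, Polynomial.C (v i) * Polynomial.X ^ ((i : ℕ) + 1) with hp
  have hc : ∀ j, p.coeff j = ∑ i : Fin k, if j = (i : ℕ) + 1 then v i else 0 := fun j => by
    simp [hp, Polynomial.coeff_X_pow]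
  have h0 : p.coeff 0 = 0 := by rw [hc]; exact Finset.sum_eq_zero fun i _ => by simp
  have h1 : pw w (m - s) m = (p ^ (m - s)).coeff m := by
    rw [coeff_pow_eq_pw p h0]
    refine pw_congr _ _ fun i hi1 hi2 => ?_
    rw [hc, Finset.sum_eq_single (⟨i - 1, by omega⟩ : Fin k)]
    · rw [if_pos (by simp; omega), h _ (by simp; omega)]
      congr 1; simp; omega
    · intro b _ hb
      rw [if_neg]
      intro hh
      exact hb (Fin.ext (by simp; omega))
    · simp
  rw [h1, hp, Finset.sum_pow_eq_sum_piAntidiag, Polynomial.finsetSum_coeff, partSum,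
    Finset.sum_filter]
  refine Finset.sum_congr rfl fun n _ => ?_
  have : ∏ i : Fin k, (Polynomial.C (v i) * Polynomial.X ^ ((i : ℕ) + 1)) ^ n i
      = Polynomial.C (∏ i : Fin k, v i ^ n i) *
        Polynomial.X ^ (∑ i : Fin k, ((i : ℕ) + 1) * n i) := by
    simp_rw [mul_pow, Finset.prod_mul_distrib, ← pow_mul, Finset.prod_pow_eq_pow_sum, map_prod,
      map_pow]
  rw [this, ← Polynomial.C_eq_natCast, ← mul_assoc, ← map_mul, Polynomial.coeff_C_mul_X_pow]
  simp only [eq_comm]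

end Kindred

namespace Kindred

noncomputable section

/-! ### The algorithm in terms of coefficients of composed series -/

/-- The coefficient of `x^m`, `m ≥ 1`, in `∑_{d ≥ 1} φ_d (∑_{i ≥ 1} v_i x^i)^d`. -/
def compCoeff {R : Type*} [CommRing R] (φ v : ℕ → R) (m : ℕ) : R :=
  ∑ d ∈ range m, φ (d + 1) * pw v (d + 1) m

/-- The Taylor coefficients of `(1 + v)^r`. -/
def binom (r : ℝ) (d : ℕ) : ℝ := fall r d / (d.factorial : ℝ)

/-- The Taylor coefficients of `log (1 + v)`. -/
def logCoeff (d : ℕ) : ℝ := (-1 : ℝ) ^ (d - 1) / (d : ℝ)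

/-- The coefficients `1, b₁, b₂, …` of `y_{n+1} / y_n - 1` in powers of `1 / y_n`. -/
def stepCoeff (τ : ℕ) (a : ℕ → ℝ) (i : ℕ) : ℝ := if i = 1 then 1 else b τ a (i - 1)

theorem compCoeff_congr {R : Type*} [CommRing R] {φ v w : ℕ → R} (m : ℕ)
    (h : ∀ i, 1 ≤ i → i ≤ m → v i = w i) : compCoeff φ v m = compCoeff φ w m :=
  Finset.sum_congr rfl fun d _ => by rw [pw_congr _ _ h]

theorem map_compCoeff {R S : Type*} [CommRing R] [CommRing S] (f : R →+* S) (φ v : ℕ → R)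
    (m : ℕ) : f (compCoeff φ v m) = compCoeff (fun i => f (φ i)) (fun i => f (v i)) m := by
  simp [compCoeff, map_pw]

theorem b_eq_compCoeff (τ : ℕ) (a : ℕ → ℝ) {j : ℕ} (hj : j ≤ 6) :
    b τ a j = compCoeff (binom (-(τ : ℝ))) (fun i => lam τ a ^ i * a i) (j + 1) := by
  -- The algorithm sums over the defect $s$; reflecting the range turns it into a sum over the
  -- number of factors.
  rw [b, compCoeff, Finset.mul_sum, ← Finset.sum_range_reflect]
  refine Finset.sum_congr rfl fun d hd => ?_
  have hd := Finset.mem_range.1 hd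
  rw [partSum_eq_pw (w := a) (by omega) (fun i _ => rfl), pw_smul,
    show j + 1 - (j + 1 - 1 - d) = d + 1 by omega, binom]
  ring

theorem oneB_eq_stepCoeff (τ : ℕ) (a : ℕ → ℝ) (i : Fin 7) :
    oneB τ a i = stepCoeff τ a ((i : ℕ) + 1) := by
  simp [oneB, stepCoeff]

theorem aa_zero_eq_compCoeff (τ : ℕ) (a : ℕ → ℝ) {j : ℕ} (hj : j ≤ 7) :
    aa τ a 0 j = compCoeff logCoeff (stepCoeff τ a) j := by
  rw [aa, if_pos rfl, compCoeff, ← Finset.sum_range_reflect]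
  refine Finset.sum_congr rfl fun d hd => ?_
  have hd := Finset.mem_range.1 hd
  rw [partSum_eq_pw (by omega) (fun i _ => oneB_eq_stepCoeff τ a i),
    show j - (j - 1 - d) = d + 1 by omega, show j - 1 - (j - 1 - d) = d by omega, logCoeff]
  rfl

theorem aa_eq_compCoeff (τ : ℕ) (a : ℕ → ℝ) {i j : ℕ} (hi : i ≠ 0) (hj : j ≤ 7) :
    aa τ a i j = compCoeff (binom (-(i : ℝ))) (stepCoeff τ a) (j - i) := by
  rw [aa, if_neg hi, compCoeff, ← Finset.sum_range_reflect]
  refine Finset.sum_congr rfl fun d hd => ?_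
  have hd := Finset.mem_range.1 hd
  rw [partSum_eq_pw (by omega) (fun i _ => oneB_eq_stepCoeff τ a i),
    show j - i - (j - i - 1 - d) = d + 1 by omega, binom]

theorem T_eq_compCoeff (τ : ℕ) (a : ℕ → ℝ) (m : ℕ) :
    T τ a (m + 2) =
      Polynomial.C (b τ a 1) * compCoeff (fun d => Polynomial.C (logCoeff d)) (T τ a) (m + 1)
        - Polynomial.C (c τ a (m + 1))
        - ∑ p ∈ Icc 1 m, Polynomial.C (c τ a p) *
            compCoeff (fun d => Polynomial.C (binom (-(p : ℝ)) d)) (T τ a) (m + 1 - p) := by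
  have h1 : ∑ s ∈ range (m + 1), Polynomial.C ((-1 : ℝ) ^ (m - s) / ((m + 1 - s : ℕ) : ℝ)) *
      partSum (m + 1) (m + 1) s (fun i : Fin (m + 1) => T τ a ((i : ℕ) + 1)) =
      compCoeff (fun d => Polynomial.C (logCoeff d)) (T τ a) (m + 1) := by
    rw [compCoeff, ← Finset.sum_range_reflect]
    refine Finset.sum_congr rfl fun d hd => ?_
    have hd := Finset.mem_range.1 hd
    rw [partSum_eq_pw (w := T τ a) le_rfl (fun i _ => rfl),
      show m + 1 - (m + 1 - 1 - d) = d + 1 by omega, show m - (m + 1 - 1 - d) = d by omega,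
      logCoeff, Nat.add_sub_cancel]
  have h2 : ∀ p ∈ Icc 1 m, ∑ q ∈ Icc 1 (m + 1 - p),
      Polynomial.C (fall (-(p : ℝ)) q / (q.factorial : ℝ)) *
        partSum (m + 1) (m + 1 - p) (m + 1 - p - q)
          (fun i : Fin (m + 1) => T τ a ((i : ℕ) + 1)) =
      compCoeff (fun d => Polynomial.C (binom (-(p : ℝ)) d)) (T τ a) (m + 1 - p) := by
    intro p hp
    rw [compCoeff, Finset.range_eq_Ico, Finset.sum_Ico_add' (fun q =>
      Polynomial.C (binom (-(p : ℝ)) q) * pw (T τ a) q (m + 1 - p))]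
    refine Finset.sum_congr (by ext; simp) fun q hq => ?_
    have hq := Finset.mem_Icc.1 hq
    rw [partSum_eq_pw (w := T τ a) (by omega) (fun i _ => rfl),
      show m + 1 - p - (m + 1 - p - q) = q by omega, binom]
  rw [T, h1, Finset.sum_congr rfl fun p hp => by rw [h2 p hp]]

theorem P_eq_compCoeff (τ : ℕ) (a : ℕ → ℝ) {m : ℕ} (hm : m + 2 ≤ 6) :
    P τ a (m + 2) = compCoeff (fun d => Polynomial.C (binom (-(1 / (τ : ℝ))) d))
      (fun i => (T τ a i).comp (Polynomial.C (-(τ : ℝ)) * Polynomial.X)) (m + 2) := by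
  rw [P, compCoeff, ← Finset.sum_range_reflect]
  refine Finset.sum_congr rfl fun d hd => ?_
  have hd := Finset.mem_range.1 hd
  rw [partSum_eq_pw (w := fun i => (T τ a i).comp (Polynomial.C (-(τ : ℝ)) * Polynomial.X)) hm
    (fun i _ => rfl), show m + 2 - (m + 2 - 1 - d) = d + 1 by omega, binom]

theorem c_succ (τ : ℕ) (a : ℕ → ℝ) (i : ℕ) : c τ a (i + 1) = 1 / ((i : ℝ) + 1) *
    (b τ a (i + 2) + ∑ h ∈ range (i + 1), aa τ a h (i + 2) * c τ a h) := by
  rw [c, Finset.sum_range]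

end

end Kindred

namespace Kindred

open scoped Polynomial.Bivariate Topology

/-! ### Asymptotic expansions in powers of a scale with polynomial coefficients -/

section Expansions

variable {α : Type*} {l : Filter α} {X δ : α → ℝ} {N : ℕ} {f g : α → ℝ} {p q : ℝ[X][Y]}

/-- `δ` tends to zero faster than any negative power of `X`. -/
def IsScale (l : Filter α) (X δ : α → ℝ) : Prop :=
  ∀ k : ℕ, Tendsto (fun a => X a ^ k * δ a) l (𝓝 0)

/-- `f = q(X, δ) + o(δ^N)`, where the outer variable of `q` stands for `δ`. -/
def HasExp (l : Filter α) (X δ : α → ℝ) (N : ℕ) (f : α → ℝ) (q : ℝ[X][Y]) : Prop :=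
  (fun a => f a - q.evalEval (X a) (δ a)) =o[l] fun a => δ a ^ N

theorem IsScale.tendsto (h : IsScale l X δ) : Tendsto δ l (𝓝 0) := by
  simpa using h 0

theorem IsScale.tendsto_eval_mul (h : IsScale l X δ) (p : ℝ[X]) :
    Tendsto (fun a => p.eval (X a) * δ a) l (𝓝 0) := by
  induction p using Polynomial.induction_on' with
  | add p q hp hq => simpa [add_mul] using hp.add hq
  | monomial n r => simpa [mul_assoc] using (h n).const_mul r

/-- One factor $\delta$ absorbs any polynomial in $X$ and $\delta$. This makes all terms of order
above $N$ negligible although their coefficients may be unbounded. -/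
theorem IsScale.tendsto_evalEval_mul (h : IsScale l X δ) (q : ℝ[X][Y]) :
    Tendsto (fun a => q.evalEval (X a) (δ a) * δ a) l (𝓝 0) := by
  induction q using Polynomial.induction_on' with
  | add p q hp hq => simpa [add_mul, Polynomial.evalEval_add] using hp.add hq
  | monomial n r =>
    have := (h.tendsto_eval_mul r).mul (h.tendsto.pow n)
    refine (this.congr fun a => ?_).trans (by simp)
    rw [← Polynomial.C_mul_X_pow_eq_monomial, Polynomial.evalEval_mul, Polynomial.evalEval_C,
      Polynomial.evalEval_pow, Polynomial.evalEval_X]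
    ring

theorem IsScale.isLittleO_of_dvd (h : IsScale l X δ) (hq : Polynomial.X ^ (N + 1) ∣ q) :
    (fun a => q.evalEval (X a) (δ a)) =o[l] fun a => δ a ^ N := by
  obtain ⟨r, rfl⟩ := hq
  have := ((Asymptotics.isLittleO_one_iff ℝ).2 (h.tendsto_evalEval_mul r)).mul_isBigO
    (isBigO_refl (fun a => δ a ^ N) l)
  refine this.congr (fun a => ?_) (fun a => by simp)
  rw [Polynomial.evalEval_mul, Polynomial.evalEval_pow, Polynomial.evalEval_X]
  ring

theorem IsScale.tendsto_evalEval (h : IsScale l X δ) {r : ℝ} (hq : q.coeff 0 = Polynomial.C r) :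
    Tendsto (fun a => q.evalEval (X a) (δ a)) l (𝓝 r) := by
  have h1 : (fun a => (q - Polynomial.C (Polynomial.C r)).evalEval (X a) (δ a))
      =o[l] fun a => δ a ^ 0 :=
    h.isLittleO_of_dvd (by rw [zero_add, pow_one, Polynomial.X_dvd_iff]; simp [hq])
  have h2 := (Asymptotics.isLittleO_one_iff ℝ).1 (h1.congr_right fun a => pow_zero _)
  simpa [Polynomial.evalEval_sub] using h2.add_const r

/-- Truncation: an expansion to order $N$ sees a polynomial only modulo $\delta^{N+1}$. Identities
between expansions thereby reduce to comparing finitely many coefficients. -/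
theorem HasExp.congr (h : IsScale l X δ) (hf : HasExp l X δ N f p)
    (hpq : ∀ k ≤ N, p.coeff k = q.coeff k) : HasExp l X δ N f q := by
  have h1 : Polynomial.X ^ (N + 1) ∣ p - q :=
    Polynomial.X_pow_dvd_iff.2 fun d hd => by simp [hpq d (by omega)]
  refine (hf.add (h.isLittleO_of_dvd h1)).congr_left fun a => ?_
  rw [Polynomial.evalEval_sub]
  ring

theorem HasExp.congr_fun (hf : HasExp l X δ N f p) (hfg : f =ᶠ[l] g) : HasExp l X δ N g p :=
  hf.congr' (hfg.mono fun a ha => by simp only [ha]) EventuallyEq.rfl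

theorem HasExp.add (hf : HasExp l X δ N f p) (hg : HasExp l X δ N g q) :
    HasExp l X δ N (fun a => f a + g a) (p + q) :=
  (IsLittleO.add hf hg).congr_left fun a => by rw [Polynomial.evalEval_add]; ring

theorem HasExp.sub (hf : HasExp l X δ N f p) (hg : HasExp l X δ N g q) :
    HasExp l X δ N (fun a => f a - g a) (p - q) :=
  (IsLittleO.sub hf hg).congr_left fun a => by rw [Polynomial.evalEval_sub]; ring

theorem HasExp.const_mul (hf : HasExp l X δ N f p) (r : ℝ) :
    HasExp l X δ N (fun a => r * f a) (Polynomial.C (Polynomial.C r) * p) :=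
  (hf.const_mul_left r).congr_left fun a => by
    rw [Polynomial.evalEval_mul, Polynomial.evalEval_C, Polynomial.eval_C]; ring

theorem HasExp.self (q : ℝ[X][Y]) :
    HasExp l X δ N (fun a => q.evalEval (X a) (δ a)) q := by
  simp [HasExp]

theorem HasExp.const (r : ℝ) :
    HasExp l X δ N (fun _ => r) (Polynomial.C (Polynomial.C r)) := by
  simp [HasExp]

theorem HasExp.finset_sum {ι : Type*} (s : Finset ι) {f : ι → α → ℝ} {p : ι → ℝ[X][Y]}
    (h : ∀ i ∈ s, HasExp l X δ N (f i) (p i)) :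
    HasExp l X δ N (fun a => ∑ i ∈ s, f i a) (∑ i ∈ s, p i) := by
  classical
  induction s using Finset.induction_on with
  | empty => simp [HasExp]
  | insert i s hi ih =>
    simp only [Finset.sum_insert hi]
    exact (h i (by simp)).add (ih fun j hj => h j (by simp [hj]))

/-- The gain in order that drives the bootstrapping of the fixed point equation. -/
theorem HasExp.delta_pow_mul (hf : HasExp l X δ N f p) (k : ℕ) :
    HasExp l X δ (N + k) (fun a => δ a ^ k * f a) (Polynomial.X ^ k * p) := by
  refine ((isBigO_refl (fun a => δ a ^ k) l).mul_isLittleO hf).congr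
    (fun a => ?_) (fun a => by ring)
  rw [Polynomial.evalEval_mul, Polynomial.evalEval_pow, Polynomial.evalEval_X]
  ring

theorem HasExp.mono (h : IsScale l X δ) (hf : HasExp l X δ N f p) {M : ℕ} (hM : M ≤ N) :
    HasExp l X δ M f p := by
  refine IsLittleO.trans_isBigO hf ?_
  obtain ⟨k, rfl⟩ := Nat.exists_eq_add_of_le hM
  have := (isBigO_refl (fun a => δ a ^ M) l).mul ((h.tendsto.pow k).isBigO_one ℝ)
  exact this.congr (fun a => by ring) (fun a => by ring)

theorem HasExp.tendsto (h : IsScale l X δ) (hf : HasExp l X δ N f p) {r : ℝ}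
    (hp : p.coeff 0 = Polynomial.C r) : Tendsto f l (𝓝 r) := by
  have h1 := (Asymptotics.isLittleO_one_iff ℝ).1
    ((hf.mono h (Nat.zero_le N)).congr_right fun a => pow_zero _)
  simpa using h1.add (h.tendsto_evalEval hp)

/-- Based on $fg-pq=(f-p)g+p(g-q)$. The leading coefficients must be constants, free of $X$, so that
$g$ and the value of $p$ stay bounded. -/
theorem HasExp.mul (h : IsScale l X δ) (hf : HasExp l X δ N f p) (hg : HasExp l X δ N g q)
    {r s : ℝ} (hp : p.coeff 0 = Polynomial.C r) (hq : q.coeff 0 = Polynomial.C s) :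
    HasExp l X δ N (fun a => f a * g a) (p * q) := by
  have h1 := IsLittleO.mul_isBigO hf ((hg.tendsto h hq).isBigO_one ℝ)
  have h2 := ((h.tendsto_evalEval hp).isBigO_one ℝ).mul_isLittleO hg
  refine ((h1.congr_right fun a => mul_one _).add (h2.congr_right fun a => one_mul _)).congr_left
    fun a => ?_
  rw [Polynomial.evalEval_mul]
  ring

theorem HasExp.pow (h : IsScale l X δ) (hf : HasExp l X δ N f p) (hp : p.coeff 0 = 0) (d : ℕ) :
    HasExp l X δ N (fun a => f a ^ d) (p ^ d) := by
  induction d with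
  | zero => simpa using HasExp.const (l := l) (X := X) (δ := δ) (N := N) 1
  | succ d ih =>
    simp only [pow_succ]
    refine ih.mul h hf (r := (0 : ℝ) ^ d) (s := 0) ?_ (by simpa using hp)
    rw [Polynomial.coeff_zero_eq_eval_zero, Polynomial.eval_pow,
      ← Polynomial.coeff_zero_eq_eval_zero, hp]
    simp

/-- Composition with a function that has a Taylor expansion at zero. -/
theorem HasExp.comp (h : IsScale l X δ) (hf : HasExp l X δ N f p) (hp : p.coeff 0 = 0)
    {φ : ℝ → ℝ} {t : ℕ → ℝ} {D : ℕ} (hD : N ≤ D)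
    (hφ : (fun v => φ v - ∑ d ∈ range (D + 1), t d * v ^ d) =O[𝓝 0] fun v => v ^ (D + 1)) :
    HasExp l X δ N (fun a => φ (f a))
      (∑ d ∈ range (D + 1), Polynomial.C (Polynomial.C (t d)) * p ^ d) := by
  have hf0 : Tendsto f l (𝓝 0) := hf.tendsto h (r := 0) (by simpa using hp)
  -- Since $p$ is divisible by $\delta$, $p^{D+1}$ is divisible by $\delta^{N+1}$, and the Taylor
  -- remainder of $\varphi$ is negligible.
  have h1 : (fun a => f a ^ (D + 1)) =o[l] fun a => δ a ^ N := by
    have h2 : Polynomial.X ^ (N + 1) ∣ p ^ (D + 1) :=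
      (pow_dvd_pow _ (by omega)).trans (pow_dvd_pow_of_dvd (Polynomial.X_dvd_iff.2 hp) _)
    refine (IsLittleO.add (hf.pow h hp (D + 1)) (h.isLittleO_of_dvd h2)).congr_left fun a => ?_
    ring
  have h3 := (hφ.comp_tendsto hf0).trans_isLittleO h1
  have h4 : HasExp l X δ N (fun a => ∑ d ∈ range (D + 1), t d * f a ^ d)
      (∑ d ∈ range (D + 1), Polynomial.C (Polynomial.C (t d)) * p ^ d) :=
    HasExp.finset_sum _ fun d _ => (hf.pow h hp d).const_mul (t d)
  refine (h3.add h4).congr_left fun a => ?_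
  simp only [Function.comp]
  ring

theorem coeff_sum_mul_pow {R : Type*} [CommRing R] (t : ℕ → R) {p : R[X]} (hp : p.coeff 0 = 0)
    {D m : ℕ} (hm : m ≠ 0) (hmD : m ≤ D) :
    (∑ d ∈ range (D + 1), Polynomial.C (t d) * p ^ d).coeff m = compCoeff t p.coeff m := by
  rw [Polynomial.finsetSum_coeff, Finset.sum_range_succ', compCoeff]
  simp only [Polynomial.coeff_C_mul, coeff_pow_eq_pw p hp, pow_zero, Polynomial.coeff_one, hm,
    if_false, mul_zero, add_zero]
  refine (Finset.sum_subset (Finset.range_subset_range.2 hmD) fun d _ hd => ?_).symm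
  rw [pw_eq_zero_of_lt _ _ _ (by simpa using hd), mul_zero]

theorem coeff_zero_sum_mul_pow {R : Type*} [CommRing R] (t : ℕ → R) {p : R[X]}
    (hp : p.coeff 0 = 0) (D : ℕ) :
    (∑ d ∈ range (D + 1), Polynomial.C (t d) * p ^ d).coeff 0 = t 0 := by
  rw [Polynomial.finsetSum_coeff, Finset.sum_range_succ']
  simp [coeff_pow_eq_pw p hp, pw]

/-- An expansion in powers of a nonvanishing scale determines its coefficients. -/
theorem HasExp.coeff_eq [l.NeBot] (hδ : Tendsto δ l (𝓝 0)) (hne : ∀ᶠ a in l, δ a ≠ 0)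
    {u v : ℕ → ℝ}
    (huv : (fun a => ∑ k ∈ range (N + 1), u k * δ a ^ k - ∑ k ∈ range (N + 1), v k * δ a ^ k)
      =o[l] fun a => δ a ^ N) : ∀ k ≤ N, u k = v k := by
  intro k
  induction k using Nat.strong_induction_on with
  | _ k ih =>
    intro hk
    by_contra hne'
    -- The coefficients below $k$ agree by induction. Divided by $\delta^k$, the difference tends to
    -- $u_k-v_k$ and also to $0$.
    have h1 : (fun a => ∑ j ∈ range (N + 1), u j * δ a ^ j - ∑ j ∈ range (N + 1), v j * δ a ^ j)
        =o[l] fun a => δ a ^ k := by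
      refine huv.trans_isBigO ?_
      obtain ⟨i, rfl⟩ := Nat.exists_eq_add_of_le hk
      have := (isBigO_refl (fun a => δ a ^ k) l).mul ((hδ.pow i).isBigO_one ℝ)
      exact this.congr (fun a => by ring) (fun a => by ring)
    have h2 : Tendsto (fun a => ∑ j ∈ range (N - k + 1), (u (k + j) - v (k + j)) * δ a ^ j) l
        (𝓝 (∑ j ∈ range (N - k + 1), (u (k + j) - v (k + j)) * 0 ^ j)) :=
      tendsto_finsetSum _ fun j _ => (hδ.pow j).const_mul _
    have h3 : Tendsto (fun a => ∑ j ∈ range (N - k + 1), (u (k + j) - v (k + j)) * δ a ^ j) l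
        (𝓝 0) := by
      refine (h1.tendsto_div_nhds_zero).congr' (hne.mono fun a ha => ?_)
      rw [div_eq_iff (pow_ne_zero _ ha), ← Finset.sum_sub_distrib,
        show N + 1 = k + (N - k + 1) by omega, Finset.sum_range_add, Finset.sum_mul,
        Finset.sum_eq_zero fun j hj => by
          rw [ih j (Finset.mem_range.1 hj) (by have := Finset.mem_range.1 hj; omega), sub_self],
        zero_add]
      exact Finset.sum_congr rfl fun j _ => by ring
    have h4 := tendsto_nhds_unique h2 h3
    rw [Finset.sum_range_succ'] at h4
    simp at h4
    exact hne' (sub_eq_zero.1 h4)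

end Expansions

end Kindred

namespace Kindred

open scoped Topology

/-! ### Taylor expansions at zero -/

theorem isBigO_sub_sum_of_hasFPowerSeriesAt {f : ℝ → ℝ} {t : ℕ → ℝ}
    (h : HasFPowerSeriesAt f (FormalMultilinearSeries.ofScalars ℝ t) 0) (D : ℕ) :
    (fun v => f v - ∑ d ∈ range (D + 1), t d * v ^ d) =O[𝓝 0] fun v => v ^ (D + 1) := by
  refine ((h.isBigO_sub_partialSum_pow (D + 1)).congr_left fun v => ?_).trans ?_
  · simp [FormalMultilinearSeries.partialSum, mul_comm]
  · exact IsBigO.of_bound 1 (Eventually.of_forall fun v => by simp)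

/-- Analyticity provides the remainder estimate; the coefficients are identified through the
iterated derivatives near $0$. -/
theorem binom_isBigO (r : ℝ) (D : ℕ) :
    (fun v : ℝ => (1 + v) ^ r - ∑ d ∈ range (D + 1), binom r d * v ^ d)
      =O[𝓝 0] fun v => v ^ (D + 1) := by
  refine isBigO_sub_sum_of_hasFPowerSeriesAt ?_ D
  have ha : AnalyticAt ℝ (fun v : ℝ => (1 + v) ^ r) 0 :=
    Real.one_add_rpow_hasFPowerSeriesAt_zero.analyticAt
  have h := ha.hasFPowerSeriesAt
  have hd : ∀ n : ℕ, iteratedDeriv n (fun v : ℝ => (1 + v) ^ r) =ᶠ[𝓝 0]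
      fun v => fall r n * (1 + v) ^ (r - n) := by
    intro n
    induction n with
    | zero => exact Eventually.of_forall fun v => by simp [fall]
    | succ n ih =>
      rw [iteratedDeriv_succ]
      refine ih.deriv.trans ?_
      filter_upwards [lt_mem_nhds (show (-1 : ℝ) < 0 by norm_num)] with v hv
      have h1 : HasDerivAt (fun v : ℝ => 1 + v) 1 v := (hasDerivAt_id v).const_add 1
      have h2 := (h1.rpow_const (p := r - n) (Or.inl (by linarith))).const_mul (fall r n)
      rw [h2.deriv, fall, fall, Finset.prod_range_succ]
      push_cast
      rw [show r - (n + 1) = r - n - 1 by ring]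
      ring
  have hc : (fun n => iteratedDeriv n (fun v : ℝ => (1 + v) ^ r) 0 / (n.factorial : ℝ))
      = binom r := by
    funext n
    rw [(hd n).eq_of_nhds, binom]
    simp
  rwa [hc] at h

theorem log_isBigO (D : ℕ) :
    (fun v : ℝ => Real.log (1 + v) - ∑ d ∈ range (D + 1), logCoeff d * v ^ d)
      =O[𝓝 0] fun v => v ^ (D + 1) := by
  -- For $|v|<1/2$ the remainder $|v|^{D+1}/(1-|v|)$ is at most $2|v|^{D+1}$.
  refine IsBigO.of_bound 2 ?_
  have h1 : ∀ᶠ v : ℝ in 𝓝 0, |v| < 1 / 2 := by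
    have := Metric.ball_mem_nhds (0 : ℝ) (show (0 : ℝ) < 1 / 2 by norm_num)
    filter_upwards [this] with v hv
    simpa using hv
  filter_upwards [h1] with v hv
  have h2 := Real.abs_log_sub_add_sum_range_le (x := -v) (by rw [abs_neg]; linarith) D
  have h3 : ∑ d ∈ range (D + 1), logCoeff d * v ^ d
      = -∑ i ∈ range D, (-v) ^ (i + 1) / ((i : ℝ) + 1) := by
    rw [Finset.sum_range_succ', ← Finset.sum_neg_distrib]
    simp only [logCoeff, Nat.cast_zero, div_zero, zero_mul, add_zero, Nat.add_sub_cancel]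
    refine Finset.sum_congr rfl fun i _ => ?_
    rw [neg_pow v]
    push_cast
    ring
  rw [h3, sub_neg_eq_add, add_comm, Real.norm_eq_abs, Real.norm_eq_abs, abs_pow]
  rw [sub_neg_eq_add, abs_neg] at h2
  refine h2.trans ?_
  rw [div_le_iff₀ (by linarith)]
  nlinarith [pow_nonneg (abs_nonneg v) (D + 1)]

end Kindred

namespace Kindred

open scoped Polynomial.Bivariate Topology

/-! ### Series without constant term -/

section SeriesPoly

variable {α : Type*} {l : Filter α} {X δ : α → ℝ} {N : ℕ} {f : α → ℝ}

/-- The polynomial `∑_{1 ≤ m ≤ N} v_m Y^m`. -/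
noncomputable def seriesPoly {R : Type*} [CommRing R] (N : ℕ) (v : ℕ → R) : R[X] :=
  ∑ m ∈ Icc 1 N, Polynomial.C (v m) * Polynomial.X ^ m

theorem coeff_seriesPoly {R : Type*} [CommRing R] (N : ℕ) (v : ℕ → R) (k : ℕ) :
    (seriesPoly N v).coeff k = if 1 ≤ k ∧ k ≤ N then v k else 0 := by
  simp [seriesPoly, Polynomial.finsetSum_coeff, Polynomial.coeff_X_pow, Finset.mem_Icc]

theorem evalEval_seriesPoly (N : ℕ) (v : ℕ → ℝ[X]) (x d : ℝ) :
    (seriesPoly N v).evalEval x d = ∑ m ∈ Icc 1 N, (v m).eval x * d ^ m := by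
  simp [seriesPoly, Polynomial.evalEval_finsetSum, Polynomial.evalEval_mul,
    Polynomial.evalEval_pow, Polynomial.evalEval_C]

theorem HasExp.comp_seriesPoly (h : IsScale l X δ) {v : ℕ → ℝ[X]}
    (hf : HasExp l X δ N f (seriesPoly N v)) {φ : ℝ → ℝ} {t : ℕ → ℝ}
    (hφ : (fun v => φ v - ∑ d ∈ range (N + 1), t d * v ^ d) =O[𝓝 0] fun v => v ^ (N + 1)) :
    HasExp l X δ N (fun a => φ (f a) - t 0)
      (seriesPoly N (compCoeff (fun d => Polynomial.C (t d)) v)) := by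
  have h0 : (seriesPoly N v).coeff 0 = 0 := by simp [coeff_seriesPoly]
  refine ((hf.comp h h0 le_rfl hφ).sub (HasExp.const (t 0))).congr h fun k hk => ?_
  rw [Polynomial.coeff_sub, coeff_seriesPoly]
  rcases Nat.eq_zero_or_pos k with rfl | hk0
  · have := coeff_zero_sum_mul_pow (fun d => Polynomial.C (t d)) h0 N
    rw [this]
    simp
  · have := coeff_sum_mul_pow (fun d => Polynomial.C (t d)) h0 hk0.ne' hk
    rw [this, if_pos ⟨hk0, hk⟩, Polynomial.coeff_C_of_ne_zero hk0.ne', sub_zero]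
    refine compCoeff_congr _ fun i h1 h2 => ?_
    rw [coeff_seriesPoly, if_pos ⟨h1, by omega⟩]

theorem HasExp.comp_seriesPoly_C (h : IsScale l X δ) {v : ℕ → ℝ}
    (hf : HasExp l X δ N f (seriesPoly N fun i => Polynomial.C (v i))) {φ : ℝ → ℝ} {t : ℕ → ℝ}
    (hφ : (fun v => φ v - ∑ d ∈ range (N + 1), t d * v ^ d) =O[𝓝 0] fun v => v ^ (N + 1)) :
    HasExp l X δ N (fun a => φ (f a) - t 0)
      (seriesPoly N fun i => Polynomial.C (compCoeff t v i)) := by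
  simp only [map_compCoeff]
  exact hf.comp_seriesPoly h hφ

end SeriesPoly

/-! ### Identities satisfied by the parameters -/

section Parameters

variable (τ : ℕ) (a : ℕ → ℝ)

@[simp] theorem binom_zero (r : ℝ) : binom r 0 = 1 := by simp [binom, fall]

@[simp] theorem binom_one (r : ℝ) : binom r 1 = r := by simp [binom, fall]

@[simp] theorem logCoeff_zero : logCoeff 0 = 0 := by simp [logCoeff]

@[simp] theorem logCoeff_one : logCoeff 1 = 1 := by simp [logCoeff]

theorem compCoeff_one {R : Type*} [CommRing R] (φ v : ℕ → R) :
    compCoeff φ v 1 = φ 1 * v 1 := by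
  simp [compCoeff, pw]

/-- For $m=1$ this is $-\tau\lambda a_1=1$, the normalisation that defines $\lambda$; for $m\ge2$ it
is the definition of $b_{m-1}$. -/
theorem stepCoeff_eq_compCoeff {τ : ℕ} {a : ℕ → ℝ} (hτ : τ ≠ 0) (ha : a 1 ≠ 0) {m : ℕ}
    (h1 : 1 ≤ m) (h7 : m ≤ 7) :
    stepCoeff τ a m = compCoeff (binom (-(τ : ℝ))) (fun i => lam τ a ^ i * a i) m := by
  obtain ⟨j, rfl⟩ := Nat.exists_eq_add_of_le' h1
  rw [stepCoeff]
  split_ifs with h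
  · obtain rfl : j = 0 := by omega
    rw [compCoeff_one, binom_one, lam]
    have : (τ : ℝ) ≠ 0 := by exact_mod_cast hτ
    field_simp
  · rw [Nat.add_sub_cancel, b_eq_compCoeff τ a (by omega)]

theorem aa_zero_one : aa τ a 0 1 = 1 := by
  rw [aa_zero_eq_compCoeff τ a (by norm_num), compCoeff_one]
  simp [stepCoeff]

theorem aa_succ (i : ℕ) (hi : i ≠ 0) (h : i ≤ 6) : aa τ a i (i + 1) = -i := by
  rw [aa_eq_compCoeff τ a hi (by omega), Nat.add_sub_cancel_left, compCoeff_one]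
  simp [stepCoeff]

/-- The recursion for the $c_i$ before solving: the last term has the factor $a_{j-1,j}=-(j-1)$,
which for $j\ge2$ is the pivot that determines $c_{j-1}$. For $j=1$ it is $c_0=-b_1$. -/
theorem b_add_sum_aa_mul_c {j : ℕ} (h1 : 1 ≤ j) (h6 : j ≤ 6) :
    b τ a j + ∑ h ∈ range j, aa τ a h j * c τ a h = 0 := by
  obtain ⟨i, rfl⟩ := Nat.exists_eq_add_of_le' h1
  rcases i with _ | i
  · have : c τ a 0 = -b τ a 1 := by rw [c]
    simp [aa_zero_one, this]
  · rw [Finset.sum_range_succ, aa_succ τ a (i + 1) (by omega) (by omega), c_succ]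
    have : (i : ℝ) + 1 ≠ 0 := by positivity
    push_cast
    field_simp
    ring

end Parameters

/-! ### Tails of slowly varying sequences -/

/-- Increments $o(n^{-4})$ are summable with tails $o(n^{-3})$. This is where the constant $C$ of
the expansions arises. -/
theorem exists_sub_isLittleO_of_diff {s : ℕ → ℝ}
    (h : (fun n => s (n + 1) - s n) =o[atTop] fun n : ℕ => (1 / (n : ℝ)) ^ 4) :
    ∃ C : ℝ, (fun n => s n - C) =o[atTop] fun n : ℕ => (1 / (n : ℝ)) ^ 3 := by
  have hs : Summable fun n => s (n + 1) - s n := by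
    refine summable_of_isBigO_nat (g := fun n : ℕ => (1 / (n : ℝ)) ^ 4) ?_ h.isBigO
    simp
  obtain ⟨C, hC⟩ : ∃ C, Tendsto s atTop (𝓝 C) := by
    have := hs.hasSum.tendsto_sum_nat
    simp only [Finset.sum_range_sub] at this
    exact ⟨_, by simpa using this.add_const (s 0)⟩
  refine ⟨C, isLittleO_iff.2 fun ε hε => ?_⟩
  obtain ⟨K, hK⟩ := eventually_atTop.1 ((isLittleO_iff.1 h) (show 0 < ε / 3 by positivity))
  filter_upwards [eventually_ge_atTop (max K 1)] with n hn
  have hstep : ∀ k : ℕ, max K 1 ≤ k → |s (k + 1) - s k|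
      ≤ ε * ((1 / (k : ℝ)) ^ 3 - (1 / ((k + 1 : ℕ) : ℝ)) ^ 3) := by
    intro k hk
    have hk1 : (1 : ℝ) ≤ k := by exact_mod_cast (le_max_right K 1).trans hk
    have h1 := hK k ((le_max_left K 1).trans hk)
    rw [Real.norm_eq_abs, Real.norm_of_nonneg (by positivity)] at h1
    refine h1.trans ?_
    -- Comparison with a telescoping sum; the factor 3 has slack and cancels against
    -- $\varepsilon/3$.
    have h2 : (1 / (k : ℝ)) ^ 4 ≤ 3 * ((1 / (k : ℝ)) ^ 3 - (1 / ((k : ℝ) + 1)) ^ 3) := by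
      rw [div_pow, div_pow, div_pow, div_sub_div _ _ (by positivity) (by positivity),
        ← mul_div_assoc, div_le_div_iff₀ (by positivity) (by positivity)]
      have h3 : (k : ℝ) ^ 3 ≤ k ^ 6 := pow_le_pow_right₀ hk1 (by norm_num)
      have h5 : 0 ≤ (k : ℝ) ^ 5 := by positivity
      linear_combination h3 + 6 * h5 + 7 * pow_nonneg (show (0 : ℝ) ≤ k by linarith) 6
    push_cast
    nlinarith
  have hsum : ∀ m : ℕ, n ≤ m → |s m - s n| ≤ ε * ((1 / (n : ℝ)) ^ 3 - (1 / (m : ℝ)) ^ 3) := by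
    intro m hm
    induction m, hm using Nat.le_induction with
    | base => simp
    | succ m hm ih =>
      have h1 := hstep m (hn.trans hm)
      have h2 := abs_sub_le (s (m + 1)) (s m) (s n)
      linarith
  have hlim : Tendsto (fun m => |s m - s n|) atTop (𝓝 |C - s n|) := (hC.sub_const _).abs
  have h3 : |C - s n| ≤ ε * (1 / (n : ℝ)) ^ 3 := by
    refine le_of_tendsto hlim ((eventually_ge_atTop n).mono fun m hm => (hsum m hm).trans ?_)
    have : 0 ≤ (1 / (m : ℝ)) ^ 3 := by positivity
    nlinarith
  rw [Real.norm_eq_abs, abs_sub_comm, Real.norm_of_nonneg (by positivity)]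
  exact h3

end Kindred

namespace Kindred

open scoped Polynomial.Bivariate Topology

/-! ### The expansion of iterates -/

section Iteration

variable {a : ℕ → ℝ} {x : ℕ → ℝ}

theorem lam_pos (ha : a 1 < 0) : 0 < lam 4 a := by
  rw [lam]
  exact div_pos_of_neg_of_neg (by norm_num) (by push_cast; linarith)

theorem isScale_zero {α : Type*} {l : Filter α} {δ : α → ℝ} (h : Tendsto δ l (𝓝 0)) :
    IsScale l (fun _ => 0) δ := by
  intro k
  rcases k with _ | k
  · simpa using h
  · simpa using tendsto_const_nhds

/-- The reciprocal of `y_n = λ / x_n⁴`. -/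
noncomputable def recipY (a : ℕ → ℝ) (x : ℕ → ℝ) (n : ℕ) : ℝ := x n ^ 4 / lam 4 a

theorem recipY_pos (ha : a 1 < 0) (hx : ∀ n, 0 < x n) (n : ℕ) : 0 < recipY a x n :=
  div_pos (pow_pos (hx n) 4) (lam_pos ha)

theorem isScale_recipY (hlim : Tendsto x atTop (𝓝 0)) :
    IsScale atTop (fun _ => 0) (recipY a x) :=
  isScale_zero (by
    have := (hlim.pow 4).div_const (lam 4 a)
    rw [zero_pow four_ne_zero, zero_div] at this
    exact this)

/-- `y_{n+1} / y_n - 1` in powers of `1 / y_n`. -/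
theorem hasExp_ratio (ha : a 1 < 0) (hx : ∀ n, 0 < x n) (hlim : Tendsto x atTop (𝓝 0))
    (hstep : (fun n => x (n + 1) / x n - (1 + ∑ m ∈ Icc 1 5, a m * x n ^ (4 * m)))
      =o[atTop] fun n => x n ^ 20) :
    HasExp atTop (fun _ => 0) (recipY a x) 5 (fun n => recipY a x n / recipY a x (n + 1) - 1)
      (seriesPoly 5 fun i => Polynomial.C (stepCoeff 4 a i)) := by
  have hl := lam_pos ha
  have hS := isScale_recipY (a := a) hlim
  have h1 : HasExp atTop (fun _ => 0) (recipY a x) 5 (fun n => x (n + 1) / x n - 1)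
      (seriesPoly 5 fun i => Polynomial.C (lam 4 a ^ i * a i)) := by
    have h2 : (fun n => x n ^ 20) =O[atTop] fun n => recipY a x n ^ 5 := by
      refine IsBigO.of_bound (lam 4 a ^ 5) (Eventually.of_forall fun n => le_of_eq ?_)
      rw [recipY, div_pow, norm_div, Real.norm_of_nonneg (pow_pos hl 5).le, ← pow_mul]
      field_simp
    refine (hstep.trans_isBigO h2).congr_left fun n => ?_
    rw [evalEval_seriesPoly, sub_sub]
    congr 2
    refine Finset.sum_congr rfl fun m _ => ?_
    rw [Polynomial.eval_C, recipY, div_pow, ← pow_mul]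
    field_simp
  have h2 := h1.comp_seriesPoly_C hS (binom_isBigO (-(4 : ℕ)) 5)
  refine (h2.congr_fun (Eventually.of_forall fun n => ?_)).congr hS fun k hk => ?_
  · have hn := hx n
    have hn1 := hx (n + 1)
    have : (1 + (x (n + 1) / x n - 1)) = x (n + 1) / x n := by ring
    simp only [binom_zero, recipY]
    -- $y_{n+1}/y_n=(x_{n+1}/x_n)^{-4}$, so the expansion is that of $(1+u)^{-4}$ at
    -- $u=x_{n+1}/x_n-1$.
    rw [this, Real.rpow_neg (by positivity), Real.rpow_natCast]
    field_simp
  · simp only [coeff_seriesPoly]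
    split_ifs with h
    · rw [stepCoeff_eq_compCoeff (by norm_num) ha.ne h.1 (by omega)]
    · rfl

/-- The Abel function `y - b₁ log y + c₁ / y + c₂ / y² + c₃ / y³` at `y = 1 / η`. -/
noncomputable def abelFn (a : ℕ → ℝ) (η : ℝ) : ℝ :=
  η⁻¹ + b 4 a 1 * Real.log η + ∑ i ∈ Icc 1 3, c 4 a i * η ^ i

theorem coeff_C_mul_X_pow_mul_seriesPoly {R : Type*} [CommRing R] {N k : ℕ} (r : R) (v : ℕ → R)
    (i : ℕ) (hk : k ≤ N + i) :
    (Polynomial.C r * (Polynomial.X ^ i * seriesPoly N v)).coeff k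
      = if i < k then r * v (k - i) else 0 := by
  rw [Polynomial.coeff_C_mul, Polynomial.coeff_X_pow_mul', coeff_seriesPoly]
  rcases lt_trichotomy i k with h | h | h
  · rw [if_pos h.le, if_pos ⟨by omega, by omega⟩, if_pos h]
  · subst h
    simp
  · rw [if_neg (by omega), if_neg (by omega), mul_zero]

theorem coeff_C_mul_X_pow_mul_seriesPoly_C {N k : ℕ} (r : ℝ) (v : ℕ → ℝ) (i : ℕ) (hk : k ≤ N) :
    (Polynomial.C (Polynomial.C r) * (Polynomial.X ^ i *
      seriesPoly N fun j => Polynomial.C (v j)) : ℝ[X][Y]).coeff k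
      = Polynomial.C (if i < k then r * v (k - i) else 0) := by
  rw [coeff_C_mul_X_pow_mul_seriesPoly _ _ _ (by omega)]
  split_ifs <;> simp

/-- The polynomial expands $\eta_n\,(A(y_{n+1})-A(y_n)-1)$ in $\eta_n=1/y_n$. Its coefficient at
$k=j+2$ is $b_{j+1}+\sum_{h\le j}a_{h,j+1}c_h$. As $k\le5$ forces $j\le3$, the three terms
$c_1,c_2,c_3$ of `abelFn` suffice. -/
theorem coeff_abel_eq_zero (a : ℕ → ℝ) {k : ℕ} (hk : k ≤ 5) :
    ((seriesPoly 5 fun i => Polynomial.C (stepCoeff 4 a i)) - Polynomial.X +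
        Polynomial.C (Polynomial.C (-b 4 a 1)) * (Polynomial.X ^ 1 *
          seriesPoly 5 fun i => Polynomial.C (compCoeff logCoeff (stepCoeff 4 a) i)) +
      ∑ i ∈ Icc 1 3, Polynomial.C (Polynomial.C (c 4 a i)) * (Polynomial.X ^ (i + 1) *
        seriesPoly 5 fun j => Polynomial.C (compCoeff (binom (-(i : ℝ))) (stepCoeff 4 a) j)) :
      ℝ[X][Y]).coeff k = 0 := by
  have hc0 : c 4 a 0 = -b 4 a 1 := by rw [c]
  have hst : stepCoeff 4 a 1 = 1 := by simp [stepCoeff]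
  rw [Polynomial.coeff_add, Polynomial.coeff_add, Polynomial.coeff_sub, Polynomial.finsetSum_coeff,
    coeff_C_mul_X_pow_mul_seriesPoly_C _ _ _ hk, Finset.sum_congr rfl fun (i : ℕ) _ =>
      coeff_C_mul_X_pow_mul_seriesPoly_C (c 4 a i) (compCoeff (binom (-(i : ℝ))) (stepCoeff 4 a))
        (i + 1) hk,
    coeff_seriesPoly, Polynomial.coeff_X]
  rcases k with _ | _ | j
  · simp
  · simp [hst]
  · have hb := b_add_sum_aa_mul_c 4 a (j := j + 1) (by omega) (by omega)
    rw [Finset.sum_range_succ', aa_zero_eq_compCoeff 4 a (by omega), hc0] at hb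
    have hsum : ∑ i ∈ Icc 1 3, (if i + 1 < j + 1 + 1 then c 4 a i *
        compCoeff (binom (-(i : ℝ))) (stepCoeff 4 a) (j + 1 + 1 - (i + 1)) else 0)
        = ∑ h ∈ range j, aa 4 a (h + 1) (j + 1) * c 4 a (h + 1) := by
      rw [← Finset.sum_filter]
      refine (Finset.sum_bij (fun h _ => h + 1) ?_ ?_ ?_ ?_).symm
      · intro h hh
        have := Finset.mem_range.1 hh
        simp
        omega
      · intro _ _ _ _ h
        omega
      · intro i hi
        simp at hi
        exact ⟨i - 1, by simp; omega, by omega⟩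
      · intro h hh
        rw [aa_eq_compCoeff 4 a (by omega) (by omega), mul_comm]
        congr 2
        omega
    rw [if_pos ⟨by omega, hk⟩, if_neg (by omega), if_pos (by omega), sub_zero, ← map_sum, hsum,
      ← map_add, ← map_add, ← map_zero Polynomial.C]
    congr 1
    have : stepCoeff 4 a (j + 1 + 1) = b 4 a (j + 1) := by simp [stepCoeff]
    rw [this, Nat.add_sub_cancel]
    linarith

theorem abelFn_diff (ha : a 1 < 0) (hx : ∀ n, 0 < x n) (hlim : Tendsto x atTop (𝓝 0))
    (hstep : (fun n => x (n + 1) / x n - (1 + ∑ m ∈ Icc 1 5, a m * x n ^ (4 * m)))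
      =o[atTop] fun n => x n ^ 20) :
    (fun n => abelFn a (recipY a x (n + 1)) - abelFn a (recipY a x n) - 1)
      =o[atTop] fun n => recipY a x n ^ 4 := by
  have hS := isScale_recipY (a := a) hlim
  have hu := hasExp_ratio ha hx hlim hstep
  set η := recipY a x with hη
  have hpos : ∀ n, 0 < η n := recipY_pos ha hx
  have hlog := ((hu.comp_seriesPoly_C hS (log_isBigO 5)).delta_pow_mul 1).const_mul (-b 4 a 1)
  have hpw : ∀ i : ℕ, _ := fun i =>
    ((hu.comp_seriesPoly_C hS (binom_isBigO (-(i : ℝ)) 5)).delta_pow_mul (i + 1)).const_mul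
      (c 4 a i)
  have hη1 : HasExp atTop (fun _ => 0) η 5 η Polynomial.X := by
    simpa using (HasExp.self (l := atTop) (X := fun _ : ℕ => (0 : ℝ)) (δ := η) (N := 5)
      (Polynomial.X : ℝ[X][Y]))
  have htot := ((hu.sub hη1).add (hlog.mono hS (by norm_num))).add
    (HasExp.finset_sum (Icc 1 3) fun i _ => (hpw i).mono hS (Nat.le_add_right 5 (i + 1)))
  have hzero : HasExp atTop (fun _ => 0) η 5 _ 0 := htot.congr hS fun k hk => by
    rw [Polynomial.coeff_zero]
    exact coeff_abel_eq_zero a hk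
  -- The extra factor $\eta_n$ keeps the expansion free of negative powers; it is divided out at the
  -- end, which turns order 5 into order 4.
  have hfin : (fun n => η n * (abelFn a (η (n + 1)) - abelFn a (η n) - 1))
      =o[atTop] fun n => η n * η n ^ 4 := by
    refine IsLittleO.congr hzero (fun n => ?_) fun n => by ring
    have h0 := hpos n
    have h1 := hpos (n + 1)
    have e1 : 1 + (η n / η (n + 1) - 1) = η n / η (n + 1) := by ring
    simp only [e1, Polynomial.evalEval_zero, sub_zero, logCoeff_zero, binom_zero]
    rw [Real.log_div h0.ne' h1.ne']
    have e2 : ∀ i ∈ Icc 1 3, c 4 a i * (η n ^ (i + 1) * ((η n / η (n + 1)) ^ (-(i : ℝ)) - 1))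
        = η n * (c 4 a i * η (n + 1) ^ i - c 4 a i * η n ^ i) := by
      intro i _
      rw [Real.rpow_neg (by positivity), Real.rpow_natCast, div_pow]
      field_simp
      ring
    rw [Finset.sum_congr rfl e2, ← Finset.mul_sum, Finset.sum_sub_distrib]
    simp only [abelFn]
    field_simp
    ring
  refine ((isBigO_refl (fun n => (η n)⁻¹) atTop).mul_isLittleO hfin).congr
    (fun n => ?_) fun n => ?_ <;>
  · have := (hpos n).ne'
    field_simp

end Iteration

end Kindred

namespace Kindred

open scoped Polynomial.Bivariate Topology

/-! ### From the Abel function to the expansion of the iterates -/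

section Iteration

variable {a : ℕ → ℝ} {x : ℕ → ℝ}

theorem tendsto_inv_recipY_div (ha : a 1 < 0) (hx : ∀ n, 0 < x n)
    (hlim : Tendsto x atTop (𝓝 0))
    (hstep : (fun n => x (n + 1) / x n - (1 + ∑ m ∈ Icc 1 5, a m * x n ^ (4 * m)))
      =o[atTop] fun n => x n ^ 20) :
    Tendsto (fun n : ℕ => (recipY a x n)⁻¹ / n) atTop (𝓝 1) := by
  have hS := isScale_recipY (a := a) hlim
  have hu := hasExp_ratio ha hx hlim hstep
  set η := recipY a x with hη
  have hpos : ∀ n, 0 < η n := recipY_pos ha hx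
  have h1 : HasExp atTop (fun _ => 0) η 1 (fun n => η n / η (n + 1) - 1) Polynomial.X :=
    (hu.mono hS (by norm_num)).congr hS fun k hk => by
      rw [coeff_seriesPoly, Polynomial.coeff_X]
      interval_cases k <;> simp [stepCoeff]
  have h2 : Tendsto (fun n => (η (n + 1))⁻¹ - (η n)⁻¹) atTop (𝓝 1) := by
    have h3 := (IsLittleO.tendsto_div_nhds_zero h1).add_const 1
    rw [zero_add] at h3
    refine h3.congr fun n => ?_
    have h0 := (hpos n).ne'
    have h0' := (hpos (n + 1)).ne'
    rw [Polynomial.evalEval_X]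
    field_simp
    ring
  -- The increments of $y_n$ tend to 1, hence so do their averages $(y_n-y_0)/n$.
  have h4 := h2.cesaro
  simp only [Finset.sum_range_sub fun n => (η n)⁻¹] at h4
  have h5 : Tendsto (fun n : ℕ => (η 0)⁻¹ / (n : ℝ)) atTop (𝓝 0) :=
    tendsto_const_div_atTop_nhds_zero_nat _
  have h6 := h4.add h5
  rw [add_zero] at h6
  exact h6.congr fun n => by ring

theorem isScale_log (r C : ℝ) :
    IsScale atTop (fun n : ℕ => r * Real.log n + C) (fun n : ℕ => 1 / (n : ℝ)) := by
  intro k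
  have h1 : (fun n : ℕ => r * Real.log n + C) =O[atTop] fun n : ℕ => Real.log n := by
    refine ((isBigO_refl _ _).const_mul_left r).add ?_
    have : (fun _ : ℝ => C) =o[atTop] Real.log := Real.isLittleO_const_log_atTop
    exact (this.comp_tendsto tendsto_natCast_atTop_atTop).isBigO
  have h2 : (fun n : ℕ => Real.log n ^ k) =o[atTop] fun n : ℕ => (n : ℝ) := by
    have := Real.isLittleO_pow_log_id_atTop (n := k)
    exact this.comp_tendsto tendsto_natCast_atTop_atTop
  have h3 := ((h1.pow k).trans_isLittleO h2).tendsto_div_nhds_zero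
  exact h3.congr fun n => by rw [mul_one_div]

/-- The fixed point equation satisfied by the `T_m`, to order `N + 1`. -/
theorem coeff_fixedPoint_eq_T (a : ℕ → ℝ) {N k : ℕ} (hN : N < 4) (hk : k ≤ N + 1) :
    (Polynomial.C Polynomial.X * Polynomial.X
      + Polynomial.C (Polynomial.C (b 4 a 1)) * (Polynomial.X ^ 1 *
          seriesPoly N (compCoeff (fun d => Polynomial.C (logCoeff d)) (T 4 a)))
      - ∑ i ∈ Icc 1 3, Polynomial.C (Polynomial.C (c 4 a i)) * (Polynomial.X ^ (i + 1) *
          seriesPoly N (compCoeff (fun d => Polynomial.C (binom (-(i : ℝ)) d)) (T 4 a)))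
      - ∑ i ∈ Icc 1 3, Polynomial.C (Polynomial.C (c 4 a i)) * Polynomial.X ^ (i + 1) :
      ℝ[X][Y]).coeff k = (seriesPoly (N + 1) (T 4 a)).coeff k := by
  have hT1 : T 4 a 1 = Polynomial.X := by rw [T]
  simp only [Polynomial.coeff_add, Polynomial.coeff_sub, Polynomial.finsetSum_coeff]
  rw [coeff_C_mul_X_pow_mul_seriesPoly _ _ _ hk, Finset.sum_congr rfl fun (i : ℕ) _ =>
      coeff_C_mul_X_pow_mul_seriesPoly (Polynomial.C (c 4 a i))
        (compCoeff (fun d => Polynomial.C (binom (-(i : ℝ)) d)) (T 4 a)) (i + 1) (by omega),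
    coeff_seriesPoly, Polynomial.coeff_C_mul, Polynomial.coeff_X]
  simp only [Polynomial.coeff_C_mul, Polynomial.coeff_X_pow]
  rcases k with _ | _ | m
  · simp
  · simp [hT1]
  · rw [if_neg (by omega), mul_zero, zero_add, if_pos (by omega), if_pos ⟨by omega, hk⟩,
      T_eq_compCoeff]
    have h1 : ∑ i ∈ Icc 1 3, (if i + 1 < m + 1 + 1 then Polynomial.C (c 4 a i) *
        compCoeff (fun d => Polynomial.C (binom (-(i : ℝ)) d)) (T 4 a) (m + 1 + 1 - (i + 1)) else 0)
        = ∑ p ∈ Icc 1 m, Polynomial.C (c 4 a p) *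
            compCoeff (fun d => Polynomial.C (binom (-(p : ℝ)) d)) (T 4 a) (m + 1 - p) := by
      rw [← Finset.sum_filter]
      refine Finset.sum_congr (by ext i; simp; omega) fun i _ => ?_
      rw [show m + 1 + 1 - (i + 1) = m + 1 - i by omega]
    -- The index $m+1$ lies in the range because $N<4$ bounds it by 3.
    have h2 : ∑ i ∈ Icc 1 3, Polynomial.C (c 4 a i) * (if m + 1 + 1 = i + 1 then (1 : ℝ[X]) else 0)
        = Polynomial.C (c 4 a (m + 1)) := by
      rw [Finset.sum_eq_single_of_mem (m + 1) (by simp; omega)]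
      · simp
      · intro i _ hi
        rw [if_neg (by omega), mul_zero]
    rw [h1, h2, show m + 1 + 1 - 1 = m + 1 by omega]
    ring

/-- The expansion of `y_n / n - 1` with coefficients `T_m(b₁ log n + C)`. -/
theorem exists_hasExp_T (ha : a 1 < 0) (hx : ∀ n, 0 < x n)
    (hlim : Tendsto x atTop (𝓝 0))
    (hstep : (fun n => x (n + 1) / x n - (1 + ∑ m ∈ Icc 1 5, a m * x n ^ (4 * m)))
      =o[atTop] fun n => x n ^ 20) :
    ∃ C : ℝ, HasExp atTop (fun n : ℕ => b 4 a 1 * Real.log n + C) (fun n : ℕ => 1 / (n : ℝ)) 4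
      (fun n => (recipY a x n)⁻¹ / n - 1) (seriesPoly 4 (T 4 a)) := by
  have hyn := tendsto_inv_recipY_div ha hx hlim hstep
  have hab := abelFn_diff ha hx hlim hstep
  set η := recipY a x with hη
  have hpos : ∀ n, 0 < η n := recipY_pos ha hx
  have hO : η =O[atTop] fun n : ℕ => 1 / (n : ℝ) := by
    have h1 := ((hyn.inv₀ one_ne_zero).isBigO_one ℝ).mul
      (isBigO_refl (fun n : ℕ => 1 / (n : ℝ)) atTop)
    refine h1.congr' ?_ (by simp)
    filter_upwards [eventually_gt_atTop 0] with n hn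
    have : (0 : ℝ) < n := by exact_mod_cast hn
    field_simp
  obtain ⟨C, hC⟩ := exists_sub_isLittleO_of_diff (s := fun n => abelFn a (η n) - n)
    ((hab.trans_isBigO (hO.pow 4)).congr_left fun n => by push_cast; ring)
  refine ⟨C, ?_⟩
  set X := fun n : ℕ => b 4 a 1 * Real.log n + C with hX
  set δ := fun n : ℕ => 1 / (n : ℝ) with hδ
  have hS : IsScale atTop X δ := isScale_log _ _
  set w := fun n => (η n)⁻¹ / n - 1 with hw
  -- The exact identity obtained by solving the definition of $A(y_n)$ for $w_n=y_n/n-1$.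
  -- Subtracting the constant terms `logCoeff 0` and `binom _ 0` makes each bracket a series without
  -- constant term; the split-off part is the second sum over $c_i$.
  have hfix : ∀ᶠ n in atTop, X n * δ n + b 4 a 1 * (δ n ^ 1 * (Real.log (1 + w n) - logCoeff 0))
      - ∑ i ∈ Icc 1 3, c 4 a i * (δ n ^ (i + 1) *
          ((1 + w n) ^ (-(i : ℝ)) - binom (-(i : ℝ)) 0))
      - ∑ i ∈ Icc 1 3, c 4 a i * δ n ^ (i + 1) + δ n * (abelFn a (η n) - n - C) = w n := by
    filter_upwards [eventually_gt_atTop 0] with n hn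
    have hn' : (0 : ℝ) < n := by exact_mod_cast hn
    have hηn := hpos n
    have e1 : 1 + w n = (η n)⁻¹ / n := by rw [hw]; ring
    rw [sub_sub _ (∑ i ∈ Icc 1 3, _), ← Finset.sum_add_distrib, e1]
    have e2 : ∀ i ∈ Icc 1 3, c 4 a i * (δ n ^ (i + 1) *
          (((η n)⁻¹ / n) ^ (-(i : ℝ)) - binom (-(i : ℝ)) 0)) + c 4 a i * δ n ^ (i + 1)
        = δ n * (c 4 a i * η n ^ i) := by
      intro i _
      rw [Real.rpow_neg (by positivity), Real.rpow_natCast, binom_zero, hδ]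
      simp only [div_pow, inv_pow, one_pow]
      field_simp
      ring
    rw [Finset.sum_congr rfl e2, ← Finset.mul_sum, Real.log_div (inv_ne_zero hηn.ne') hn'.ne',
      Real.log_inv, abelFn, logCoeff_zero, hX, hδ, hw]
    field_simp
    ring
  have hrem : HasExp atTop X δ 4 (fun n => δ n * (abelFn a (η n) - n - C)) 0 := by
    refine ((isBigO_refl δ atTop).mul_isLittleO hC).congr (fun n => ?_) fun n => ?_
    · rw [Polynomial.evalEval_zero, sub_zero]
    · ring
  -- Bootstrapping: order $N$ of $w$ on the right of the fixed point equation yields order $N+1$ on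
  -- the left, up to order 4 where the remainder `hrem` stops it.
  have hmain : ∀ N, N ≤ 4 → HasExp atTop X δ N w (seriesPoly N (T 4 a)) := by
    intro N
    induction N with
    | zero =>
      intro _
      have : Tendsto w atTop (𝓝 0) := by simpa using hyn.sub_const 1
      have h0 := (Asymptotics.isLittleO_one_iff ℝ).2 this
      refine h0.congr (fun n => ?_) fun n => by simp
      simp [evalEval_seriesPoly]
    | succ N ih =>
      intro hN
      have hw := ih (by omega)
      have h1 : HasExp atTop X δ (N + 1) (fun n => X n * δ n)
          (Polynomial.C Polynomial.X * Polynomial.X) := by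
        have := HasExp.self (l := atTop) (X := X) (δ := δ) (N := N + 1)
          (Polynomial.C Polynomial.X * Polynomial.X)
        simpa [Polynomial.evalEval_mul, Polynomial.evalEval_C] using this
      have h2 := ((hw.comp_seriesPoly hS (log_isBigO N)).delta_pow_mul 1).const_mul (b 4 a 1)
      have h3 := HasExp.finset_sum (Icc 1 3) fun (i : ℕ) _ =>
        (((hw.comp_seriesPoly hS (binom_isBigO (-(i : ℝ)) N)).delta_pow_mul
          (i + 1)).const_mul (c 4 a i)).mono hS (M := N + 1) (by omega)
      have h4 : HasExp atTop X δ (N + 1) (fun n => ∑ i ∈ Icc 1 3, c 4 a i * δ n ^ (i + 1))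
          (∑ i ∈ Icc 1 3, Polynomial.C (Polynomial.C (c 4 a i)) * Polynomial.X ^ (i + 1)) := by
        have := HasExp.self (l := atTop) (X := X) (δ := δ) (N := N + 1)
          (∑ i ∈ Icc 1 3, Polynomial.C (Polynomial.C (c 4 a i)) * Polynomial.X ^ (i + 1))
        simpa [Polynomial.evalEval_mul, Polynomial.evalEval_C, Polynomial.evalEval_finsetSum,
          Polynomial.evalEval_pow] using this
      have h5 := (((h1.add h2).sub h3).sub h4).add (hrem.mono hS hN)
      refine (h5.congr_fun hfix).congr hS fun k hk => ?_
      rw [add_zero]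
      exact coeff_fixedPoint_eq_T a (by omega) hk
  exact hmain 4 le_rfl

/-- The substitution $\widetilde T_m(X)=T_m(-4X)$ undoes the factor $-1/4$, which is there to make
$P_1=X$. -/
theorem compCoeff_eval_eq_P (a : ℕ → ℝ) (X : ℝ) {m : ℕ} (h1 : 1 ≤ m) (h6 : m ≤ 6) :
    (compCoeff (fun d => Polynomial.C (binom (-(1 / ((4 : ℕ) : ℝ))) d)) (T 4 a) m).eval X
      = (P 4 a m).eval (-(1 / ((4 : ℕ) : ℝ)) * X) := by
  obtain ⟨j, rfl⟩ := Nat.exists_eq_add_of_le' h1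
  rcases j with _ | j
  · rw [compCoeff_one, binom_one, T, P]
    simp
  · rw [P_eq_compCoeff 4 a h6, ← Polynomial.coe_evalRingHom, ← Polynomial.coe_evalRingHom,
      map_compCoeff, map_compCoeff]
    simp only [Polynomial.coe_evalRingHom, Polynomial.eval_C, Polynomial.eval_comp,
      Polynomial.eval_mul, Polynomial.eval_X]
    congr 1
    funext i
    congr 1
    push_cast
    ring

theorem exists_expandsAs_formulaA (ha : a 1 < 0) (hx : ∀ n, 0 < x n)
    (hlim : Tendsto x atTop (𝓝 0))
    (hstep : (fun n => x (n + 1) / x n - (1 + ∑ m ∈ Icc 1 5, a m * x n ^ (4 * m)))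
      =o[atTop] fun n => x n ^ 20) :
    ∃ C : ℝ, ExpandsAs x (formulaA 4 a 4 C) := by
  obtain ⟨C, hC⟩ := exists_hasExp_T ha hx hlim hstep
  have hl := lam_pos ha
  refine ⟨C, ?_⟩
  have h1 := hC.comp_seriesPoly (isScale_log _ _) (binom_isBigO (-(1 / ((4 : ℕ) : ℝ))) 4)
  have h2 := (isBigO_refl (fun n : ℕ => (lam 4 a / n) ^ (1 / ((4 : ℕ) : ℝ))) atTop).mul_isLittleO h1
  have h3 : (fun n : ℕ => (lam 4 a / n) ^ (1 / ((4 : ℕ) : ℝ)) * (1 / (n : ℝ)) ^ 4)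
      =O[atTop] fun n : ℕ => (n : ℝ) ^ (-(17 / 4) : ℝ) := by
    refine IsBigO.of_bound (lam 4 a ^ (1 / ((4 : ℕ) : ℝ))) ?_
    filter_upwards [eventually_gt_atTop 0] with n hn
    have hn' : (0 : ℝ) < n := by exact_mod_cast hn
    rw [Real.norm_of_nonneg (by positivity), Real.norm_of_nonneg (by positivity),
      Real.div_rpow hl.le hn'.le, show (-(17 / 4) : ℝ) = -(1 / ((4 : ℕ) : ℝ)) + -((4 : ℕ) : ℝ) by
        push_cast; norm_num, Real.rpow_add hn', Real.rpow_neg hn'.le, Real.rpow_neg hn'.le,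
      Real.rpow_natCast, one_div_pow]
    apply le_of_eq
    ring
  refine (h2.trans_isBigO h3).congr' ?_ EventuallyEq.rfl
  filter_upwards [eventually_gt_atTop 0] with n hn
  have hn' : (0 : ℝ) < n := by exact_mod_cast hn
  have hxn := hx n
  have e1 : (1 + ((recipY a x n)⁻¹ / n - 1)) = lam 4 a / n * (1 / x n ^ 4) := by
    rw [recipY]
    field_simp
    ring
  have e2 : (x n ^ 4) ^ (1 / ((4 : ℕ) : ℝ)) = x n := by
    rw [one_div, Real.pow_rpow_inv_natCast hxn.le (by norm_num)]
  -- This is $x_n=(\lambda/n)^{1/4}(1+w_n)^{-1/4}$, with $1+w_n=\lambda/(nx_n^4)$.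
  have e3 : (lam 4 a / n) ^ (1 / ((4 : ℕ) : ℝ)) *
      (lam 4 a / n * (1 / x n ^ 4)) ^ (-(1 / ((4 : ℕ) : ℝ))) = x n := by
    rw [Real.mul_rpow (by positivity) (by positivity), ← mul_assoc, ← Real.rpow_add (by positivity),
      add_neg_cancel, Real.rpow_zero, one_mul, Real.rpow_neg (by positivity),
      Real.div_rpow zero_le_one (by positivity), e2, Real.one_rpow, one_div, inv_inv]
  rw [e1, binom_zero, formulaA, evalEval_seriesPoly, mul_sub, mul_sub, mul_one, e3]
  rw [mul_add, mul_one, sub_sub]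
  congr 2
  congr 1
  refine Finset.sum_congr rfl fun m hm => ?_
  have hm := Finset.mem_Icc.1 hm
  rw [compCoeff_eval_eq_P a _ hm.1 (by omega), one_div_pow, mul_one_div]

end Iteration

end Kindred

namespace Kindred

open scoped Topology Nat

/-! ### Power series in `x^(4k+1)` -/

/-- `∑ u_k x^(4k+1)` for `U = ∑ u_k x^k`. -/
noncomputable def gapSeries (U : PowerSeries ℝ) : PowerSeries ℝ :=
  PowerSeries.X * PowerSeries.expand 4 four_ne_zero U

theorem coeff_gapSeries_pow (U : PowerSeries ℝ) (d n : ℕ) :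
    PowerSeries.coeff n (gapSeries U ^ d) =
      if d ≤ n ∧ 4 ∣ n - d then PowerSeries.coeff ((n - d) / 4) (U ^ d) else 0 := by
  rw [gapSeries, mul_pow, ← map_pow, PowerSeries.coeff_X_pow_mul']
  by_cases h : d ≤ n
  · by_cases h4 : 4 ∣ n - d
    · obtain ⟨k, hk⟩ := h4
      rw [if_pos h, if_pos ⟨h, ⟨k, hk⟩⟩, hk, PowerSeries.coeff_expand_mul,
        Nat.mul_div_cancel_left _ (by norm_num)]
    · rw [if_pos h, if_neg fun hh => h4 hh.2, PowerSeries.coeff_expand_of_not_dvd _ _ _ h4]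
  · simp [h]

theorem coeff_gapSeries (U : PowerSeries ℝ) (k : ℕ) :
    PowerSeries.coeff (4 * k + 1) (gapSeries U) = PowerSeries.coeff k U := by
  have := coeff_gapSeries_pow U 1 (4 * k + 1)
  simpa using this

theorem coeff_gapSeries_of_ne (U : PowerSeries ℝ) {n : ℕ} (hn : n % 4 ≠ 1) :
    PowerSeries.coeff n (gapSeries U) = 0 := by
  have := coeff_gapSeries_pow U 1 n
  rw [pow_one, if_neg (by omega)] at this
  exact this

theorem eq_gapSeries {A : PowerSeries ℝ} (h : ∀ n, n % 4 ≠ 1 → PowerSeries.coeff n A = 0) :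
    A = gapSeries (PowerSeries.mk fun k => PowerSeries.coeff (4 * k + 1) A) := by
  ext n
  by_cases hn : n % 4 = 1
  · obtain ⟨k, rfl⟩ : ∃ k, n = 4 * k + 1 := ⟨n / 4, by omega⟩
    rw [coeff_gapSeries, PowerSeries.coeff_mk]
  · rw [h n hn, coeff_gapSeries_of_ne _ hn]

theorem hasSum_gapSeries_iff (U : PowerSeries ℝ) (x s : ℝ) :
    HasSum (fun n => PowerSeries.coeff n (gapSeries U) * x ^ n) s ↔
      HasSum (fun k => PowerSeries.coeff k U * x ^ (4 * k + 1)) s := by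
  have hinj : Function.Injective fun k : ℕ => 4 * k + 1 := fun _ _ h => by simpa using h
  rw [← hinj.hasSum_iff]
  · simp only [Function.comp_def, coeff_gapSeries]
  · intro n hn
    rw [coeff_gapSeries_of_ne, zero_mul]
    intro h
    exact hn ⟨n / 4, by show 4 * (n / 4) + 1 = n; omega⟩

theorem hasFPowerSeriesOnBall_seriesSum {A : PowerSeries ℝ} (h : 0 < radius A) :
    HasFPowerSeriesOnBall (seriesSum A)
      (FormalMultilinearSeries.ofScalars ℝ fun n => PowerSeries.coeff n A) 0 (radius A) := by
  have h1 := (FormalMultilinearSeries.ofScalars ℝ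
    fun n => PowerSeries.coeff n A).hasFPowerSeriesOnBall h
  refine h1.congr fun x _ => ?_
  rw [seriesSum, FormalMultilinearSeries.sum]
  exact tsum_congr fun n => by simp [mul_comm]

/-- Uniqueness of the power series of an analytic function. -/
theorem taylorSeries_eq {f : ℝ → ℝ} {A : PowerSeries ℝ}
    (h : HasFPowerSeriesAt f
      (FormalMultilinearSeries.ofScalars ℝ fun n => PowerSeries.coeff n A) 0) :
    taylorSeries f = A := by
  have h1 := h.analyticAt.hasFPowerSeriesAt.eq_formalMultilinearSeries h
  have h2 := FormalMultilinearSeries.ofScalars_series_injective ℝ ℝ h1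
  ext n
  rw [taylorSeries, PowerSeries.coeff_mk]
  exact congrFun h2 n

/-! ### The Fresnel cosine and its hyperbolic companion -/

/-- The coefficients `ε^k (π/2)^(2k) / ((2k)! (4k+1))`: for `ε = -1` those of the Fresnel cosine,
for `ε = 1` those of `∫₀ˣ cosh (π t² / 2) dt`. -/
noncomputable def fresnelU (ε : ℝ) : PowerSeries ℝ :=
  PowerSeries.mk fun k => ε ^ k * ((Real.pi / 2) ^ (2 * k) / ((2 * k)! * (4 * k + 1)))

theorem summable_pow_div_two_mul_factorial (r : ℝ) :
    Summable fun k : ℕ => r ^ (2 * k) / ((2 * k)! : ℝ) :=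
  (Real.summable_pow_div_factorial r).comp_injective
    (i := fun k : ℕ => 2 * k) fun _ _ h => by simpa using h

/-- Dropping the denominators $4k+1$ leaves the even part of an exponential series. -/
theorem summable_fresnelU {ε : ℝ} (hε : |ε| = 1) (x : ℝ) :
    Summable fun k => |PowerSeries.coeff k (fresnelU ε) * x ^ (4 * k + 1)| := by
  refine Summable.of_nonneg_of_le (fun _ => abs_nonneg _) (fun k => ?_)
    ((summable_pow_div_two_mul_factorial (Real.pi / 2 * x ^ 2)).mul_right |x|)
  rw [fresnelU, PowerSeries.coeff_mk, abs_mul, abs_mul, abs_pow, hε, one_pow, one_mul, abs_pow,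
    abs_of_nonneg (by positivity : 0 ≤ (Real.pi / 2) ^ (2 * k) / ((2 * k)! * (4 * k + 1) : ℝ)),
    mul_pow, ← pow_mul, pow_succ, ← mul_assoc, show 2 * (2 * k) = 4 * k by ring,
    Even.pow_abs (⟨2 * k, by ring⟩ : Even (4 * k)) x]
  refine mul_le_mul_of_nonneg_right ?_ (abs_nonneg x)
  rw [div_mul_eq_mul_div]
  refine div_le_div_of_nonneg_left (mul_nonneg (by positivity) ?_) (by positivity) ?_
  · rw [show 4 * k = 2 * (2 * k) by ring, pow_mul]
    positivity
  · have : (0 : ℝ) ≤ k := by positivity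
    exact le_mul_of_one_le_right (by positivity) (by linarith)

theorem radius_gapSeries_fresnelU {ε : ℝ} (hε : |ε| = 1) :
    radius (gapSeries (fresnelU ε)) = ⊤ := by
  refine FormalMultilinearSeries.radius_eq_top_of_summable_norm _ fun r => ?_
  simp only [FormalMultilinearSeries.ofScalars_norm]
  have h1 := (hasSum_gapSeries_iff (fresnelU ε) r _).2 (summable_fresnelU hε r).of_abs.hasSum
  refine h1.summable.abs.congr fun n => ?_
  rw [abs_mul, Real.norm_eq_abs, abs_of_nonneg (by positivity : (0 : ℝ) ≤ (r : ℝ) ^ n)]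

theorem hasFPowerSeriesOnBall_fresnelU {ε : ℝ} (hε : |ε| = 1) :
    HasFPowerSeriesOnBall (seriesSum (gapSeries (fresnelU ε)))
      (FormalMultilinearSeries.ofScalars ℝ fun n =>
        PowerSeries.coeff n (gapSeries (fresnelU ε))) 0 ⊤ := by
  have := hasFPowerSeriesOnBall_seriesSum (A := gapSeries (fresnelU ε))
    (by rw [radius_gapSeries_fresnelU hε]; simp)
  rwa [radius_gapSeries_fresnelU hε] at this

theorem hasSum_seriesSum_fresnelU {ε : ℝ} (hε : |ε| = 1) (x : ℝ) :
    HasSum (fun k => PowerSeries.coeff k (fresnelU ε) * x ^ (4 * k + 1))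
      (seriesSum (gapSeries (fresnelU ε)) x) := by
  have h1 := (hasSum_gapSeries_iff (fresnelU ε) x _).2 (summable_fresnelU hε x).of_abs.hasSum
  rw [seriesSum, h1.tsum_eq]
  exact (summable_fresnelU hε x).of_abs.hasSum

/-- Termwise integration of the cosine series, dominated on the interval by the series of absolute
values at the endpoint $x$. -/
theorem fresnelC_eq_seriesSum : fresnelC = seriesSum (gapSeries (fresnelU (-1))) := by
  funext x
  refine HasSum.unique ?_ (hasSum_seriesSum_fresnelU (by norm_num) x)
  have h := intervalIntegral.hasSum_integral_of_dominated_convergence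
    (μ := MeasureTheory.volume) (a := 0) (b := x)
    (F := fun k t => (-1 : ℝ) ^ k * (Real.pi / 2 * t ^ 2) ^ (2 * k) / ((2 * k)! : ℝ))
    (f := fun t => Real.cos (Real.pi / 2 * t ^ 2))
    (fun k _ => (Real.pi / 2 * x ^ 2) ^ (2 * k) / ((2 * k)! : ℝ))
    (fun k => (by fun_prop : Continuous _).aestronglyMeasurable)
    (fun k => Eventually.of_forall fun t ht => ?_)
    (Eventually.of_forall fun t _ => summable_pow_div_two_mul_factorial _)
    intervalIntegrable_const
    (Eventually.of_forall fun t _ => Real.hasSum_cos _)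
  · have he : (fun k => PowerSeries.coeff k (fresnelU (-1)) * x ^ (4 * k + 1)) = fun k : ℕ =>
        ∫ t in (0 : ℝ)..x, (-1 : ℝ) ^ k * (Real.pi / 2 * t ^ 2) ^ (2 * k) / ((2 * k)! : ℝ) := by
      funext k
      have hf : ∀ t : ℝ, (-1 : ℝ) ^ k * (Real.pi / 2 * t ^ 2) ^ (2 * k) / ((2 * k)! : ℝ)
          = (-1) ^ k * (Real.pi / 2) ^ (2 * k) / ((2 * k)! : ℝ) * t ^ (4 * k) := fun t => by
        rw [mul_pow, ← pow_mul, show 2 * (2 * k) = 4 * k by ring]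
        ring
      simp only [hf]
      rw [intervalIntegral.integral_const_mul, integral_pow, fresnelU, PowerSeries.coeff_mk,
        zero_pow (by omega), sub_zero]
      push_cast
      field_simp
    rw [he]
    exact h
  · have h1 : t ^ 2 ≤ x ^ 2 := by
      rw [Set.mem_uIoc] at ht
      rcases ht with ht | ht <;> nlinarith
    rw [norm_div, norm_mul, norm_pow, norm_neg, norm_one, one_pow, one_mul, norm_pow,
      Real.norm_of_nonneg (by positivity), Real.norm_of_nonneg (by positivity)]
    gcongr

end Kindred

namespace Kindred

/-! ### Series reversion -/

theorem coeff_pow_eq_zero_of_lt {F : PowerSeries ℝ} (hF : PowerSeries.constantCoeff F = 0)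
    {N d : ℕ} (h : N < d) : PowerSeries.coeff N (F ^ d) = 0 :=
  PowerSeries.X_pow_dvd_iff.1 (pow_dvd_pow_of_dvd (PowerSeries.X_dvd_iff.2 hF) d) N h

theorem coeff_subst_eq_sum {F : PowerSeries ℝ} (hF : PowerSeries.constantCoeff F = 0)
    (A : PowerSeries ℝ) (N : ℕ) :
    PowerSeries.coeff N (PowerSeries.subst F A) =
      ∑ d ∈ range (N + 1), PowerSeries.coeff d A * PowerSeries.coeff N (F ^ d) := by
  rw [PowerSeries.coeff_subst' (PowerSeries.HasSubst.of_constantCoeff_zero' hF)]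
  refine finsum_eq_sum_of_support_subset _ fun d hd => ?_
  by_contra h
  refine hd ?_
  simp only [Finset.coe_range, Set.mem_Iio, not_lt] at h
  change PowerSeries.coeff d A • PowerSeries.coeff N (F ^ d) = 0
  rw [coeff_pow_eq_zero_of_lt hF (by omega), smul_zero]

/-- The relation between `U` and `V` that says that `∑ v_k x^(4k+1)` is the reversion of
`∑ u_k x^(4k+1)`. -/
def IsGapInverse (U V : PowerSeries ℝ) : Prop :=
  ∀ N, ∑ d ∈ range (N + 1), PowerSeries.coeff d V * PowerSeries.coeff (N - d) (U ^ (4 * d + 1))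
    = if N = 0 then 1 else 0

theorem constantCoeff_gapSeries (U : PowerSeries ℝ) :
    PowerSeries.constantCoeff (gapSeries U) = 0 := by
  rw [← PowerSeries.coeff_zero_eq_constantCoeff_apply, coeff_gapSeries_of_ne _ (by norm_num)]

theorem coeff_zero_pow_eq_one {U : PowerSeries ℝ} (hU : PowerSeries.coeff 0 U = 1) (d : ℕ) :
    PowerSeries.coeff 0 (U ^ d) = 1 := by
  rw [PowerSeries.coeff_zero_eq_constantCoeff_apply] at *
  rw [map_pow, hU, one_pow]

/-- The powers of $F=\sum u_kx^{4k+1}$ satisfy $F^d\in x^d\,\mathbb R[[x^4]]$, so the triangular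
system for the coefficients of $A$ splits into residue classes modulo 4, and only the class of 1 has
a nonzero right-hand side. -/
theorem coeff_eq_zero_of_subst_gapSeries {U A : PowerSeries ℝ} (hU : PowerSeries.coeff 0 U = 1)
    (h : PowerSeries.subst (gapSeries U) A = PowerSeries.X) {n : ℕ} (hn : n % 4 ≠ 1) :
    PowerSeries.coeff n A = 0 := by
  induction n using Nat.strong_induction_on with
  | _ n ih =>
    have h1 := coeff_subst_eq_sum (constantCoeff_gapSeries U) A n
    rw [h, PowerSeries.coeff_X, if_neg (by omega), Finset.sum_range_succ, Finset.sum_eq_zero,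
      zero_add, coeff_gapSeries_pow, if_pos ⟨le_rfl, by simp⟩, Nat.sub_self, Nat.zero_div,
      coeff_zero_pow_eq_one hU, mul_one] at h1
    · exact h1.symm
    · intro d hd
      have hd := Finset.mem_range.1 hd
      by_cases hdn : 4 ∣ n - d
      · rw [ih d hd (by omega), zero_mul]
      · rw [coeff_gapSeries_pow, if_neg fun hh => hdn hh.2, mul_zero]

theorem isGapInverse_of_subst {U A : PowerSeries ℝ}
    (h : PowerSeries.subst (gapSeries U) A = PowerSeries.X) :
    IsGapInverse U (PowerSeries.mk fun k => PowerSeries.coeff (4 * k + 1) A) := by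
  intro N
  have h1 := coeff_subst_eq_sum (constantCoeff_gapSeries U) A (4 * N + 1)
  rw [h, PowerSeries.coeff_X] at h1
  have h2 : (if 4 * N + 1 = 1 then (1 : ℝ) else 0) = if N = 0 then 1 else 0 := by simp
  rw [← h2, h1]
  refine Finset.sum_of_injOn (fun d => 4 * d + 1) (fun _ _ _ _ hh => by simpa using hh) ?_ ?_ ?_
  · intro d hd
    simp at hd ⊢
    omega
  · intro d hd hd'
    have hd := Finset.mem_range.1 hd
    rw [coeff_gapSeries_pow, if_neg, mul_zero]
    intro hh
    refine hd' ⟨d / 4, ?_, ?_⟩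
    · simp
      omega
    · simp only
      omega
  · intro d hd
    have hd := Finset.mem_range.1 hd
    rw [PowerSeries.coeff_mk, coeff_gapSeries_pow, if_pos (by omega)]
    congr 3
    omega

theorem IsGapInverse.eq {U V W : PowerSeries ℝ} (hU : PowerSeries.coeff 0 U = 1)
    (hV : IsGapInverse U V) (hW : IsGapInverse U W) : V = W := by
  ext n
  induction n using Nat.strong_induction_on with
  | _ n ih =>
    have h := (hV n).trans (hW n).symm
    rw [Finset.sum_range_succ, Finset.sum_range_succ, Nat.sub_self, coeff_zero_pow_eq_one hU,
      mul_one, mul_one, Finset.sum_congr rfl fun d hd => by rw [ih d (Finset.mem_range.1 hd)]] at h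
    exact add_left_cancel h

/-- The defining relation is homogeneous of degree $N$. For $r=-1$ it says that sign alternation
commutes with reversion; for $r=10/\pi^2$ it removes $\pi$ from the coefficients. -/
theorem IsGapInverse.rescale {U V : PowerSeries ℝ} (h : IsGapInverse U V) (r : ℝ) :
    IsGapInverse (PowerSeries.rescale r U) (PowerSeries.rescale r V) := by
  intro N
  have h1 : ∀ d ∈ range (N + 1), PowerSeries.coeff d (PowerSeries.rescale r V) *
      PowerSeries.coeff (N - d) (PowerSeries.rescale r U ^ (4 * d + 1))
      = r ^ N * (PowerSeries.coeff d V * PowerSeries.coeff (N - d) (U ^ (4 * d + 1))) := by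
    intro d hd
    have hd := Finset.mem_range.1 hd
    rw [← map_pow, PowerSeries.coeff_rescale, PowerSeries.coeff_rescale,
      show r ^ N = r ^ d * r ^ (N - d) by rw [← pow_add]; congr 1; omega]
    ring
  rw [Finset.sum_congr rfl h1, ← Finset.mul_sum, h N]
  rcases N with _ | N <;> simp

theorem existsUnique_isReversion {F : PowerSeries ℝ} (hF : PowerSeries.constantCoeff F = 0)
    (hF1 : IsUnit (PowerSeries.coeff 1 F)) :
    IsReversion F (reversion F) ∧ (∀ G, IsReversion F G → G = reversion F) ∧
      PowerSeries.subst F (reversion F) = PowerSeries.X := by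
  set S := F.substInvOfIsUnit hF1 with hS
  have h1 : IsReversion F S := ⟨F.constantCoeff_substInvOfIsUnit hF1,
    F.subst_substInvOfIsUnit_right hF hF1⟩
  have hleft : PowerSeries.subst F S = PowerSeries.X := F.subst_substInvOfIsUnit_left hF hF1
  have huniq : ∀ G, IsReversion F G → G = S := by
    intro G hG
    have hFs := PowerSeries.HasSubst.of_constantCoeff_zero' hF
    have hGs := PowerSeries.HasSubst.of_constantCoeff_zero' hG.1
    -- A right inverse equals the left inverse $S$, by associativity of substitution.
    have h2 := PowerSeries.subst_comp_subst_apply hFs hGs S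
    rw [hleft, hG.2, PowerSeries.X_subst, PowerSeries.subst_X hGs] at h2
    exact h2
  have hrev : IsReversion F (reversion F) := Classical.epsilon_spec ⟨S, h1⟩
  have heq := huniq _ hrev
  exact ⟨hrev, fun G hG => (huniq G hG).trans heq.symm, by rw [heq]; exact hleft⟩

end Kindred

namespace Kindred

open scoped Topology Polynomial.Bivariate

/-! ### Taylor series of a composition -/

theorem coeff_trunc_pow (F : PowerSeries ℝ) {N k : ℕ} (hk : k ≤ N) (d : ℕ) :
    ((PowerSeries.trunc (N + 1) F) ^ d).coeff k = PowerSeries.coeff k (F ^ d) := by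
  rw [← Polynomial.coeff_coe, Polynomial.coe_pow,
    ← PowerSeries.coeff_coe_trunc_of_lt (n := k) (m := N + 1) (by omega),
    PowerSeries.trunc_trunc_pow, PowerSeries.coeff_coe_trunc_of_lt (by omega)]

/-- An analytic identity $\varphi(h(x))=x$ passes to formal series: both sides are expanded in the
scale $\delta=x$ and the coefficients compared by `HasExp.coeff_eq`. -/
theorem subst_eq_X_of_hasFPowerSeriesAt {F A : PowerSeries ℝ}
    (hF : PowerSeries.constantCoeff F = 0) {h φ : ℝ → ℝ}
    (hh : HasFPowerSeriesAt h
      (FormalMultilinearSeries.ofScalars ℝ fun n => PowerSeries.coeff n F) 0)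
    (hφ : HasFPowerSeriesAt φ
      (FormalMultilinearSeries.ofScalars ℝ fun n => PowerSeries.coeff n A) 0)
    (hinv : ∀ᶠ x in 𝓝 0, φ (h x) = x) : PowerSeries.subst F A = PowerSeries.X := by
  ext n
  -- Order $n+1$ rather than $n$ ensures $N\ge1$, so that the expansion $x$ of the right-hand side
  -- is not truncated when $n=0$.
  obtain ⟨N, hN⟩ : ∃ N, N = n + 1 := ⟨_, rfl⟩
  have hl : 𝓝[≠] (0 : ℝ) ≤ 𝓝 0 := nhdsWithin_le_nhds
  have hδ : Tendsto (fun x : ℝ => x) (𝓝[≠] 0) (𝓝 0) := hl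
  have hS : IsScale (𝓝[≠] (0 : ℝ)) (fun _ => 0) (fun x => x) := isScale_zero hδ
  obtain ⟨t, ht⟩ : ∃ t, t = PowerSeries.trunc (N + 1) F := ⟨_, rfl⟩
  obtain ⟨B, hB⟩ : ∃ B : ℝ[X], B = ∑ d ∈ range (N + 1),
    Polynomial.C (PowerSeries.coeff d A) * t ^ d := ⟨_, rfl⟩
  have ht0 : t.coeff 0 = 0 := by
    rw [ht, PowerSeries.coeff_trunc, if_pos (by omega), PowerSeries.coeff_zero_eq_constantCoeff,
      hF]
  have h1 : HasExp (𝓝[≠] (0 : ℝ)) (fun _ => 0) (fun x => x) N h (t.map Polynomial.C) := by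
    have := ((isBigO_sub_sum_of_hasFPowerSeriesAt hh N).mono hl).trans_isLittleO
      ((isLittleO_pow_pow (𝕜 := ℝ) (Nat.lt_succ_self N)).mono hl)
    refine this.congr_left fun x => ?_
    rw [Polynomial.evalEval_map_C, ht, Polynomial.eval, PowerSeries.eval₂_trunc_eq_sum_range]
    simp
  have h2 := h1.comp hS (by simp [ht0]) le_rfl (isBigO_sub_sum_of_hasFPowerSeriesAt hφ N)
  have h3 : HasExp (𝓝[≠] (0 : ℝ)) (fun _ => 0) (fun x => x) N (fun x => x)
      ((∑ k ∈ range (N + 1), Polynomial.C (B.coeff k) * Polynomial.X ^ k).map Polynomial.C) := by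
    refine (h2.congr_fun (hinv.filter_mono hl)).congr hS fun k hk => ?_
    have : (∑ d ∈ range (N + 1), Polynomial.C (Polynomial.C (PowerSeries.coeff d A)) *
        t.map Polynomial.C ^ d : ℝ[X][Y]) = B.map Polynomial.C := by
      simp [hB, Polynomial.map_sum]
    rw [this, Polynomial.coeff_map, Polynomial.coeff_map, Polynomial.finsetSum_coeff]
    congr 1
    rw [Finset.sum_eq_single_of_mem k (by simp; omega)]
    · simp
    · intro j _ hj
      rw [Polynomial.coeff_C_mul, Polynomial.coeff_X_pow, if_neg hj.symm, mul_zero]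
  have h4 := HasExp.coeff_eq (N := N) (u := fun k => if k = 1 then 1 else 0)
    (v := B.coeff) hδ (eventually_mem_nhdsWithin) (h3.congr_left fun x => by
      have hx : ∑ k ∈ range (N + 1), (if k = 1 then (1 : ℝ) else 0) * x ^ k = x := by
        rw [Finset.sum_eq_single_of_mem 1 (by simp; omega)
          (fun j _ hj => by rw [if_neg hj, zero_mul]), if_pos rfl, one_mul, pow_one]
      rw [Polynomial.evalEval_map_C, Polynomial.eval_finsetSum, hx]
      simp) n (by omega)
  rw [coeff_subst_eq_sum hF, PowerSeries.coeff_X, h4, hB, Polynomial.finsetSum_coeff, hN,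
    Finset.sum_range_succ _ (n + 1), Polynomial.coeff_C_mul, ht,
    coeff_trunc_pow F (by omega), coeff_pow_eq_zero_of_lt hF (Nat.lt_succ_self n), mul_zero,
    add_zero]
  refine Finset.sum_congr rfl fun d _ => ?_
  rw [Polynomial.coeff_C_mul, coeff_trunc_pow F (by omega)]

/-! ### The function `g` -/

theorem coeff_zero_fresnelU (ε : ℝ) : PowerSeries.coeff 0 (fresnelU ε) = 1 := by
  simp [fresnelU]

theorem rescale_fresnelU : PowerSeries.rescale (-1) (fresnelU (-1)) = fresnelU 1 := by
  ext k
  rw [PowerSeries.coeff_rescale, fresnelU, fresnelU, PowerSeries.coeff_mk, PowerSeries.coeff_mk,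
    ← mul_assoc, ← mul_pow]
  norm_num

theorem fSeries_eq : fSeries = gapSeries (fresnelU (-1)) := by
  rw [fSeries, fresnelC_eq_seriesSum]
  exact taylorSeries_eq (hasFPowerSeriesOnBall_fresnelU (by norm_num)).hasFPowerSeriesAt

theorem isReversion_fSeries : IsReversion fSeries (reversion fSeries) ∧
    (∀ G, IsReversion fSeries G → G = reversion fSeries) ∧
      PowerSeries.subst fSeries (reversion fSeries) = PowerSeries.X := by
  refine existsUnique_isReversion ?_ ?_
  · rw [fSeries_eq, constantCoeff_gapSeries]
  · have := coeff_gapSeries (fresnelU (-1)) 0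
    rw [coeff_zero_fresnelU] at this
    rw [fSeries_eq, show 1 = 4 * 0 + 1 by norm_num, this]
    exact isUnit_one

/-- The coefficients of the reversion of the Fresnel cosine: those of `x^(4k+1)`. -/
noncomputable def reversionV : PowerSeries ℝ :=
  PowerSeries.mk fun k => PowerSeries.coeff (4 * k + 1) (reversion fSeries)

theorem coeff_reversion_eq_zero {n : ℕ} (hn : n % 4 ≠ 1) :
    PowerSeries.coeff n (reversion fSeries) = 0 := by
  have h := isReversion_fSeries.2.2
  rw [fSeries_eq] at h ⊢
  exact coeff_eq_zero_of_subst_gapSeries (coeff_zero_fresnelU _) h hn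

theorem reversion_eq : reversion fSeries = gapSeries reversionV :=
  eq_gapSeries fun _ hn => coeff_reversion_eq_zero hn

theorem isGapInverse_reversionV : IsGapInverse (fresnelU (-1)) reversionV := by
  have h := isReversion_fSeries.2.2
  rw [fSeries_eq] at h
  have := isGapInverse_of_subst h
  rwa [reversionV, fSeries_eq]

theorem gSeries_eq : gSeries = gapSeries (PowerSeries.rescale (-1) reversionV) := by
  rw [gSeries, reversion_eq]
  ext n
  rw [alternate, PowerSeries.coeff_mk]
  by_cases hn : n % 4 = 1
  · obtain ⟨k, rfl⟩ : ∃ k, n = 4 * k + 1 := ⟨n / 4, by omega⟩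
    rw [coeff_gapSeries, coeff_gapSeries, PowerSeries.coeff_rescale,
      show (4 * k + 1) / 4 = k by omega]
  · rw [coeff_gapSeries_of_ne _ hn, coeff_gapSeries_of_ne _ hn, mul_zero]

/-- The function `∫₀ˣ cosh (π t² / 2) dt`, the inverse of `g`. -/
noncomputable def fresnelCosh : ℝ → ℝ := seriesSum (gapSeries (fresnelU 1))

theorem hasFPowerSeriesOnBall_fresnelCosh : HasFPowerSeriesOnBall fresnelCosh
    (FormalMultilinearSeries.ofScalars ℝ fun n =>
      PowerSeries.coeff n (gapSeries (fresnelU 1))) 0 ⊤ :=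
  hasFPowerSeriesOnBall_fresnelU (by norm_num)

theorem hasSum_fresnelCosh (x : ℝ) :
    HasSum (fun k => PowerSeries.coeff k (fresnelU 1) * x ^ (4 * k + 1)) (fresnelCosh x) :=
  hasSum_seriesSum_fresnelU (by norm_num) x

theorem coeff_fresnelU_one_pos (k : ℕ) : 0 < PowerSeries.coeff k (fresnelU 1) := by
  rw [fresnelU, PowerSeries.coeff_mk]
  positivity

theorem lt_fresnelCosh {x : ℝ} (hx : 0 < x) : x < fresnelCosh x := by
  have h := sum_le_hasSum (range 2) (fun k _ =>
    mul_nonneg (coeff_fresnelU_one_pos k).le (pow_nonneg hx.le _)) (hasSum_fresnelCosh x)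
  rw [Finset.sum_range_succ, Finset.sum_range_one, coeff_zero_fresnelU] at h
  have := mul_pos (coeff_fresnelU_one_pos 1) (pow_pos hx (4 * 1 + 1))
  simp at h this
  linarith

theorem fresnelCosh_nonpos {x : ℝ} (hx : x ≤ 0) : fresnelCosh x ≤ 0 := by
  refine (hasSum_fresnelCosh x).nonpos fun k => ?_
  exact mul_nonpos_of_nonneg_of_nonpos (coeff_fresnelU_one_pos k).le
    (Odd.pow_nonpos ⟨2 * k, by ring⟩ hx)

theorem analyticAt_fresnelCosh (x : ℝ) : AnalyticAt ℝ fresnelCosh x :=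
  hasFPowerSeriesOnBall_fresnelCosh.analyticAt_of_mem (by simp)

theorem deriv_fresnelCosh_zero : deriv fresnelCosh 0 = 1 := by
  have := hasFPowerSeriesOnBall_fresnelCosh.hasFPowerSeriesAt.deriv
  rw [this]
  have h1 := coeff_gapSeries (fresnelU 1) 0
  rw [coeff_zero_fresnelU] at h1
  simpa using h1

theorem fresnelCosh_zero : fresnelCosh 0 = 0 := by
  have := hasSum_fresnelCosh 0
  simpa using this.unique (by simp)

/-- `g` is analytic at the origin, and a local inverse of `fresnelCosh`. -/
theorem exists_localInverse_gSeries : ∃ φ : ℝ → ℝ, HasFPowerSeriesAt φ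
      (FormalMultilinearSeries.ofScalars ℝ fun n => PowerSeries.coeff n gSeries) 0 ∧
    ∀ᶠ x in 𝓝 0, fresnelCosh (φ x) = x := by
  have ha := analyticAt_fresnelCosh 0
  have hd : deriv fresnelCosh 0 ≠ 0 := by rw [deriv_fresnelCosh_zero]; exact one_ne_zero
  have hr := ha.hasStrictDerivAt.eventually_right_inverse hd
  have hl := ha.hasStrictDerivAt.eventually_left_inverse hd
  have hφ := ha.analyticAt_localInverse hd
  rw [fresnelCosh_zero] at hr hφ
  refine ⟨_, ?_, hr⟩
  set φ := ha.hasStrictDerivAt.localInverse _ _ _ hd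
  have h1 := hφ.hasFPowerSeriesAt
  have hA : taylorSeries φ = gSeries := by
    have h2 := subst_eq_X_of_hasFPowerSeriesAt (A := taylorSeries φ) (constantCoeff_gapSeries _)
      hasFPowerSeriesOnBall_fresnelCosh.hasFPowerSeriesAt
      (by simpa only [taylorSeries, PowerSeries.coeff_mk] using h1) hl
    rw [eq_gapSeries fun n hn =>
      coeff_eq_zero_of_subst_gapSeries (coeff_zero_fresnelU _) h2 hn, gSeries_eq]
    congr 1
    -- Both series are gap inverses of `fresnelU 1`: one by the local inverse, the other by
    -- alternating the signs in the reversion of the Fresnel cosine.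
    have h3 := isGapInverse_reversionV.rescale (-1)
    rw [rescale_fresnelU] at h3
    exact (isGapInverse_of_subst h2).eq (coeff_zero_fresnelU _) h3
  rw [← hA]
  simpa only [taylorSeries, PowerSeries.coeff_mk] using h1

theorem radius_gSeries_pos : 0 < radius gSeries := by
  obtain ⟨φ, hφ, -⟩ := exists_localInverse_gSeries
  exact hφ.radius_pos

theorem hasFPowerSeriesOnBall_g : HasFPowerSeriesOnBall g
    (FormalMultilinearSeries.ofScalars ℝ fun n => PowerSeries.coeff n gSeries) 0
    (radius gSeries) :=
  hasFPowerSeriesOnBall_seriesSum radius_gSeries_pos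

/-- The identity theorem on the interval of convergence. As $h$ is analytic on all of $\mathbb R$,
the composition $h\circ g$ is analytic there without any knowledge of the range of $g$. -/
theorem fresnelCosh_g {x : ℝ} (hx : 0 ≤ x) (hx' : ENNReal.ofReal x < radius gSeries) :
    fresnelCosh (g x) = x := by
  obtain ⟨φ, hφ, hinv⟩ := exists_localInverse_gSeries
  have hg := hasFPowerSeriesOnBall_g
  have heq : g =ᶠ[𝓝 0] φ := by
    filter_upwards [hφ.eventually_hasSum_sub, hg.hasFPowerSeriesAt.eventually_hasSum_sub] with
      y h1 h2 using h2.unique h1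
  have h1 : AnalyticOnNhd ℝ (fun y => fresnelCosh (g y)) (Metric.eball 0 (radius gSeries)) :=
    fun y hy => (analyticAt_fresnelCosh _).comp (hg.analyticAt_of_mem hy)
  have h2 : AnalyticOnNhd ℝ (fun y : ℝ => y) (Metric.eball 0 (radius gSeries)) :=
    fun y _ => analyticAt_id
  have hconv : IsPreconnected (Metric.eball (0 : ℝ) (radius gSeries)) :=
    (convex_eball _ _).isPreconnected
  refine h1.eqOn_of_preconnected_of_eventuallyEq h2 hconv
    (Metric.mem_eball_self radius_gSeries_pos) ?_ ?_
  · filter_upwards [heq, hinv] with y hy1 hy2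
    rw [hy1, hy2]
  · rw [Metric.mem_eball, edist_zero_right, ← ofReal_norm, Real.norm_of_nonneg hx]
    exact hx'

theorem g_pos_lt {x : ℝ} (hx : 0 < x) (hx' : ENNReal.ofReal x < radius gSeries) :
    0 < g x ∧ g x < x := by
  have h := fresnelCosh_g hx.le hx'
  have hpos : 0 < g x := by
    by_contra hneg
    have := fresnelCosh_nonpos (not_lt.1 hneg)
    linarith
  exact ⟨hpos, by have := lt_fresnelCosh hpos; linarith⟩

end Kindred

namespace Kindred

open scoped Topology

/-! ### Iterates of the Fresnel cosine and of `g` -/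

theorem ratio_isLittleO_of_gapSeries {F : ℝ → ℝ} {U : PowerSeries ℝ}
    (hF : HasFPowerSeriesAt F
      (FormalMultilinearSeries.ofScalars ℝ fun n => PowerSeries.coeff n (gapSeries U)) 0)
    (hU : PowerSeries.coeff 0 U = 1) {x : ℕ → ℝ} (hx : ∀ n, 0 < x n)
    (hlim : Tendsto x atTop (𝓝 0)) (hrec : ∀ n, x (n + 1) = F (x n)) :
    (fun n => x (n + 1) / x n -
        (1 + ∑ m ∈ Icc 1 5, gapCoeff 4 (gapSeries U) m * x n ^ (4 * m)))
      =o[atTop] fun n => x n ^ 20 := by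
  -- Up to degree 24 only $x,x^5,\dots,x^{21}$ occur. The error $O(x^{25})=o(x^{21})$ becomes
  -- $o(x^{20})$ after division by $x$.
  have h1 := (isBigO_sub_sum_of_hasFPowerSeriesAt hF 24).comp_tendsto hlim
  have h2 : (fun n => x n ^ 25) =o[atTop] fun n => x n ^ 21 :=
    (isLittleO_pow_pow (𝕜 := ℝ) (show 21 < 25 by norm_num)).comp_tendsto hlim
  have h3 := h1.trans_isLittleO h2
  have h4 := (isBigO_refl (fun n => (x n)⁻¹) atTop).mul_isLittleO h3
  refine h4.congr (fun n => ?_) fun n => ?_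
  · have hn := (hx n).ne'
    have h0 : ∀ k, k % 4 ≠ 1 → PowerSeries.coeff k (gapSeries U) = 0 :=
      fun k hk => coeff_gapSeries_of_ne U hk
    have hc1 : PowerSeries.coeff 1 (gapSeries U) = 1 := by
      have := coeff_gapSeries U 0
      rwa [hU] at this
    have hI : ∑ m ∈ Icc 1 5, gapCoeff 4 (gapSeries U) m * x n ^ (4 * m) =
        ∑ m ∈ range 5, gapCoeff 4 (gapSeries U) (m + 1) * x n ^ (4 * (m + 1)) := by
      rw [Finset.range_eq_Ico, Finset.sum_Ico_add' (fun m =>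
        gapCoeff 4 (gapSeries U) m * x n ^ (4 * m))]
      rfl
    rw [hI]
    simp only [Function.comp_apply, gapCoeff, Finset.sum_range_succ, Finset.sum_range_zero, hc1]
    norm_num [h0]
    rw [hrec n]
    field_simp
    ring
  · have hn := (hx n).ne'
    field_simp

theorem tendsto_zero_of_decreasing {x : ℕ → ℝ} (hpos : ∀ n, 0 < x n)
    (hlt : ∀ n, x (n + 1) < x n) (h : ∀ L, 0 < L → ¬Tendsto x atTop (𝓝 L)) :
    Tendsto x atTop (𝓝 0) := by
  have hanti : Antitone x := antitone_nat_of_succ_le fun n => (hlt n).le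
  have hlim := tendsto_atTop_ciInf hanti ⟨0, by rintro _ ⟨n, rfl⟩; exact (hpos n).le⟩
  have hL : 0 ≤ ⨅ n, x n := le_ciInf fun n => (hpos n).le
  rcases hL.lt_or_eq with hL | hL
  · exact absurd hlim (h _ hL)
  · rwa [← hL] at hlim

/-! ### Bounds and iterates for the Fresnel cosine -/

theorem hasDerivAt_fresnelC (x : ℝ) :
    HasDerivAt fresnelC (Real.cos (Real.pi / 2 * x ^ 2)) x :=
  ((by fun_prop : Continuous fun t : ℝ => Real.cos (Real.pi / 2 * t ^ 2)).integral_hasStrictDerivAt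
    0 x).hasDerivAt

theorem continuous_fresnelC : Continuous fresnelC :=
  continuous_iff_continuousAt.2 fun x => (hasDerivAt_fresnelC x).continuousAt

theorem fresnelC_lt {x : ℝ} (hx : 0 < x) : fresnelC x < x := by
  have h : fresnelC x < ∫ _ in (0 : ℝ)..x, (1 : ℝ) := by
    refine intervalIntegral.integral_lt_integral_of_continuousOn_of_le_of_exists_lt hx
      (by fun_prop) (by fun_prop) (fun t _ => Real.cos_le_one _)
      ⟨min x 1, ⟨by positivity, min_le_left _ _⟩, ?_⟩
    have h0 : 0 < min x 1 := by positivity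
    have h1 : min x 1 ^ 2 ≤ 1 := pow_le_one₀ h0.le (min_le_right _ _)
    have h2 := Real.cos_lt_cos_of_nonneg_of_le_pi le_rfl
      (show Real.pi / 2 * min x 1 ^ 2 ≤ Real.pi by nlinarith [Real.pi_pos])
      (mul_pos (by positivity) (pow_pos h0 2))
    rwa [Real.cos_zero] at h2
  simpa using h

/-- From $\cos s\ge1-s^2/2$ one gets $f(1)\ge1-\pi^2/40>0.7>2/\pi$. -/
theorem two_div_pi_lt_fresnelC_one : 2 / Real.pi < fresnelC 1 := by
  have h1 : ∫ t in (0 : ℝ)..1, (1 - (Real.pi / 2 * t ^ 2) ^ 2 / 2) ≤ fresnelC 1 :=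
    intervalIntegral.integral_mono_on zero_le_one
      ((by fun_prop : Continuous _).intervalIntegrable _ _)
      ((by fun_prop : Continuous _).intervalIntegrable _ _)
      fun t _ => Real.one_sub_sq_div_two_le_cos
  have h2 : ∫ t in (0 : ℝ)..1, (1 - (Real.pi / 2 * t ^ 2) ^ 2 / 2) = 1 - Real.pi ^ 2 / 40 := by
    have : ∀ t : ℝ, 1 - (Real.pi / 2 * t ^ 2) ^ 2 / 2 = 1 - Real.pi ^ 2 / 8 * t ^ 4 :=
      fun t => by ring
    simp only [this]
    rw [intervalIntegral.integral_sub (by simp)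
      ((by fun_prop : Continuous _).intervalIntegrable _ _), intervalIntegral.integral_const_mul,
      integral_pow]
    norm_num
    ring
  have h3 := Real.pi_gt_d2
  have h4 := Real.pi_lt_d2
  have h5 : 2 / Real.pi < 7 / 10 := by
    rw [div_lt_iff₀ (by linarith)]
    linarith
  nlinarith

theorem fresnelC_pos {x : ℝ} (hx : 0 < x) : 0 < fresnelC x := by
  have hpi := Real.pi_pos
  rcases le_total x 1 with h1 | h1
  · refine intervalIntegral.intervalIntegral_pos_of_pos_on
      ((by fun_prop : Continuous _).intervalIntegrable _ _) (fun t ht => ?_) hx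
    have h2 : t ^ 2 < 1 := by
      have := ht.2.trans_le h1
      nlinarith [ht.1]
    exact Real.cos_pos_of_mem_Ioo ⟨by nlinarith [sq_nonneg t], by nlinarith⟩
  -- Integration by parts against $(\sin(\pi t^2/2)+1)/(\pi t)$: the added 1 makes both this
  -- function and the derivative of $K$ nonnegative, so $f(x)\ge K(x)\ge K(1)=f(1)-2/\pi>0$.
  · set K : ℝ → ℝ := fun t =>
      fresnelC t - (Real.sin (Real.pi / 2 * t ^ 2) + 1) / (Real.pi * t) with hK
    have hd : ∀ t, 0 < t →
        HasDerivAt K ((Real.sin (Real.pi / 2 * t ^ 2) + 1) / (Real.pi * t ^ 2)) t := by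
      intro t ht
      have h2 : HasDerivAt (fun t : ℝ => Real.pi / 2 * t ^ 2) (Real.pi * t) t := by
        have := (hasDerivAt_pow 2 t).const_mul (Real.pi / 2)
        refine this.congr_deriv ?_
        push_cast
        ring
      have h3 : HasDerivAt (fun t : ℝ => Real.pi * t) Real.pi t := by
        simpa using (hasDerivAt_id t).const_mul Real.pi
      refine ((hasDerivAt_fresnelC t).sub
        ((h2.sin.add_const 1).div h3 (by positivity))).congr_deriv ?_
      field_simp
      ring
    have hmono : MonotoneOn K (Set.Ici 1) := by
      refine monotoneOn_of_deriv_nonneg (convex_Ici 1)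
        (fun t ht => (hd t (zero_lt_one.trans_le ht)).continuousAt.continuousWithinAt)
        (fun t ht => ?_) fun t ht => ?_
      · rw [interior_Ici] at ht
        exact (hd t (zero_lt_one.trans ht)).differentiableAt.differentiableWithinAt
      · rw [interior_Ici] at ht
        rw [(hd t (zero_lt_one.trans ht)).deriv]
        exact div_nonneg (by linarith [Real.neg_one_le_sin (Real.pi / 2 * t ^ 2)]) (by positivity)
    have h4 := hmono (Set.mem_Ici.2 le_rfl) (Set.mem_Ici.2 h1) h1
    have h5 : K 1 = fresnelC 1 - 2 / Real.pi := by
      simp [hK]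
      norm_num
    have h6 : 0 ≤ (Real.sin (Real.pi / 2 * x ^ 2) + 1) / (Real.pi * x) :=
      div_nonneg (by linarith [Real.neg_one_le_sin (Real.pi / 2 * x ^ 2)]) (by positivity)
    have h7 := two_div_pi_lt_fresnelC_one
    rw [h5] at h4
    simp only [hK] at h4
    linarith

theorem iterate_fresnelC_pos {x₀ : ℝ} (h : 0 < x₀) (n : ℕ) : 0 < fresnelC^[n] x₀ := by
  induction n with
  | zero => exact h
  | succ n ih => rw [Function.iterate_succ_apply']; exact fresnelC_pos ih

theorem iterate_fresnelC_lt {x₀ : ℝ} (h : 0 < x₀) (n : ℕ) :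
    fresnelC^[n + 1] x₀ < fresnelC^[n] x₀ := by
  rw [Function.iterate_succ_apply']
  exact fresnelC_lt (iterate_fresnelC_pos h n)

theorem exists_expandsAs_fresnelC {x₀ : ℝ} (h : 0 < x₀)
    (ha : gapCoeff 4 fSeries 1 < 0) :
    ∃ C, ExpandsAs (fun n => fresnelC^[n] x₀) (formulaA 4 (gapCoeff 4 fSeries) 4 C) := by
  have hpos := iterate_fresnelC_pos h
  have hlim : Tendsto (fun n => fresnelC^[n] x₀) atTop (𝓝 0) := by
    refine tendsto_zero_of_decreasing hpos (iterate_fresnelC_lt h) fun L hL hlim => ?_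
    have h1 := (continuous_fresnelC.tendsto L).comp hlim
    have h2 := (tendsto_add_atTop_iff_nat 1).2 hlim
    refine (fresnelC_lt hL).ne (tendsto_nhds_unique h1 (h2.congr fun n => ?_))
    rw [Function.iterate_succ_apply', Function.comp_apply]
  refine exists_expandsAs_formulaA ha hpos hlim ?_
  rw [fSeries_eq]
  refine ratio_isLittleO_of_gapSeries (F := fresnelC) ?_ (coeff_zero_fresnelU _) hpos hlim
    fun n => Function.iterate_succ_apply' _ _ _
  rw [fresnelC_eq_seriesSum]
  exact (hasFPowerSeriesOnBall_fresnelU (by norm_num)).hasFPowerSeriesAt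

/-! ### Iterates of $g$ -/

theorem iterate_g_mem {x₀ : ℝ} (h : 0 < x₀) (h' : ENNReal.ofReal x₀ < radius gSeries) (n : ℕ) :
    0 < g^[n] x₀ ∧ ENNReal.ofReal (g^[n] x₀) < radius gSeries := by
  induction n with
  | zero => exact ⟨h, h'⟩
  | succ n ih =>
    rw [Function.iterate_succ_apply']
    have := g_pos_lt ih.1 ih.2
    exact ⟨this.1, (ENNReal.ofReal_le_ofReal this.2.le).trans_lt ih.2⟩

theorem iterate_g_lt {x₀ : ℝ} (h : 0 < x₀) (h' : ENNReal.ofReal x₀ < radius gSeries) (n : ℕ) :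
    g^[n + 1] x₀ < g^[n] x₀ := by
  rw [Function.iterate_succ_apply']
  exact (g_pos_lt (iterate_g_mem h h' n).1 (iterate_g_mem h h' n).2).2

theorem coeff_zero_reversionV : PowerSeries.coeff 0 reversionV = 1 := by
  have := isGapInverse_reversionV 0
  rwa [zero_add, Finset.sum_range_one, Nat.sub_self,
    coeff_zero_pow_eq_one (coeff_zero_fresnelU _), mul_one, if_pos rfl] at this

theorem exists_expandsAs_g {x₀ : ℝ} (h : 0 < x₀) (h' : ENNReal.ofReal x₀ < radius gSeries)
    (ha : gapCoeff 4 gSeries 1 < 0) :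
    ∃ C, ExpandsAs (fun n => g^[n] x₀) (formulaA 4 (gapCoeff 4 gSeries) 4 C) := by
  have hpos := fun n => (iterate_g_mem h h' n).1
  have hlim : Tendsto (fun n => g^[n] x₀) atTop (𝓝 0) := by
    refine tendsto_zero_of_decreasing hpos (iterate_g_lt h h') fun L hL hlim => ?_
    have h2 := (tendsto_add_atTop_iff_nat 1).2 hlim
    -- Passing to the limit in $h(x_{n+1})=x_n$ makes a positive limit $L$ a fixed point of $h$,
    -- against $h(L)>L$.
    have h1 := ((analyticAt_fresnelCosh L).continuousAt.tendsto).comp h2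
    refine (lt_fresnelCosh hL).ne' (tendsto_nhds_unique h1 (hlim.congr fun n => ?_))
    rw [Function.comp_apply, Function.iterate_succ_apply',
      fresnelCosh_g (hpos n).le (iterate_g_mem h h' n).2]
  refine exists_expandsAs_formulaA ha hpos hlim ?_
  have hg := hasFPowerSeriesOnBall_g.hasFPowerSeriesAt
  rw [gSeries_eq] at hg ⊢
  refine ratio_isLittleO_of_gapSeries hg ?_ hpos hlim fun n => Function.iterate_succ_apply' _ _ _
  rw [PowerSeries.coeff_rescale, coeff_zero_reversionV]
  norm_num

end Kindred

namespace Kindred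

/-! ### Explicit formulas for the coefficients of composed series -/

theorem pw_one {R : Type*} [CommRing R] (v : ℕ → R) (m : ℕ) : pw v 1 (m + 1) = v (m + 1) := by
  have : pw v 1 (m + 1) = ∑ i ∈ range (m + 1), v (i + 1) * if m + 1 - (i + 1) = 0 then 1 else 0 :=
    rfl
  rw [this, Finset.sum_eq_single_of_mem m (by simp)]
  · simp
  · intro i hi hne
    have := Finset.mem_range.1 hi
    rw [if_neg (by omega), mul_zero]

/-- The recursion without its vanishing terms. Together with `pw_one` it unfolds `compCoeff` at a
numeral into a polynomial in the $v_i$. -/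
theorem pw_succ_eq {R : Type*} [CommRing R] (v : ℕ → R) (d m : ℕ) :
    pw v (d + 2) m = ∑ i ∈ range (m - (d + 1)), v (i + 1) * pw v (d + 1) (m - (i + 1)) := by
  rw [pw]
  refine (Finset.sum_subset (Finset.range_subset_range.2 (Nat.sub_le m (d + 1))) fun i hi hi' =>
    ?_).symm
  rw [pw_eq_zero_of_lt v (d + 1) _ (by simp at hi hi'; omega), mul_zero]

theorem compCoeff_two {R : Type*} [CommRing R] (φ v : ℕ → R) :
    compCoeff φ v 2 = φ 1 * (v 2)
        + φ 2 * (v 1 ^ 2) := by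
  simp only [compCoeff, Finset.sum_range_succ, Finset.sum_range_zero, Nat.reduceSub, Nat.reduceAdd,
    zero_add, pw_one, pw_succ_eq]
  ring

theorem compCoeff_three {R : Type*} [CommRing R] (φ v : ℕ → R) :
    compCoeff φ v 3 = φ 1 * (v 3)
        + φ 2 * (2 * v 1 * v 2)
        + φ 3 * (v 1 ^ 3) := by
  simp only [compCoeff, Finset.sum_range_succ, Finset.sum_range_zero, Nat.reduceSub, Nat.reduceAdd,
    zero_add, pw_one, pw_succ_eq]
  ring

theorem compCoeff_four {R : Type*} [CommRing R] (φ v : ℕ → R) :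
    compCoeff φ v 4 = φ 1 * (v 4)
        + φ 2 * (2 * v 1 * v 3 + v 2 ^ 2)
        + φ 3 * (3 * v 1 ^ 2 * v 2)
        + φ 4 * (v 1 ^ 4) := by
  simp only [compCoeff, Finset.sum_range_succ, Finset.sum_range_zero, Nat.reduceSub, Nat.reduceAdd,
    zero_add, pw_one, pw_succ_eq]
  ring

theorem compCoeff_five {R : Type*} [CommRing R] (φ v : ℕ → R) :
    compCoeff φ v 5 = φ 1 * (v 5)
        + φ 2 * (2 * v 1 * v 4 + 2 * v 2 * v 3)
        + φ 3 * (3 * v 1 ^ 2 * v 3 + 3 * v 1 * v 2 ^ 2)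
        + φ 4 * (4 * v 1 ^ 3 * v 2)
        + φ 5 * (v 1 ^ 5) := by
  simp only [compCoeff, Finset.sum_range_succ, Finset.sum_range_zero, Nat.reduceSub, Nat.reduceAdd,
    zero_add, pw_one, pw_succ_eq]
  ring

theorem compCoeff_six {R : Type*} [CommRing R] (φ v : ℕ → R) :
    compCoeff φ v 6 = φ 1 * (v 6)
        + φ 2 * (2 * v 1 * v 5 + 2 * v 2 * v 4 + v 3 ^ 2)
        + φ 3 * (3 * v 1 ^ 2 * v 4 + 6 * v 1 * v 2 * v 3 + v 2 ^ 3)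
        + φ 4 * (4 * v 1 ^ 3 * v 3 + 6 * v 1 ^ 2 * v 2 ^ 2)
        + φ 5 * (5 * v 1 ^ 4 * v 2)
        + φ 6 * (v 1 ^ 6) := by
  simp only [compCoeff, Finset.sum_range_succ, Finset.sum_range_zero, Nat.reduceSub, Nat.reduceAdd,
    zero_add, pw_one, pw_succ_eq]
  ring

theorem compCoeff_seven {R : Type*} [CommRing R] (φ v : ℕ → R) :
    compCoeff φ v 7 = φ 1 * (v 7)
        + φ 2 * (2 * v 1 * v 6 + 2 * v 2 * v 5 + 2 * v 3 * v 4)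
        + φ 3 * (3 * v 1 ^ 2 * v 5 + 6 * v 1 * v 2 * v 4 + 3 * v 1 * v 3 ^ 2 + 3 * v 2 ^ 2 * v 3)
        + φ 4 * (4 * v 1 ^ 3 * v 4 + 12 * v 1 ^ 2 * v 2 * v 3 + 4 * v 1 * v 2 ^ 3)
        + φ 5 * (5 * v 1 ^ 4 * v 3 + 10 * v 1 ^ 3 * v 2 ^ 2)
        + φ 6 * (6 * v 1 ^ 5 * v 2)
        + φ 7 * (v 1 ^ 7) := by
  simp only [compCoeff, Finset.sum_range_succ, Finset.sum_range_zero, Nat.reduceSub, Nat.reduceAdd,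
    zero_add, pw_one, pw_succ_eq]
  ring

/-! ### Powers of a power series with constant term 1 -/

theorem coeff_pow_eq_pw_powerSeries {R : Type*} [CommRing R] (p : PowerSeries R)
    (hp : PowerSeries.coeff 0 p = 0) (d : ℕ) :
    ∀ m, PowerSeries.coeff m (p ^ d) = pw (fun i => PowerSeries.coeff i p) d m := by
  induction d with
  | zero => intro m; simp [pw, PowerSeries.coeff_one]
  | succ d ih =>
    intro m
    rw [pow_succ', PowerSeries.coeff_mul, Finset.Nat.sum_antidiagonal_eq_sum_range_succ_mk,
      Finset.sum_range_succ', hp, zero_mul, add_zero]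
    exact Finset.sum_congr rfl fun i _ => by rw [ih]

theorem coeff_pow_eq_compCoeff {U : PowerSeries ℝ} (hU : PowerSeries.coeff 0 U = 1) (e : ℕ)
    {m : ℕ} (hm : m ≠ 0) : PowerSeries.coeff m (U ^ e) =
      compCoeff (fun d => (e.choose d : ℝ)) (fun i => PowerSeries.coeff i U) m := by
  have h0 : PowerSeries.coeff 0 (U - 1) = 0 := by
    rw [map_sub, hU, PowerSeries.coeff_one, if_pos rfl, sub_self]
  have h1 : U ^ e = ∑ d ∈ range (e + 1), (U - 1) ^ d * (e.choose d : PowerSeries ℝ) := by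
    have := add_pow (U - 1) 1 e
    simpa using this
  have h2 : ∀ d, PowerSeries.coeff m ((U - 1) ^ d * (e.choose d : PowerSeries ℝ)) =
      (e.choose d : ℝ) * pw (fun i => PowerSeries.coeff i U) d m := by
    intro d
    rw [← map_natCast (PowerSeries.C (R := ℝ)), PowerSeries.coeff_mul_C, mul_comm,
      coeff_pow_eq_pw_powerSeries _ h0]
    congr 1
    refine pw_congr _ _ fun i hi _ => ?_
    rw [map_sub, PowerSeries.coeff_one, if_neg (by omega), sub_zero]
  rw [h1, map_sum, Finset.sum_congr rfl fun d _ => h2 d, compCoeff]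
  -- Both sums are extended to a common range: the binomial coefficients vanish for $d>e$, the
  -- coefficients of $x^m$ for $d>m$.
  have h3 : ∑ d ∈ range (e + 1), (e.choose d : ℝ) * pw (fun i => PowerSeries.coeff i U) d m =
      ∑ d ∈ range (e + m + 1), (e.choose d : ℝ) * pw (fun i => PowerSeries.coeff i U) d m :=
    Finset.sum_subset (Finset.range_subset_range.2 (by omega)) fun d _ hd => by
      rw [Nat.choose_eq_zero_of_lt (by simp at hd; omega), Nat.cast_zero, zero_mul]
  have h4 : ∑ d ∈ range (m + 1), (e.choose d : ℝ) * pw (fun i => PowerSeries.coeff i U) d m =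
      ∑ d ∈ range (e + m + 1), (e.choose d : ℝ) * pw (fun i => PowerSeries.coeff i U) d m :=
    Finset.sum_subset (Finset.range_subset_range.2 (by omega)) fun d _ hd => by
      rw [pw_eq_zero_of_lt _ _ _ (by simp at hd; omega), mul_zero]
  rw [h3, ← h4, Finset.sum_range_succ']
  simp [pw, hm]

/-! ### Values of the polynomials $T_m$ and $P_m$ at a real number -/

section Formulas

variable (τ : ℕ) (a : ℕ → ℝ) (X : ℝ)

@[simp] theorem eval_T_one : (T τ a 1).eval X = X := by
  rw [T, Polynomial.eval_X]

theorem eval_compCoeff_T (φ : ℕ → ℝ) (m : ℕ) :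
    (compCoeff (fun d => Polynomial.C (φ d)) (T τ a) m).eval X =
      compCoeff φ (fun i => (T τ a i).eval X) m := by
  rw [← Polynomial.coe_evalRingHom, map_compCoeff]
  simp

theorem eval_T_two : (T τ a 2).eval X = b τ a 1 * X - c τ a 1 := by
  rw [T_eq_compCoeff]
  simp only [zero_add, Polynomial.eval_sub, Polynomial.eval_mul,
    Polynomial.eval_C, Polynomial.eval_finsetSum, eval_compCoeff_T]
  rw [compCoeff_one]
  simp

theorem eval_T_three : (T τ a 3).eval X =
    b τ a 1 * ((T τ a 2).eval X - X ^ 2 / 2) - c τ a 2 + c τ a 1 * X := by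
  rw [T_eq_compCoeff]
  simp only [show Icc 1 1 = {1} by decide, Finset.sum_singleton, Nat.reduceAdd,
    Nat.reduceSub, Polynomial.eval_sub, Polynomial.eval_mul, Polynomial.eval_C, eval_compCoeff_T]
  rw [compCoeff_one, compCoeff_two, eval_T_one]
  norm_num [logCoeff, binom, fall]
  exact Or.inl (by ring)

theorem eval_T_four : (T τ a 4).eval X =
    b τ a 1 * ((T τ a 3).eval X - X * (T τ a 2).eval X + X ^ 3 / 3) - c τ a 3
      + c τ a 1 * ((T τ a 2).eval X - X ^ 2) + 2 * c τ a 2 * X := by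
  rw [T_eq_compCoeff]
  simp only [show Icc 1 2 = {1, 2} by decide, Nat.reduceAdd, Nat.reduceSub,
    Finset.sum_pair (show (1 : ℕ) ≠ 2 by decide), Polynomial.eval_sub, Polynomial.eval_add,
    Polynomial.eval_mul, Polynomial.eval_C, eval_compCoeff_T]
  rw [compCoeff_one, compCoeff_two, compCoeff_three, eval_T_one]
  norm_num [logCoeff, binom, fall, Finset.prod_range_succ, Nat.factorial]
  ring

theorem eval_P {m : ℕ} (hm : m + 2 ≤ 6) : (P τ a (m + 2)).eval X =
    compCoeff (binom (-(1 / (τ : ℝ)))) (fun i => (T τ a i).eval (-(τ : ℝ) * X)) (m + 2) := by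
  rw [P_eq_compCoeff τ a hm, ← Polynomial.coe_evalRingHom, map_compCoeff]
  simp

end Formulas

end Kindred

namespace Kindred

/-! ### The first coefficients of the two series -/

theorem coeff_rescale_fresnelU (m : ℕ) :
    PowerSeries.coeff m (PowerSeries.rescale (10 / Real.pi ^ 2) (fresnelU (-1))) =
      (-(5 / 2)) ^ m / ((2 * m).factorial * (4 * m + 1)) := by
  -- $-5/2$ is $\lambda=10/\pi^2$ times $-(\pi/2)^2$.
  have h : (-(5 / 2) : ℝ) ^ m = (10 / Real.pi ^ 2) ^ m * (-1) ^ m * ((Real.pi / 2) ^ 2) ^ m := by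
    rw [← mul_pow, ← mul_pow]
    congr 1
    have := Real.pi_ne_zero
    field_simp
    norm_num
  rw [PowerSeries.coeff_rescale, fresnelU, PowerSeries.coeff_mk, pow_mul, h]
  ring

/-- The reversion of the Fresnel cosine, rescaled so as to have rational coefficients. -/
noncomputable def rationalV : PowerSeries ℝ := PowerSeries.rescale (10 / Real.pi ^ 2) reversionV

/-- The gap inverse relation solved for its top term, a rational recursion for the reversion. It is
run up to $N=7$ because $b_6$ involves $a_7$. -/
theorem sum_coeff_rationalV {N : ℕ} (hN : N ≠ 0) :
    PowerSeries.coeff N rationalV + ∑ d ∈ range N, PowerSeries.coeff d rationalV *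
      compCoeff (fun e => ((4 * d + 1).choose e : ℝ))
        (fun m => (-(5 / 2)) ^ m / ((2 * m).factorial * (4 * m + 1))) (N - d) = 0 := by
  have h := isGapInverse_reversionV.rescale (10 / Real.pi ^ 2) N
  have h0 : PowerSeries.coeff 0 (PowerSeries.rescale (10 / Real.pi ^ 2) (fresnelU (-1))) = 1 := by
    rw [PowerSeries.coeff_rescale, pow_zero, one_mul, coeff_zero_fresnelU]
  rw [if_neg hN, Finset.sum_range_succ, Nat.sub_self, coeff_zero_pow_eq_one h0, mul_one,
    add_comm] at h
  rw [← h]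
  congr 1
  refine Finset.sum_congr rfl fun d hd => ?_
  rw [coeff_pow_eq_compCoeff h0 _ (by have := Finset.mem_range.1 hd; omega)]
  simp only [coeff_rescale_fresnelU]
  rfl

theorem coeff_zero_rationalV : PowerSeries.coeff 0 rationalV = 1 := by
  simp [rationalV, PowerSeries.coeff_rescale, -PowerSeries.coeff_zero_eq_constantCoeff,
    coeff_zero_reversionV]

theorem coeff_one_rationalV : PowerSeries.coeff 1 rationalV = 1 / 4 := by
  have h := sum_coeff_rationalV (N := 1) (by decide)
  simp only [Finset.sum_range_succ, Finset.sum_range_zero, Nat.reduceSub, compCoeff_one,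
    coeff_zero_rationalV] at h
  norm_num [Nat.choose, Nat.factorial] at h
  linarith

theorem coeff_two_rationalV : PowerSeries.coeff 2 rationalV = 245 / 864 := by
  have h := sum_coeff_rationalV (N := 2) (by decide)
  simp only [Finset.sum_range_succ, Finset.sum_range_zero, Nat.reduceSub, compCoeff_two,
    compCoeff_one,
    coeff_zero_rationalV, coeff_one_rationalV] at h
  norm_num [Nat.choose, Nat.factorial] at h
  linarith

theorem coeff_three_rationalV : PowerSeries.coeff 3 rationalV = 20095 / 44928 := by
  have h := sum_coeff_rationalV (N := 3) (by decide)
  simp only [Finset.sum_range_succ, Finset.sum_range_zero, Nat.reduceSub, compCoeff_three,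
    compCoeff_two, compCoeff_one,
    coeff_zero_rationalV, coeff_one_rationalV, coeff_two_rationalV] at h
  norm_num [Nat.choose, Nat.factorial] at h
  linarith

theorem coeff_four_rationalV : PowerSeries.coeff 4 rationalV = 210185785 / 256628736 := by
  have h := sum_coeff_rationalV (N := 4) (by decide)
  simp only [Finset.sum_range_succ, Finset.sum_range_zero, Nat.reduceSub, compCoeff_four,
    compCoeff_three, compCoeff_two, compCoeff_one,
    coeff_zero_rationalV, coeff_one_rationalV, coeff_two_rationalV, coeff_three_rationalV] at h
  norm_num [Nat.choose, Nat.factorial] at h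
  linarith

theorem coeff_five_rationalV : PowerSeries.coeff 5 rationalV = 105645970915 / 64670441472 := by
  have h := sum_coeff_rationalV (N := 5) (by decide)
  simp only [Finset.sum_range_succ, Finset.sum_range_zero, Nat.reduceSub, compCoeff_five,
    compCoeff_four, compCoeff_three, compCoeff_two, compCoeff_one,
    coeff_zero_rationalV, coeff_one_rationalV, coeff_two_rationalV, coeff_three_rationalV,
      coeff_four_rationalV] at h
  norm_num [Nat.choose, Nat.factorial] at h
  linarith

theorem coeff_six_rationalV : PowerSeries.coeff 6 rationalV = 58802270433223 / 17072996548608 := by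
  have h := sum_coeff_rationalV (N := 6) (by decide)
  simp only [Finset.sum_range_succ, Finset.sum_range_zero, Nat.reduceSub, compCoeff_six,
    compCoeff_five, compCoeff_four, compCoeff_three, compCoeff_two, compCoeff_one,
    coeff_zero_rationalV, coeff_one_rationalV, coeff_two_rationalV, coeff_three_rationalV,
      coeff_four_rationalV, coeff_five_rationalV] at h
  norm_num [Nat.choose, Nat.factorial] at h
  linarith

theorem coeff_seven_rationalV : PowerSeries.coeff 7 rationalV = 1749358002505355045 /
    231714709157707776 := by
  have h := sum_coeff_rationalV (N := 7) (by decide)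
  simp only [Finset.sum_range_succ, Finset.sum_range_zero, Nat.reduceSub, compCoeff_seven,
    compCoeff_six, compCoeff_five, compCoeff_four, compCoeff_three, compCoeff_two, compCoeff_one,
    coeff_zero_rationalV, coeff_one_rationalV, coeff_two_rationalV, coeff_three_rationalV,
      coeff_four_rationalV, coeff_five_rationalV, coeff_six_rationalV] at h
  norm_num [Nat.choose, Nat.factorial] at h
  linarith

theorem coeff_reversionV (m : ℕ) : PowerSeries.coeff m reversionV =
    PowerSeries.coeff m rationalV * (Real.pi ^ 2 / 10) ^ m := by
  have := Real.pi_ne_zero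
  rw [rationalV, PowerSeries.coeff_rescale, mul_right_comm, ← mul_pow,
    div_mul_div_cancel₀ (by positivity), div_self (by norm_num), one_pow, one_mul]

theorem gapCoeff_gapSeries (U : PowerSeries ℝ) (m : ℕ) :
    gapCoeff 4 (gapSeries U) m = PowerSeries.coeff m U := by
  rw [gapCoeff, mul_comm, coeff_gapSeries]

theorem gapCoeff_fSeries_one : gapCoeff 4 fSeries 1 = -(Real.pi ^ 2 / 40) := by
  rw [fSeries_eq, gapCoeff_gapSeries, fresnelU, PowerSeries.coeff_mk]
  norm_num
  ring

theorem gapCoeff_gSeries_one : gapCoeff 4 gSeries 1 = -(Real.pi ^ 2 / 40) := by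
  rw [gSeries_eq, gapCoeff_gapSeries, PowerSeries.coeff_rescale, coeff_reversionV,
    coeff_one_rationalV]
  ring

theorem lam_eq {a : ℕ → ℝ} (h : a 1 = -(Real.pi ^ 2 / 40)) : lam 4 a = 10 / Real.pi ^ 2 := by
  have := Real.pi_ne_zero
  rw [lam, h]
  field_simp
  norm_num

theorem lam_fSeries : lam 4 (gapCoeff 4 fSeries) = 10 / Real.pi ^ 2 := lam_eq gapCoeff_fSeries_one

theorem lam_gSeries : lam 4 (gapCoeff 4 gSeries) = 10 / Real.pi ^ 2 := lam_eq gapCoeff_gSeries_one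

theorem lam_pow_mul_fSeries (m : ℕ) : lam 4 (gapCoeff 4 fSeries) ^ m * gapCoeff 4 fSeries m =
    (-(5 / 2)) ^ m / ((2 * m).factorial * (4 * m + 1)) := by
  rw [lam_fSeries, fSeries_eq, gapCoeff_gapSeries, ← PowerSeries.coeff_rescale,
    coeff_rescale_fresnelU]

theorem lam_pow_mul_gSeries (m : ℕ) : lam 4 (gapCoeff 4 gSeries) ^ m * gapCoeff 4 gSeries m =
    (-1) ^ m * PowerSeries.coeff m rationalV := by
  rw [lam_gSeries, gSeries_eq, gapCoeff_gapSeries, rationalV, PowerSeries.coeff_rescale,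
    PowerSeries.coeff_rescale]
  ring

end Kindred

namespace Kindred

/-! ### The parameters of the algorithm for the two series -/

theorem b_gSeries :
    b 4 (gapCoeff 4 gSeries) 1 = -(55 / 108) ∧
      b 4 (gapCoeff 4 gSeries) 2 = 80 / 117 ∧
      b 4 (gapCoeff 4 gSeries) 3 = -(1613305 / 1388016) ∧
      b 4 (gapCoeff 4 gSeries) 4 = 343709 / 154791 ∧
      b 4 (gapCoeff 4 gSeries) 5 = -(181191932495 / 39810678336) ∧
      b 4 (gapCoeff 4 gSeries) 6 = 7036909925 / 719512794 := by
  refine ⟨?_, ?_, ?_, ?_, ?_, ?_⟩ <;>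
  · rw [b_eq_compCoeff _ _ (by norm_num)]
    simp only [lam_pow_mul_gSeries, Nat.reduceAdd, compCoeff_two, compCoeff_three, compCoeff_four,
      compCoeff_five,
    compCoeff_six, compCoeff_seven, coeff_one_rationalV, coeff_two_rationalV,
      coeff_three_rationalV, coeff_four_rationalV, coeff_five_rationalV, coeff_six_rationalV,
      coeff_seven_rationalV]
    norm_num [binom, fall, Finset.prod_range_succ, Nat.factorial]

theorem stepCoeff_gSeries :
    stepCoeff 4 (gapCoeff 4 gSeries) 1 = 1 ∧
      stepCoeff 4 (gapCoeff 4 gSeries) 2 = -(55 / 108) ∧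
      stepCoeff 4 (gapCoeff 4 gSeries) 3 = 80 / 117 ∧
      stepCoeff 4 (gapCoeff 4 gSeries) 4 = -(1613305 / 1388016) ∧
      stepCoeff 4 (gapCoeff 4 gSeries) 5 = 343709 / 154791 ∧
      stepCoeff 4 (gapCoeff 4 gSeries) 6 = -(181191932495 / 39810678336) := by
  obtain ⟨b1, b2, b3, b4, b5, -⟩ := b_gSeries
  simp [stepCoeff, b1, b2, b3, b4, b5]

theorem aa_zero_gSeries :
    aa 4 (gapCoeff 4 gSeries) 0 1 = 1 ∧
      aa 4 (gapCoeff 4 gSeries) 0 2 = -(109 / 108) ∧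
      aa 4 (gapCoeff 4 gSeries) 0 3 = 2143 / 1404 ∧
      aa 4 (gapCoeff 4 gSeries) 0 4 = -(98701909 / 36088416) ∧
      aa 4 (gapCoeff 4 gSeries) 0 5 = 3497783 / 649740 ∧
      aa 4 (gapCoeff 4 gSeries) 0 6 = -(65830792020265 / 5852169715392) := by
  obtain ⟨s1, s2, s3, s4, s5, s6⟩ := stepCoeff_gSeries
  refine ⟨?_, ?_, ?_, ?_, ?_, ?_⟩ <;>
  · rw [aa_zero_eq_compCoeff _ _ (by norm_num)]
    simp only [compCoeff_one, compCoeff_two, compCoeff_three, compCoeff_four, compCoeff_five,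
    compCoeff_six, s1, s2, s3, s4, s5, s6]
    norm_num [logCoeff]

/-- Intermediate values, needed for the $c_i$. -/
theorem aa_gSeries :
    aa 4 (gapCoeff 4 gSeries) 1 2 = -1 ∧
      aa 4 (gapCoeff 4 gSeries) 1 3 = 163 / 108 ∧
      aa 4 (gapCoeff 4 gSeries) 2 3 = -2 ∧
      aa 4 (gapCoeff 4 gSeries) 1 4 = -(1897 / 702) ∧
      aa 4 (gapCoeff 4 gSeries) 2 4 = 217 / 54 ∧
      aa 4 (gapCoeff 4 gSeries) 3 4 = -3 ∧
      aa 4 (gapCoeff 4 gSeries) 1 5 = 7995019 / 1503684 ∧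
      aa 4 (gapCoeff 4 gSeries) 2 5 = -(219 / 26) ∧
      aa 4 (gapCoeff 4 gSeries) 3 5 = 271 / 36 ∧
      aa 4 (gapCoeff 4 gSeries) 4 5 = -4 ∧
      aa 4 (gapCoeff 4 gSeries) 1 6 = -(1403028845 / 126309456) ∧
      aa 4 (gapCoeff 4 gSeries) 2 6 = 330503675 / 18044208 ∧
      aa 4 (gapCoeff 4 gSeries) 3 6 = -(2125 / 117) ∧
      aa 4 (gapCoeff 4 gSeries) 4 6 = 325 / 27 ∧
      aa 4 (gapCoeff 4 gSeries) 5 6 = -5 := by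
  obtain ⟨s1, s2, s3, s4, s5, -⟩ := stepCoeff_gSeries
  refine ⟨?_, ?_, ?_, ?_, ?_, ?_, ?_, ?_, ?_, ?_, ?_, ?_, ?_, ?_, ?_⟩ <;>
  · rw [aa_eq_compCoeff _ _ (by norm_num) (by norm_num)]
    simp only [Nat.reduceSub, compCoeff_one, compCoeff_two, compCoeff_three, compCoeff_four,
      compCoeff_five, s1, s2, s3, s4, s5]
    norm_num [binom, fall, Finset.prod_range_succ, Nat.factorial]

theorem c_zero_gSeries : c 4 (gapCoeff 4 gSeries) 0 = 55 / 108 := by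
  rw [c, b_gSeries.1, neg_neg]

theorem c_one_gSeries : c 4 (gapCoeff 4 gSeries) 1 = 25745 / 151632 := by
  obtain ⟨-, b2, -, -, -, -⟩ := b_gSeries
  obtain ⟨-, z2, -, -, -, -⟩ := aa_zero_gSeries
  have h := c_succ 4 (gapCoeff 4 gSeries) 0
  simp only [Finset.sum_range_succ, Finset.sum_range_zero, Nat.reduceAdd, b2, z2,
    c_zero_gSeries] at h
  rw [h]
  norm_num

theorem c_two_gSeries : c 4 (gapCoeff 4 gSeries) 2 = -(250903475 / 3897548928) := by
  obtain ⟨-, -, b3, -, -, -⟩ := b_gSeries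
  obtain ⟨-, -, z3, -, -, -⟩ := aa_zero_gSeries
  obtain ⟨-, a13, -, -, -, -, -, -, -, -, -, -, -, -, -⟩ := aa_gSeries
  have h := c_succ 4 (gapCoeff 4 gSeries) 1
  simp only [Finset.sum_range_succ, Finset.sum_range_zero, Nat.reduceAdd, b3, z3, a13,
    c_zero_gSeries, c_one_gSeries] at h
  rw [h]
  norm_num

theorem c_three_gSeries : c 4 (gapCoeff 4 gSeries) 3 = 124092693449 / 3379862723328 := by
  obtain ⟨-, -, -, b4, -, -⟩ := b_gSeries
  obtain ⟨-, -, -, z4, -, -⟩ := aa_zero_gSeries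
  obtain ⟨-, -, -, a14, a24, -, -, -, -, -, -, -, -, -, -⟩ := aa_gSeries
  have h := c_succ 4 (gapCoeff 4 gSeries) 2
  simp only [Finset.sum_range_succ, Finset.sum_range_zero, Nat.reduceAdd, b4, z4, a14, a24,
    c_zero_gSeries, c_one_gSeries, c_two_gSeries] at h
  rw [h]
  norm_num

theorem c_four_gSeries : c 4 (gapCoeff 4 gSeries) 4 = -(2012588028078415 / 91012943413776384) := by
  obtain ⟨-, -, -, -, b5, -⟩ := b_gSeries
  obtain ⟨-, -, -, -, z5, -⟩ := aa_zero_gSeries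
  obtain ⟨-, -, -, -, -, -, a15, a25, a35, -, -, -, -, -, -⟩ := aa_gSeries
  have h := c_succ 4 (gapCoeff 4 gSeries) 3
  simp only [Finset.sum_range_succ, Finset.sum_range_zero, Nat.reduceAdd, b5, z5, a15, a25, a35,
    c_zero_gSeries, c_one_gSeries, c_two_gSeries, c_three_gSeries] at h
  rw [h]
  norm_num

theorem c_five_gSeries : c 4 (gapCoeff 4 gSeries) 5 = 168154016370424766095 /
    15749152767150106816512 := by
  obtain ⟨-, -, -, -, -, b6⟩ := b_gSeries
  obtain ⟨-, -, -, -, -, z6⟩ := aa_zero_gSeries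
  obtain ⟨-, -, -, -, -, -, -, -, -, -, a16, a26, a36, a46, -⟩ := aa_gSeries
  have h := c_succ 4 (gapCoeff 4 gSeries) 4
  simp only [Finset.sum_range_succ, Finset.sum_range_zero, Nat.reduceAdd, b6, z6, a16, a26, a36,
    a46,
    c_zero_gSeries, c_one_gSeries, c_two_gSeries, c_three_gSeries, c_four_gSeries] at h
  rw [h]
  norm_num

theorem eval_T_two_gSeries (X : ℝ) : (T 4 (gapCoeff 4 gSeries) 2).eval X =
    -(55 / 108) * X - 25745 / 151632 := by
  rw [eval_T_two, b_gSeries.1, c_one_gSeries]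

theorem eval_T_three_gSeries (X : ℝ) : (T 4 (gapCoeff 4 gSeries) 3).eval X =
    55 / 216 * X ^ 2 + 1205 / 2808 * X + 587905525 / 3897548928 := by
  rw [eval_T_three, eval_T_two_gSeries, b_gSeries.1, c_one_gSeries, c_two_gSeries]
  ring

theorem eval_T_four_gSeries (X : ℝ) : (T 4 (gapCoeff 4 gSeries) 4).eval X =
    -(55 / 324) * X ^ 3 - 169465 / 303264 * X ^ 2 - 1013788675 / 1948774464 * X - 16359252550091 /
      114915332593152 := by
  rw [eval_T_four, eval_T_three_gSeries, eval_T_two_gSeries, b_gSeries.1, c_one_gSeries,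
    c_two_gSeries, c_three_gSeries]
  ring

theorem eval_P_two_gSeries (X : ℝ) : (P 4 (gapCoeff 4 gSeries) 2).eval X =
    5 / 2 * X ^ 2 - 55 / 108 * X + 25745 / 606528 := by
  refine (eval_P 4 _ X (show 0 + 2 ≤ 6 by norm_num)).trans ?_
  simp only [Nat.reduceAdd, compCoeff_two, eval_T_one, eval_T_two_gSeries]
  norm_num [binom, fall, Finset.prod_range_succ, Nat.factorial]
  ring

theorem eval_P_three_gSeries (X : ℝ) : (P 4 (gapCoeff 4 gSeries) 3).eval X =
    15 / 2 * X ^ 3 - 385 / 108 * X ^ 2 + 389005 / 606528 * X - 587905525 / 15590195712 := by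
  refine (eval_P 4 _ X (show 1 + 2 ≤ 6 by norm_num)).trans ?_
  simp only [Nat.reduceAdd, compCoeff_three, eval_T_one, eval_T_two_gSeries, eval_T_three_gSeries]
  norm_num [binom, fall, Finset.prod_range_succ, Nat.factorial]
  ring

theorem eval_P_four_gSeries (X : ℝ) : (P 4 (gapCoeff 4 gSeries) 4).eval X =
    195 / 8 * X ^ 4 - 12485 / 648 * X ^ 3 + 62045 / 10368 * X ^ 2 - 12734847275 / 15590195712 * X +
      73718758987739 / 1838645321490432 := by
  refine (eval_P 4 _ X (show 2 + 2 ≤ 6 by norm_num)).trans ?_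
  simp only [Nat.reduceAdd, compCoeff_four, eval_T_one, eval_T_two_gSeries, eval_T_three_gSeries,
    eval_T_four_gSeries]
  norm_num [binom, fall, Finset.prod_range_succ, Nat.factorial]
  ring

/-! ### The same parameters for the Fresnel cosine -/

theorem b_fSeries :
    b 4 (gapCoeff 4 fSeries) 1 = 55 / 108 ∧
      b 4 (gapCoeff 4 fSeries) 2 = 245 / 1404 ∧
      b 4 (gapCoeff 4 fSeries) 3 = 403315 / 9022104 ∧
      b 4 (gapCoeff 4 fSeries) 4 = 188719 / 21051576 ∧
      b 4 (gapCoeff 4 fSeries) 5 = 2770688381 / 1950723238464 ∧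
      b 4 (gapCoeff 4 fSeries) 6 = 1382689765 / 8081567702208 := by
  refine ⟨?_, ?_, ?_, ?_, ?_, ?_⟩ <;>
  · rw [b_eq_compCoeff _ _ (by norm_num)]
    simp only [lam_pow_mul_fSeries, Nat.reduceAdd, compCoeff_two, compCoeff_three, compCoeff_four,
      compCoeff_five,
    compCoeff_six, compCoeff_seven]
    norm_num [binom, fall, Finset.prod_range_succ, Nat.factorial]

theorem stepCoeff_fSeries :
    stepCoeff 4 (gapCoeff 4 fSeries) 1 = 1 ∧
      stepCoeff 4 (gapCoeff 4 fSeries) 2 = 55 / 108 ∧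
      stepCoeff 4 (gapCoeff 4 fSeries) 3 = 245 / 1404 ∧
      stepCoeff 4 (gapCoeff 4 fSeries) 4 = 403315 / 9022104 ∧
      stepCoeff 4 (gapCoeff 4 fSeries) 5 = 188719 / 21051576 ∧
      stepCoeff 4 (gapCoeff 4 fSeries) 6 = 2770688381 / 1950723238464 := by
  obtain ⟨b1, b2, b3, b4, b5, -⟩ := b_fSeries
  simp [stepCoeff, b1, b2, b3, b4, b5]

theorem aa_zero_fSeries :
    aa 4 (gapCoeff 4 fSeries) 0 1 = 1 ∧
      aa 4 (gapCoeff 4 fSeries) 0 2 = 1 / 108 ∧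
      aa 4 (gapCoeff 4 fSeries) 0 3 = -(1 / 702) ∧
      aa 4 (gapCoeff 4 fSeries) 0 4 = -(7639 / 36088416) ∧
      aa 4 (gapCoeff 4 fSeries) 0 5 = -(5587 / 315773640) ∧
      aa 4 (gapCoeff 4 fSeries) 0 6 = -(2445241 / 2926084857696) := by
  obtain ⟨s1, s2, s3, s4, s5, s6⟩ := stepCoeff_fSeries
  refine ⟨?_, ?_, ?_, ?_, ?_, ?_⟩ <;>
  · rw [aa_zero_eq_compCoeff _ _ (by norm_num)]
    simp only [compCoeff_one, compCoeff_two, compCoeff_three, compCoeff_four, compCoeff_five,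
    compCoeff_six, s1, s2, s3, s4, s5, s6]
    norm_num [logCoeff]

theorem aa_fSeries :
    aa 4 (gapCoeff 4 fSeries) 1 2 = -1 ∧
      aa 4 (gapCoeff 4 fSeries) 1 3 = 53 / 108 ∧
      aa 4 (gapCoeff 4 fSeries) 2 3 = -2 ∧
      aa 4 (gapCoeff 4 fSeries) 1 4 = -(73 / 468) ∧
      aa 4 (gapCoeff 4 fSeries) 2 4 = 107 / 54 ∧
      aa 4 (gapCoeff 4 fSeries) 3 4 = -3 ∧
      aa 4 (gapCoeff 4 fSeries) 1 5 = 215731 / 6014736 ∧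
      aa 4 (gapCoeff 4 fSeries) 2 5 = -(454 / 351) ∧
      aa 4 (gapCoeff 4 fSeries) 3 5 = 161 / 36 ∧
      aa 4 (gapCoeff 4 fSeries) 4 5 = -4 ∧
      aa 4 (gapCoeff 4 fSeries) 1 6 = -(266425 / 42103152) ∧
      aa 4 (gapCoeff 4 fSeries) 2 6 = 11269085 / 18044208 ∧
      aa 4 (gapCoeff 4 fSeries) 3 6 = -(2065 / 468) ∧
      aa 4 (gapCoeff 4 fSeries) 4 6 = 215 / 27 ∧
      aa 4 (gapCoeff 4 fSeries) 5 6 = -5 := by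
  obtain ⟨s1, s2, s3, s4, s5, -⟩ := stepCoeff_fSeries
  refine ⟨?_, ?_, ?_, ?_, ?_, ?_, ?_, ?_, ?_, ?_, ?_, ?_, ?_, ?_, ?_⟩ <;>
  · rw [aa_eq_compCoeff _ _ (by norm_num) (by norm_num)]
    simp only [Nat.reduceSub, compCoeff_one, compCoeff_two, compCoeff_three, compCoeff_four,
      compCoeff_five, s1, s2, s3, s4, s5]
    norm_num [binom, fall, Finset.prod_range_succ, Nat.factorial]

theorem c_zero_fSeries : c 4 (gapCoeff 4 fSeries) 0 = -(55 / 108) := by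
  rw [c, b_fSeries.1]

theorem c_one_fSeries : c 4 (gapCoeff 4 fSeries) 1 = 25745 / 151632 := by
  obtain ⟨-, b2, -, -, -, -⟩ := b_fSeries
  obtain ⟨-, z2, -, -, -, -⟩ := aa_zero_fSeries
  have h := c_succ 4 (gapCoeff 4 fSeries) 0
  simp only [Finset.sum_range_succ, Finset.sum_range_zero, Nat.reduceAdd, b2, z2,
    c_zero_fSeries] at h
  rw [h]
  norm_num

theorem c_two_fSeries : c 4 (gapCoeff 4 fSeries) 2 = 250903475 / 3897548928 := by
  obtain ⟨-, -, b3, -, -, -⟩ := b_fSeries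
  obtain ⟨-, -, z3, -, -, -⟩ := aa_zero_fSeries
  obtain ⟨-, a13, -, -, -, -, -, -, -, -, -, -, -, -, -⟩ := aa_fSeries
  have h := c_succ 4 (gapCoeff 4 fSeries) 1
  simp only [Finset.sum_range_succ, Finset.sum_range_zero, Nat.reduceAdd, b3, z3, a13,
    c_zero_fSeries, c_one_fSeries] at h
  rw [h]
  norm_num

theorem c_three_fSeries : c 4 (gapCoeff 4 fSeries) 3 = 124092693449 / 3379862723328 := by
  obtain ⟨-, -, -, b4, -, -⟩ := b_fSeries
  obtain ⟨-, -, -, z4, -, -⟩ := aa_zero_fSeries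
  obtain ⟨-, -, -, a14, a24, -, -, -, -, -, -, -, -, -, -⟩ := aa_fSeries
  have h := c_succ 4 (gapCoeff 4 fSeries) 2
  simp only [Finset.sum_range_succ, Finset.sum_range_zero, Nat.reduceAdd, b4, z4, a14, a24,
    c_zero_fSeries, c_one_fSeries, c_two_fSeries] at h
  rw [h]
  norm_num

theorem c_four_fSeries : c 4 (gapCoeff 4 fSeries) 4 = 2012588028078415 / 91012943413776384 := by
  obtain ⟨-, -, -, -, b5, -⟩ := b_fSeries
  obtain ⟨-, -, -, -, z5, -⟩ := aa_zero_fSeries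
  obtain ⟨-, -, -, -, -, -, a15, a25, a35, -, -, -, -, -, -⟩ := aa_fSeries
  have h := c_succ 4 (gapCoeff 4 fSeries) 3
  simp only [Finset.sum_range_succ, Finset.sum_range_zero, Nat.reduceAdd, b5, z5, a15, a25, a35,
    c_zero_fSeries, c_one_fSeries, c_two_fSeries, c_three_fSeries] at h
  rw [h]
  norm_num

theorem c_five_fSeries : c 4 (gapCoeff 4 fSeries) 5 = 168154016370424766095 /
    15749152767150106816512 := by
  obtain ⟨-, -, -, -, -, b6⟩ := b_fSeries
  obtain ⟨-, -, -, -, -, z6⟩ := aa_zero_fSeries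
  obtain ⟨-, -, -, -, -, -, -, -, -, -, a16, a26, a36, a46, -⟩ := aa_fSeries
  have h := c_succ 4 (gapCoeff 4 fSeries) 4
  simp only [Finset.sum_range_succ, Finset.sum_range_zero, Nat.reduceAdd, b6, z6, a16, a26, a36,
    a46,
    c_zero_fSeries, c_one_fSeries, c_two_fSeries, c_three_fSeries, c_four_fSeries] at h
  rw [h]
  norm_num

theorem eval_T_two_fSeries (X : ℝ) : (T 4 (gapCoeff 4 fSeries) 2).eval X =
    55 / 108 * X - 25745 / 151632 := by
  rw [eval_T_two, b_fSeries.1, c_one_fSeries]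

theorem eval_T_three_fSeries (X : ℝ) : (T 4 (gapCoeff 4 fSeries) 3).eval X =
    -(55 / 216) * X ^ 2 + 1205 / 2808 * X - 587905525 / 3897548928 := by
  rw [eval_T_three, eval_T_two_fSeries, b_fSeries.1, c_one_fSeries, c_two_fSeries]
  ring

theorem eval_T_four_fSeries (X : ℝ) : (T 4 (gapCoeff 4 fSeries) 4).eval X =
    55 / 324 * X ^ 3 - 169465 / 303264 * X ^ 2 + 1013788675 / 1948774464 * X - 16359252550091 /
      114915332593152 := by
  rw [eval_T_four, eval_T_three_fSeries, eval_T_two_fSeries, b_fSeries.1, c_one_fSeries,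
    c_two_fSeries, c_three_fSeries]
  ring

theorem eval_P_two_fSeries (X : ℝ) : (P 4 (gapCoeff 4 fSeries) 2).eval X =
    5 / 2 * X ^ 2 + 55 / 108 * X + 25745 / 606528 := by
  refine (eval_P 4 _ X (show 0 + 2 ≤ 6 by norm_num)).trans ?_
  simp only [Nat.reduceAdd, compCoeff_two, eval_T_one, eval_T_two_fSeries]
  norm_num [binom, fall, Finset.prod_range_succ, Nat.factorial]
  ring

theorem eval_P_three_fSeries (X : ℝ) : (P 4 (gapCoeff 4 fSeries) 3).eval X =
    15 / 2 * X ^ 3 + 385 / 108 * X ^ 2 + 389005 / 606528 * X + 587905525 / 15590195712 := by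
  refine (eval_P 4 _ X (show 1 + 2 ≤ 6 by norm_num)).trans ?_
  simp only [Nat.reduceAdd, compCoeff_three, eval_T_one, eval_T_two_fSeries, eval_T_three_fSeries]
  norm_num [binom, fall, Finset.prod_range_succ, Nat.factorial]
  ring

theorem eval_P_four_fSeries (X : ℝ) : (P 4 (gapCoeff 4 fSeries) 4).eval X =
    195 / 8 * X ^ 4 + 12485 / 648 * X ^ 3 + 62045 / 10368 * X ^ 2 + 12734847275 / 15590195712 * X +
      73718758987739 / 1838645321490432 := by
  refine (eval_P 4 _ X (show 2 + 2 ≤ 6 by norm_num)).trans ?_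
  simp only [Nat.reduceAdd, compCoeff_four, eval_T_one, eval_T_two_fSeries, eval_T_three_fSeries,
    eval_T_four_fSeries]
  norm_num [binom, fall, Finset.prod_range_succ, Nat.factorial]
  ring

end Kindred

namespace Kindred

/-! ### The explicit expansions -/

theorem kappa_pos : 0 < kappa := by
  rw [kappa]
  have := Real.pi_pos
  positivity

theorem rpow_eq_two_mul_sqrt_kappa : (10 / Real.pi ^ 2) ^ (1 / ((4 : ℕ) : ℝ)) = 2 * √kappa := by
  -- $16\kappa^2=16\cdot\frac58\cdot\pi^{-2}$; this is why the expansions are normalised by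
  -- $\sqrt\kappa$ and start with 2.
  have h : 10 / Real.pi ^ 2 = (2 * √kappa) ^ 4 := by
    have h1 : √kappa ^ 4 = kappa ^ 2 := by
      rw [show 4 = 2 * 2 by norm_num, pow_mul, Real.sq_sqrt kappa_pos.le]
    rw [mul_pow, h1, kappa, div_pow, Real.sq_sqrt (by norm_num)]
    ring
  rw [h, one_div, Real.pow_rpow_inv_natCast (by positivity) (by norm_num)]

theorem ExpandsAs.div_of_eq {x E F : ℕ → ℝ} (h : ExpandsAs x E) (s : ℝ)
    (hF : ∀ n : ℕ, 0 < n → E n / s = F n) : ExpandsAs (fun n => x n / s) F := by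
  refine (h.const_mul_left s⁻¹).congr' ?_ EventuallyEq.rfl
  filter_upwards [eventually_gt_atTop 0] with n hn
  rw [← hF n hn]
  ring

theorem formulaA_div_sqrt_kappa {a : ℕ → ℝ} (h : lam 4 a = 10 / Real.pi ^ 2) (C : ℝ) (n : ℕ) :
    formulaA 4 a 4 C n / √kappa = 2 * ((n : ℝ) ^ (1 / 4 : ℝ))⁻¹ *
      (1 + ∑ m ∈ Icc 1 4,
        (P 4 a m).eval (-(1 / 4) * (b 4 a 1 * Real.log n + C)) / (n : ℝ) ^ m) := by
  have h1 : √kappa ≠ 0 := (Real.sqrt_pos.2 kappa_pos).ne'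
  rw [formulaA, h, Real.div_rpow (by positivity) (by positivity), rpow_eq_two_mul_sqrt_kappa]
  push_cast
  field_simp

theorem expansion_eq (K : ℕ → ℕ → ℝ → ℝ) (C : ℝ) {n : ℕ} (hn : 0 < n) :
    expansion K C n = ((n : ℝ) ^ (1 / 4 : ℝ))⁻¹ *
      ∑ m ∈ range 5, (∑ j ∈ range (m + 1), K m j C * Real.log n ^ j) * ((n : ℝ)⁻¹) ^ m := by
  have hn' : (0 : ℝ) < n := Nat.cast_pos.2 hn
  rw [expansion, Finset.mul_sum]
  refine Finset.sum_congr rfl fun m _ => ?_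
  rw [Finset.sum_mul, Finset.mul_sum]
  refine Finset.sum_congr rfl fun j _ => ?_
  rw [Real.rpow_add hn', Real.rpow_natCast, inv_pow]
  ring

theorem sum_Icc_one_four (f : ℕ → ℝ) : ∑ m ∈ Icc 1 4, f m = f 1 + f 2 + f 3 + f 4 := by
  simp [Finset.sum_Icc_succ_top]

theorem eval_P_one (τ : ℕ) (a : ℕ → ℝ) (X : ℝ) : (P τ a 1).eval X = X := by
  rw [P, Polynomial.eval_X]

theorem formulaA_gSeries_div (C : ℝ) {n : ℕ} (hn : 0 < n) :
    formulaA 4 (gapCoeff 4 gSeries) 4 C n / √kappa = expansion gTerm C n := by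
  rw [formulaA_div_sqrt_kappa lam_gSeries, expansion_eq _ _ hn, sum_Icc_one_four, eval_P_one,
    eval_P_two_gSeries, eval_P_three_gSeries, eval_P_four_gSeries, b_gSeries.1]
  simp only [Finset.sum_range_succ, Finset.sum_range_zero, gTerm]
  ring

theorem formulaA_fSeries_div (C : ℝ) {n : ℕ} (hn : 0 < n) :
    formulaA 4 (gapCoeff 4 fSeries) 4 (-C) n / √kappa = expansion fTerm C n := by
  rw [formulaA_div_sqrt_kappa lam_fSeries, expansion_eq _ _ hn, sum_Icc_one_four, eval_P_one,
    eval_P_two_fSeries, eval_P_three_fSeries, eval_P_four_fSeries, b_fSeries.1]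
  simp only [Finset.sum_range_succ, Finset.sum_range_zero, fTerm]
  ring

/-! ### Kindredness -/

theorem gTerm_eq (m : ℕ) (hm : m ≤ 4) (j : ℕ) (hj : j ≤ m) (C : ℝ) :
    gTerm m j C = (-1) ^ m * fTerm m j C := by
  interval_cases m <;> interval_cases j <;> simp only [gTerm, fTerm] <;> ring

theorem c_gSeries_eq (i : ℕ) (h1 : 1 ≤ i) (h5 : i ≤ 5) :
    c 4 (gapCoeff 4 gSeries) i = (-1) ^ (i + 1) * c 4 (gapCoeff 4 fSeries) i := by
  interval_cases i
  · rw [c_one_gSeries, c_one_fSeries]; norm_num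
  · rw [c_two_gSeries, c_two_fSeries]; norm_num
  · rw [c_three_gSeries, c_three_fSeries]; norm_num
  · rw [c_four_gSeries, c_four_fSeries]; norm_num
  · rw [c_five_gSeries, c_five_fSeries]; norm_num

theorem eval_T_gSeries_eq (m : ℕ) (h1 : 1 ≤ m) (h4 : m ≤ 4) (X : ℝ) :
    (T 4 (gapCoeff 4 gSeries) m).eval X =
      (-1) ^ m * (T 4 (gapCoeff 4 fSeries) m).eval (-X) := by
  interval_cases m
  · rw [eval_T_one, eval_T_one]; ring
  · rw [eval_T_two_gSeries, eval_T_two_fSeries]; ring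
  · rw [eval_T_three_gSeries, eval_T_three_fSeries]; ring
  · rw [eval_T_four_gSeries, eval_T_four_fSeries]; ring

theorem eval_P_gSeries_eq (m : ℕ) (h4 : m ≤ 4) (X : ℝ) :
    (P 4 (gapCoeff 4 gSeries) m).eval X =
      (-1) ^ m * (P 4 (gapCoeff 4 fSeries) m).eval (-X) := by
  interval_cases m
  · simp [P]
  · rw [eval_P_one, eval_P_one]; ring
  · rw [eval_P_two_gSeries, eval_P_two_fSeries]; ring
  · rw [eval_P_three_gSeries, eval_P_three_fSeries]; ring
  · rw [eval_P_four_gSeries, eval_P_four_fSeries]; ring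

theorem coeff_reversion (m : ℕ) : PowerSeries.coeff (4 * m + 1) (reversion fSeries) =
    PowerSeries.coeff m rationalV * (Real.pi ^ 2 / 10) ^ m := by
  rw [reversion_eq, coeff_gapSeries, coeff_reversionV]

theorem gapCoeff_one_neg {a : ℕ → ℝ} (h : a 1 = -(Real.pi ^ 2 / 40)) : a 1 < 0 := by
  have := Real.pi_pos
  rw [h, neg_lt_zero]
  positivity

end Kindred


theorem mainTheorem10 :
    -- the Taylor series of the Fresnel cosine has exactly one series reversion
    (Kindred.IsReversion Kindred.fSeries (Kindred.reversion Kindred.fSeries) ∧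
      ∀ G : PowerSeries ℝ, Kindred.IsReversion Kindred.fSeries G →
        G = Kindred.reversion Kindred.fSeries) ∧
    -- its shape and first coefficients
    ((∀ n : ℕ, n % 4 ≠ 1 → PowerSeries.coeff n (Kindred.reversion Kindred.fSeries) = 0) ∧
      PowerSeries.coeff 1 (Kindred.reversion Kindred.fSeries) = 1 ∧
      PowerSeries.coeff 5 (Kindred.reversion Kindred.fSeries) = Real.pi ^ 2 / 40 ∧
      PowerSeries.coeff 9 (Kindred.reversion Kindred.fSeries) = 49 * Real.pi ^ 4 / 17280 ∧
      PowerSeries.coeff 13 (Kindred.reversion Kindred.fSeries) =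
        4019 * Real.pi ^ 6 / 8985600 ∧
      PowerSeries.coeff 17 (Kindred.reversion Kindred.fSeries) =
        42037157 * Real.pi ^ 8 / 513257472000 ∧
      PowerSeries.coeff 21 (Kindred.reversion Kindred.fSeries) =
        21129194183 * Real.pi ^ 10 / 1293408829440000) ∧
    -- the series defining `g` converges near the origin
    0 < Kindred.radius Kindred.gSeries ∧
    -- for every choice of names for the coefficient sequences of `g` and of the Fresnel cosine
    ∀ ag af : ℕ → ℝ, ag = Kindred.gapCoeff 4 Kindred.gSeries →
      af = Kindred.gapCoeff 4 Kindred.fSeries →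
    -- the parameters of the algorithm for `g`
    Kindred.lam 4 ag = 10 / Real.pi ^ 2 ∧
    (Kindred.b 4 ag 1 = -(55 / 108) ∧ Kindred.b 4 ag 2 = 80 / 117 ∧
      Kindred.b 4 ag 3 = -(1613305 / 1388016) ∧ Kindred.b 4 ag 4 = 343709 / 154791 ∧
      Kindred.b 4 ag 5 = -(181191932495 / 39810678336) ∧
      Kindred.b 4 ag 6 = 7036909925 / 719512794) ∧
    (Kindred.aa 4 ag 0 1 = 1 ∧ Kindred.aa 4 ag 0 2 = -(109 / 108) ∧
      Kindred.aa 4 ag 0 3 = 2143 / 1404 ∧ Kindred.aa 4 ag 0 4 = -(98701909 / 36088416) ∧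
      Kindred.aa 4 ag 0 5 = 3497783 / 649740 ∧
      Kindred.aa 4 ag 0 6 = -(65830792020265 / 5852169715392)) ∧
    (Kindred.c 4 ag 1 = 25745 / 151632 ∧ Kindred.c 4 ag 2 = -(250903475 / 3897548928) ∧
      Kindred.c 4 ag 3 = 124092693449 / 3379862723328 ∧
      Kindred.c 4 ag 4 = -(2012588028078415 / 91012943413776384) ∧
      Kindred.c 4 ag 5 = 168154016370424766095 / 15749152767150106816512) ∧
    (∀ X : ℝ, (Kindred.T 4 ag 2).eval X = -(55 / 108) * X - 25745 / 151632 ∧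
      (Kindred.T 4 ag 3).eval X =
        55 / 216 * X ^ 2 + 1205 / 2808 * X + 587905525 / 3897548928 ∧
      (Kindred.T 4 ag 4).eval X =
        -(55 / 324) * X ^ 3 - 169465 / 303264 * X ^ 2 - 1013788675 / 1948774464 * X
          - 16359252550091 / 114915332593152) ∧
    (∀ X : ℝ, (Kindred.P 4 ag 2).eval X = 5 / 2 * X ^ 2 - 55 / 108 * X + 25745 / 606528 ∧
      (Kindred.P 4 ag 3).eval X =
        15 / 2 * X ^ 3 - 385 / 108 * X ^ 2 + 389005 / 606528 * X
          - 587905525 / 15590195712 ∧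
      (Kindred.P 4 ag 4).eval X =
        195 / 8 * X ^ 4 - 12485 / 648 * X ^ 3 + 62045 / 10368 * X ^ 2
          - 12734847275 / 15590195712 * X + 73718758987739 / 1838645321490432) ∧
    -- iterates of `g`: formula (A) and the explicit expansion, with the same constant
    (∀ x₀ : ℝ, 0 < x₀ → ENNReal.ofReal x₀ < Kindred.radius Kindred.gSeries →
      (∀ n : ℕ, 0 < Kindred.g^[n + 1] x₀ ∧ Kindred.g^[n + 1] x₀ < Kindred.g^[n] x₀) ∧
      ∃ C : ℝ,
        Kindred.ExpandsAs (fun n => Kindred.g^[n] x₀) (Kindred.formulaA 4 ag 4 C) ∧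
        Kindred.ExpandsAs (fun n => Kindred.g^[n] x₀ / √Kindred.kappa)
          (Kindred.expansion Kindred.gTerm C)) ∧
    -- iterates of the Fresnel cosine: formula (B) and the explicit expansion
    (∀ x₀ : ℝ, 0 < x₀ →
      (∀ n : ℕ, 0 < Kindred.fresnelC^[n + 1] x₀ ∧
        Kindred.fresnelC^[n + 1] x₀ < Kindred.fresnelC^[n] x₀) ∧
      ∃ C : ℝ,
        Kindred.ExpandsAs (fun n => Kindred.fresnelC^[n] x₀) (Kindred.formulaA 4 af 4 (-C)) ∧
        Kindred.ExpandsAs (fun n => Kindred.fresnelC^[n] x₀ / √Kindred.kappa)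
          (Kindred.expansion Kindred.fTerm C)) ∧
    -- the two functions are kindred: all corresponding coefficients agree up to sign
    (∀ m ≤ 4, ∀ j ≤ m, ∀ C : ℝ, Kindred.gTerm m j C = (-1) ^ m * Kindred.fTerm m j C) ∧
    (Kindred.lam 4 af = Kindred.lam 4 ag ∧ Kindred.b 4 af 1 = -Kindred.b 4 ag 1) ∧
    (∀ i : ℕ, 1 ≤ i → i ≤ 5 → Kindred.c 4 ag i = (-1) ^ (i + 1) * Kindred.c 4 af i) ∧
    (∀ m : ℕ, 1 ≤ m → m ≤ 4 → ∀ X : ℝ,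
      (Kindred.T 4 ag m).eval X = (-1) ^ m * (Kindred.T 4 af m).eval (-X)) ∧
    (∀ m : ℕ, m ≤ 4 → ∀ X : ℝ,
      (Kindred.P 4 ag m).eval X = (-1) ^ m * (Kindred.P 4 af m).eval (-X)) := by
  open Kindred in
  refine ⟨⟨isReversion_fSeries.1, isReversion_fSeries.2.1⟩,
    ⟨fun n => coeff_reversion_eq_zero (n := n), ?_, ?_, ?_, ?_, ?_, ?_⟩, radius_gSeries_pos, ?_⟩
  · simpa [coeff_zero_rationalV, -PowerSeries.coeff_zero_eq_constantCoeff] using coeff_reversion 0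
  · rw [coeff_reversion 1, coeff_one_rationalV]; ring
  · rw [coeff_reversion 2, coeff_two_rationalV]; ring
  · rw [coeff_reversion 3, coeff_three_rationalV]; ring
  · rw [coeff_reversion 4, coeff_four_rationalV]; ring
  · rw [coeff_reversion 5, coeff_five_rationalV]; ring
  rintro ag af rfl rfl
  refine ⟨lam_gSeries, b_gSeries, aa_zero_gSeries,
    ⟨c_one_gSeries, c_two_gSeries, c_three_gSeries, c_four_gSeries, c_five_gSeries⟩,
    fun X => ⟨eval_T_two_gSeries X, eval_T_three_gSeries X, eval_T_four_gSeries X⟩,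
    fun X => ⟨eval_P_two_gSeries X, eval_P_three_gSeries X, eval_P_four_gSeries X⟩,
    fun x₀ h h' => ⟨fun n => ⟨(iterate_g_mem h h' (n + 1)).1, iterate_g_lt h h' n⟩, ?_⟩,
    fun x₀ h => ⟨fun n => ⟨iterate_fresnelC_pos h (n + 1), iterate_fresnelC_lt h n⟩, ?_⟩,
    gTerm_eq, ⟨lam_fSeries.trans lam_gSeries.symm, by rw [b_fSeries.1, b_gSeries.1, neg_neg]⟩,
    c_gSeries_eq, eval_T_gSeries_eq, eval_P_gSeries_eq⟩
  · obtain ⟨C, hC⟩ := exists_expandsAs_g h h' (gapCoeff_one_neg gapCoeff_gSeries_one)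
    exact ⟨C, hC, hC.div_of_eq _ fun n hn => formulaA_gSeries_div C hn⟩
  · obtain ⟨C, hC⟩ := exists_expandsAs_fresnelC h (gapCoeff_one_neg gapCoeff_fSeries_one)
    -- Formula (B) is stated with $-C$, so the constant of the Fresnel cosine is the negative of the
    -- one produced by the general expansion.
    rw [← neg_neg C] at hC
    exact ⟨-C, hC, hC.div_of_eq _ fun n hn => formulaA_fSeries_div (-C) hn⟩
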